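/- Let $H$ be a separable complex Hilbert space and let $\alpha:[0,1]\to[0,\infty)$ be of class $C^2$ with $\{t\in[0,1]:\alpha(t)=0\}$ a Lebesgue null set. Let $L^2_\alpha=L^2_\alpha(H,(0,1))$ be the Hilbert space of $H$-valued functions with inner product $\int_0^1\langle u(t),v(t)\rangle_H\,\alpha(t)\,dt$. Let $A(t)=A_r(t)+iA_i(t)$ have a dense domain $D\subset H$ independent of $t\in(0,1)$, where $A_r(t)$ ($t\in(0,1)$) and $A_i(t)$ ($t\in[0,1]$, with $D\subset D(A_i(t))$) are (possibly unbounded) self-adjoint operators, $A_r(t)$ and $A_i(t)$ commute (i.e. their resolvents commute) for every $t\in(0,1)$, and for each $f\in D$ the functions $A_r(t)f$ and $A_i(t)f$ are continuously differentiable on $(0,1)$ and on $[0,1]$, respectively. Assume $$A_r(t)=\frac{\alpha'(t)}{2\alpha(t)}I+C\quad\text{for a.e. }t\in(0,1)$$ with a constant self-adjoint operator $C\ge 0$ (possibly unbounded). Let $L_0$ be the minimal operator of $l(u)=u'+A(t)u$ in $L^2_\alpha$, i.e. the closure of $u\mapsto l(u)$ on the finite sums $\sum_k\varphi_k(t)f_k$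 with $\varphi_k\in C_0^\infty(0,1)$, $f_k\in D$; let $L_0^+$ be the minimal operator constructed in the same way from the formally adjoint expression $l^+(v)=-\frac{(\alpha v)'}{\alpha}+A(t)^*v$; and let $L=(L_0^+)^*$, $L^+=L_0^*$ be the maximal operators. Let $U(t,s)$, $t,s\in[0,1]$, be the bounded evolution operators of $y'+iA_i(t)y=0$: for $f\in D$, $t\mapsto U(t,s)f$ is the continuously differentiable $D$-valued solution with $U(s,s)f=f$. Let $W$ be a unitary operator in $H$ with $CW=WC$, and let $L_W$ be the normal extension of $L_0$ determined by $W$, i.e. the restriction of $L$ to the $u\in D(L)\cap D(L^+)$ for which $\sqrt\alpha\,u$ has a representative that is continuous on $[0,1]$ and satisfies $$(\sqrt\alpha\,u)(1)=U(1,0)\,W\,(\sqrt\alpha\,u)(0).$$ Then the spectrum of $L_W$ is $$\sigma(L_W)=\bigl\{\ln|\mu|^{-1}+i\,(2n\pi-\arg\mu)\;:\;n\in\mathbb Z,\ \mu\in\sigma\bigl(W^*e^{-C}\bigr),\ \mu\neq0\bigr\}.$$ -/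

import Mathlib

open MeasureTheory Set
open scoped ContDiff InnerProductSpace

noncomputable section

namespace NormalExt

/-! ### Unbounded operators -/

section Operators

variable {E : Type*} [NormedAddCommGroup E] [InnerProductSpace ℂ E]

/-- The value `T x` of a partially defined operator, extended by `0` outside the domain of `T`.
It is only used at points of the domain. -/
def app (T : E →ₗ.[ℂ] E) (x : E) : E :=
  open Classical in if hx : x ∈ T.domain then T ⟨x, hx⟩ else 0

theorem app_of_mem (T : E →ₗ.[ℂ] E) {x : E} (hx : x ∈ T.domain) : app T x = T ⟨x, hx⟩ := by
  simp [app, hx]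

/-- `R` is the bounded everywhere defined inverse `(T - z)⁻¹`. -/
structure IsResolventAt (T : E →ₗ.[ℂ] E) (z : ℂ) (R : E →L[ℂ] E) : Prop where
  mem_domain : ∀ x : E, R x ∈ T.domain
  right_inv : ∀ x : E, app T (R x) - z • R x = x
  left_inv : ∀ x ∈ T.domain, R (app T x - z • x) = x

/-- The spectrum of an unbounded operator: all `z` for which `T - z` has no bounded everywhere
defined inverse. -/
def unboundedSpectrum (T : E →ₗ.[ℂ] E) : Set ℂ :=
  {z | ¬ ∃ R : E →L[ℂ] E, IsResolventAt T z R}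

/-- The resolvent `(T - z)⁻¹` (and `0` if `z` belongs to the spectrum). -/
def resolventOp (T : E →ₗ.[ℂ] E) (z : ℂ) : E →L[ℂ] E :=
  open Classical in
  if h : ∃ R : E →L[ℂ] E, IsResolventAt T z R then h.choose else 0

/-- Commutation of two unbounded self-adjoint operators: all their resolvents commute
(equivalently, their spectral measures commute). -/
def StronglyCommute (S T : E →ₗ.[ℂ] E) : Prop :=
  ∀ (z w : ℂ) (R Q : E →L[ℂ] E), IsResolventAt S z R → IsResolventAt T w Q → Commute R Q

/-- `W C = C W` for a bounded `W` and an unbounded `C`, including equality of the domains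
`D(W C) = D(C)` and `D(C W) = {x | W x ∈ D(C)}`. -/
def BoundedCommutes (W : E →L[ℂ] E) (C : E →ₗ.[ℂ] E) : Prop :=
  (∀ x : E, x ∈ C.domain ↔ W x ∈ C.domain) ∧ ∀ x ∈ C.domain, W (app C x) = app C (W x)

/-- The operator `e^{-C}` of a nonnegative self-adjoint, possibly unbounded `C`. With
`J = (1 + C)⁻¹`, a bounded self-adjoint operator with spectrum in `[0, 1]`, one has `C = J⁻¹ - 1`,
so `e^{-C}` is the function `s ↦ e^{1 - 1/s}` (with value `0` at `s = 0`) of `J`. -/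
def expNeg [CompleteSpace E] (C : E →ₗ.[ℂ] E) : E →L[ℂ] E :=
  cfc (fun s : ℝ => if s ≤ 0 then 0 else Real.exp (1 - 1 / s)) (resolventOp C (-1))

end Operators

/-! ### The weighted space -/

/-- The weight: `α : [0,1] → [0,∞)` of class `C²` whose zero set is a null set. -/
structure IsWeight (α : ℝ → ℝ) : Prop where
  contDiffOn : ContDiffOn ℝ 2 α (Icc 0 1)
  nonneg : ∀ t ∈ Icc (0 : ℝ) 1, 0 ≤ α t
  zeros_null : volume {t : ℝ | t ∈ Icc (0 : ℝ) 1 ∧ α t = 0} = 0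

/-- The measure `α(t) dt` on `(0,1)`. -/
def weightMeasure (α : ℝ → ℝ) : Measure ℝ :=
  (volume.restrict (Ioo (0 : ℝ) 1)).withDensity (fun t => ENNReal.ofReal (α t))

/-- The weighted Hilbert space `L²_α(H,(0,1))`, with inner product
`∫₀¹ ⟪u t, v t⟫ α(t) dt`. -/
abbrev WeightedL2 (H : Type*) [NormedAddCommGroup H] (α : ℝ → ℝ) : Type _ :=
  Lp H 2 (weightMeasure α)

section Differential

variable {H : Type*} [NormedAddCommGroup H] [InnerProductSpace ℂ H]

/-! ### The coefficient -/

/-- The operator coefficient `A(t) = A_r(t) + i A_i(t)`. -/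
def coeff (Ar Ai : ℝ → H →ₗ.[ℂ] H) (t : ℝ) : H →ₗ.[ℂ] H :=
  Ar t + Complex.I • Ai t

/-- The standing assumptions on the coefficient `A(t) = A_r(t) + i A_i(t)` with constant domain
`D`, including the normality condition `A_r(t) = α'(t) / (2 α(t)) + C`, `C ≥ 0`. -/
structure IsNormalCoeff [CompleteSpace H] (α : ℝ → ℝ) (Ar Ai : ℝ → H →ₗ.[ℂ] H)
    (C : H →ₗ.[ℂ] H) (D : Submodule ℂ H) : Prop where
  dense : Dense (D : Set H)
  domain_eq : ∀ t ∈ Ioo (0 : ℝ) 1, (coeff Ar Ai t).domain = D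
  le_domain_im : ∀ t ∈ Icc (0 : ℝ) 1, D ≤ (Ai t).domain
  selfAdjoint_re : ∀ t ∈ Ioo (0 : ℝ) 1, IsSelfAdjoint (Ar t)
  selfAdjoint_im : ∀ t ∈ Icc (0 : ℝ) 1, IsSelfAdjoint (Ai t)
  commute : ∀ t ∈ Ioo (0 : ℝ) 1, StronglyCommute (Ar t) (Ai t)
  contDiff_re : ∀ f ∈ D, ContDiffOn ℝ 1 (fun t => app (Ar t) f) (Ioo 0 1)
  contDiff_im : ∀ f ∈ D, ContDiffOn ℝ 1 (fun t => app (Ai t) f) (Icc 0 1)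
  selfAdjoint_const : IsSelfAdjoint C
  nonneg_const : ∀ x : C.domain, 0 ≤ (⟪C x, (x : H)⟫_ℂ).re
  re_eq : ∀ᵐ t ∂(volume.restrict (Ioo (0 : ℝ) 1)),
    Ar t = (((deriv α t / (2 * α t) : ℝ) : ℂ) • (LinearMap.id : H →ₗ[ℂ] H)) +ᵥ C

/-- `U(t,s)`, `t, s ∈ [0,1]`, is the family of evolution operators of `y' + i A_i(t) y = 0`:
for `f ∈ D`, the function `t ↦ U(t,s) f` is the classical (continuously differentiable,
`D`-valued) solution with value `f` at `t = s`. -/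
structure IsEvolutionFamily (D : Submodule ℂ H) (Ai : ℝ → H →ₗ.[ℂ] H)
    (U : ℝ → ℝ → H →L[ℂ] H) : Prop where
  mem_domain : ∀ t ∈ Icc (0 : ℝ) 1, ∀ s ∈ Icc (0 : ℝ) 1, ∀ f ∈ D, U t s f ∈ D
  contDiffOn : ∀ s ∈ Icc (0 : ℝ) 1, ∀ f ∈ D, ContDiffOn ℝ 1 (fun t => U t s f) (Icc 0 1)
  hasDerivWithinAt : ∀ t ∈ Icc (0 : ℝ) 1, ∀ s ∈ Icc (0 : ℝ) 1, ∀ f ∈ D,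
    HasDerivWithinAt (fun r => U r s f) (-(Complex.I • app (Ai t) (U t s f))) (Icc 0 1) t
  initial : ∀ s ∈ Icc (0 : ℝ) 1, ∀ f ∈ D, U s s f = f

/-! ### Minimal and maximal operators -/

/-- Complex test functions of the class `C_0^∞(0,1)`. -/
def IsTestFun (φ : ℝ → ℂ) : Prop :=
  ContDiff ℝ ∞ φ ∧ HasCompactSupport φ ∧ tsupport φ ⊆ Ioo 0 1

/-- `L₀'`: the operator `u ↦ u' + A(t) u` on the finite sums of functions `φ(t) f`, with `φ` a test
function and `f ∈ D`, given through its graph in `L²_α × L²_α`. -/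
def preMinimal (α : ℝ → ℝ) (Ar Ai : ℝ → H →ₗ.[ℂ] H) (D : Submodule ℂ H) :
    WeightedL2 H α →ₗ.[ℂ] WeightedL2 H α :=
  (Submodule.span ℂ {p : WeightedL2 H α × WeightedL2 H α |
    ∃ φ : ℝ → ℂ, IsTestFun φ ∧ ∃ f ∈ D,
      (∀ᵐ t ∂(weightMeasure α), p.1 t = φ t • f) ∧
      (∀ᵐ t ∂(weightMeasure α),
        p.2 t = deriv φ t • f + φ t • app (coeff Ar Ai t) f)}).toLinearPMap

/-- The same construction for the formally adjoint expression `v ↦ -(α v)' / α + A(t)^* v`. -/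
def preMinimalPlus [CompleteSpace H] (α : ℝ → ℝ) (Ar Ai : ℝ → H →ₗ.[ℂ] H)
    (D : Submodule ℂ H) : WeightedL2 H α →ₗ.[ℂ] WeightedL2 H α :=
  (Submodule.span ℂ {p : WeightedL2 H α × WeightedL2 H α |
    ∃ φ : ℝ → ℂ, IsTestFun φ ∧ ∃ f ∈ D,
      (∀ᵐ t ∂(weightMeasure α), p.1 t = φ t • f) ∧
      (∀ᵐ t ∂(weightMeasure α),
        p.2 t = -((deriv (fun s => (α s : ℂ) * φ s) t / (α t : ℂ)) • f)
          + φ t • app (coeff Ar Ai t).adjoint f)}).toLinearPMap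

variable [CompleteSpace H]

/-- The minimal operator `L₀`, the closure of `L₀'`. -/
def minimalOp (α : ℝ → ℝ) (Ar Ai : ℝ → H →ₗ.[ℂ] H) (D : Submodule ℂ H) :
    WeightedL2 H α →ₗ.[ℂ] WeightedL2 H α :=
  (preMinimal α Ar Ai D).closure

/-- The minimal operator `L₀⁺` of the formally adjoint expression. -/
def minimalOpPlus (α : ℝ → ℝ) (Ar Ai : ℝ → H →ₗ.[ℂ] H) (D : Submodule ℂ H) :
    WeightedL2 H α →ₗ.[ℂ] WeightedL2 H α :=
  (preMinimalPlus α Ar Ai D).closure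

/-- The maximal operator `L = (L₀⁺)^*`. -/
def maximalOp (α : ℝ → ℝ) (Ar Ai : ℝ → H →ₗ.[ℂ] H) (D : Submodule ℂ H) :
    WeightedL2 H α →ₗ.[ℂ] WeightedL2 H α :=
  (minimalOpPlus α Ar Ai D).adjoint

/-- The maximal operator `L⁺ = L₀^*` of the formally adjoint expression. -/
def maximalOpPlus (α : ℝ → ℝ) (Ar Ai : ℝ → H →ₗ.[ℂ] H) (D : Submodule ℂ H) :
    WeightedL2 H α →ₗ.[ℂ] WeightedL2 H α :=
  (minimalOp α Ar Ai D).adjoint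

/-! ### The extension `L_W` -/

/-- The boundary condition `(√α u)(1) = V (√α u)(0)`: the function `√α u` has a representative `w`
that is continuous on `[0,1]`, and `w 1 = V (w 0)`. -/
def boundaryCondition (α : ℝ → ℝ) (V : H →L[ℂ] H) : Submodule ℂ (WeightedL2 H α) where
  carrier := {u | ∃ w : ℝ → H, ContinuousOn w (Icc 0 1) ∧
    (∀ᵐ t ∂(weightMeasure α), ((Real.sqrt (α t) : ℝ) : ℂ) • u t = w t) ∧ w 1 = V (w 0)}
  add_mem' := by
    rintro u v ⟨w, hw, huw, hbw⟩ ⟨w', hw', hvw, hbw'⟩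
    refine ⟨fun t => w t + w' t, hw.add hw', ?_, by simp [hbw, hbw']⟩
    filter_upwards [huw, hvw, Lp.coeFn_add u v] with t h1 h2 h3
    rw [h3, Pi.add_apply, smul_add, h1, h2]
  zero_mem' := by
    refine ⟨fun _ => 0, continuousOn_const, ?_, by simp⟩
    filter_upwards [Lp.coeFn_zero H 2 (weightMeasure α)] with t h
    rw [h]
    simp
  smul_mem' := by
    rintro c u ⟨w, hw, huw, hbw⟩
    refine ⟨fun t => c • w t, hw.const_smul c, ?_, by simp [hbw]⟩
    filter_upwards [huw, Lp.coeFn_smul c u] with t h1 h2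
    rw [h2, Pi.smul_apply, smul_comm, h1]

/-- The extension `L_W`: the restriction of the maximal operator `L` to those
`u ∈ D(L) ∩ D(L⁺)` with `(√α u)(1) = U(1,0) W (√α u)(0)`. -/
def extensionOp (α : ℝ → ℝ) (Ar Ai : ℝ → H →ₗ.[ℂ] H) (D : Submodule ℂ H)
    (U : ℝ → ℝ → H →L[ℂ] H) (W : H →L[ℂ] H) : WeightedL2 H α →ₗ.[ℂ] WeightedL2 H α :=
  (maximalOp α Ar Ai D).domRestrict
    ((maximalOpPlus α Ar Ai D).domain ⊓ boundaryCondition α (U 1 0 * W))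

end Differential

end NormalExt

end

/-! ### The scalar functions behind `e^{-tC}` and their functional calculus in `J = (1 + C)⁻¹`. -/

noncomputable section

namespace NormalExt
open Filter Topology

/-! Put `V t = U(t,0)` and `E = e^{-C}`. The factor `√α` absorbs the term `α'/(2α)` of `A_r`, and
the unitary `V t`, which commutes with `C`, absorbs `i A_i`. Under the unitary map `y ↦ V y / √α`
from `L²(H,(0,1))` onto `L²_α` (`exists_weightedEquiv`) the expression `l` becomes `y' + C y`, `l⁺`
becomes `-y' + C y`, and the boundary condition becomes `y(1) = W y(0)`. The mild solution of `y' +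
C y = λ y + γ` is `e^{-t(C-λ)} y(0)` plus a Duhamel integral, so the boundary condition reads `(W -
e^λ E) y(0) = d`, where `d` is the Duhamel integral at time 1. Hence `λ` is a regular point of `L_W`
exactly when `W - e^λ E` is invertible. Since `W - e^λ E = e^λ W (e^{-λ} - W^* E)`, this means
`e^{-λ} ∉ σ(W^* E)`, and the numbers in the formula are the solutions `λ` of `e^{-λ} = μ`.

Invertibility gives the resolvent (`exists_isResolventAt_extensionOp`). The delicate point is that
the solutions lie in `D(L⁺)`. For smooth `y` with `y(1) = W y(0)`, the integral of `2 Re ⟪C y, y'⟫`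
is the increment of `⟪C y, y⟫` over `[0,1]`, which vanishes because `W` is an isometry commuting
with `C`. So `-y' + C y` and `y' + C y` have equal norms (`exists_mem_graph_smoothed`); smoothing by
`e^{-2εC}` and weak closedness of adjoints extend membership to all mild solutions. Uniqueness comes
from showing that an element of the kernel of `L_W - λ` is a mild solution
(`isMildSolution_of_mem_graph`), hence equals `e^{-t(C-λ)} y(0)`.

Conversely, a bounded resolvent is applied to explicit functions satisfying the boundary condition,
which yields `‖E² x‖ ≤ c ‖(W - e^λ E) x‖` (`exists_norm_semigroup_le`). As `W` is isometric, this
bounds `W - e^λ E` from below, and a normal operator bounded below is invertible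
(`isUnit_of_isResolventAt`).

Before all this, the zeros of `α` inside `(0,1)` are excluded (`IsWeight.pos`): continuity of
`A_r(t) f` turns the normality condition into a linear differential equation for `α`. -/

/-- The function `s ↦ exp (t (1 - 1 / s))`, extended by `0` to `s ≤ 0`. -/
def decay (t s : ℝ) : ℝ := if s ≤ 0 then 0 else Real.exp (t * (1 - 1 / s))

theorem decay_nonneg (t s : ℝ) : 0 ≤ decay t s := by
  unfold decay; split_ifs <;> positivity

theorem decay_le_one {t s : ℝ} (ht : 0 ≤ t) (hs : s ∈ Icc (0 : ℝ) 1) : decay t s ≤ 1 := by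
  unfold decay
  split_ifs with h
  · exact zero_le_one
  · push Not at h
    rw [Real.exp_le_one_iff]
    have : 1 ≤ 1 / s := by rw [le_div_iff₀ h]; linarith [hs.2]
    nlinarith

/-- The bound `e^x ≥ x² / 2` at `x = t / s`. Quadratic vanishing at `s = 0` is what keeps `decay t s
/ s` continuous there. -/
theorem decay_le_sq {t s : ℝ} (ht : 0 < t) (_ : 0 ≤ s) :
    decay t s ≤ Real.exp t * (2 / t ^ 2) * s ^ 2 := by
  unfold decay
  split_ifs with h
  · positivity
  · push Not at h
    have h1 := Real.quadratic_le_exp_of_nonneg (x := t / s) (by positivity)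
    have h2 : (t / s) ^ 2 / 2 ≤ Real.exp (t / s) := by
      have : 0 ≤ t / s := by positivity
      linarith
    have h3 : Real.exp (t * (1 - 1 / s)) = Real.exp t * (Real.exp (t / s))⁻¹ := by
      rw [← Real.exp_neg, ← Real.exp_add]; congr 1; ring
    rw [h3, mul_assoc]
    gcongr
    rw [inv_le_comm₀ (Real.exp_pos _) (by positivity)]
    refine le_trans (le_of_eq ?_) h2
    field_simp

theorem decay_add {t r : ℝ} (s : ℝ) : decay (t + r) s = decay t s * decay r s := by
  unfold decay
  split_ifs
  · simp
  · rw [← Real.exp_add]; congr 1; ring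

/-- In terms of `c = 1/s - 1` the function is `(1 + c) e^{-tc}`, which tends to `0` as `c → ∞`; so
`(1 + C) e^{-tC}` is bounded for `t > 0`. -/
theorem continuousOn_decay_div {t : ℝ} (ht : 0 < t) :
    ContinuousOn (fun s => decay t s / s) (Icc 0 1) := by
  intro s hs
  rcases eq_or_lt_of_le hs.1 with h0 | h0
  · subst h0
    have hv : decay t 0 / 0 = 0 := by simp
    rw [ContinuousWithinAt, hv]
    have hlim : Tendsto (fun s : ℝ => Real.exp t * (2 / t ^ 2) * s) (𝓝[Icc 0 1] 0) (𝓝 0) := by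
      have : Continuous (fun s : ℝ => Real.exp t * (2 / t ^ 2) * s) := by fun_prop
      have h := this.tendsto 0
      simp only [mul_zero] at h
      exact h.mono_left nhdsWithin_le_nhds
    refine squeeze_zero' ?_ ?_ hlim
    · filter_upwards [self_mem_nhdsWithin] with s hs
      exact div_nonneg (decay_nonneg _ _) hs.1
    · filter_upwards [self_mem_nhdsWithin] with s hs
      rcases eq_or_lt_of_le hs.1 with h | h
      · subst h; simp
      · rw [div_le_iff₀ h]
        have := decay_le_sq ht hs.1
        nlinarith
  · have : (fun s => decay t s / s) =ᶠ[𝓝 s] fun s => Real.exp (t * (1 - 1 / s)) / s := by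
      filter_upwards [lt_mem_nhds h0] with r hr
      rw [decay, if_neg (not_le.2 hr)]
    refine ContinuousAt.continuousWithinAt ?_
    refine ContinuousAt.congr ?_ this.symm
    have hne : s ≠ 0 := h0.ne'
    fun_prop (disch := assumption)

theorem continuousOn_decay {t : ℝ} (ht : 0 < t) : ContinuousOn (decay t) (Icc 0 1) := by
  refine ((continuousOn_decay_div ht).mul continuousOn_id).congr ?_
  intro s hs
  rcases eq_or_lt_of_le hs.1 with h | h
  · subst h; simp [decay]
  · simp [h.ne']

/-- With `s = 1/(1 + c)` this is `|e^{-tc} - 1| ≤ t c ≤ t (1 + c)`. It controls `e^{-tC} - 1` on the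
range of `J`. -/
theorem abs_decay_sub_one_mul_le {t s : ℝ} (ht : 0 ≤ t) (hs : s ∈ Icc (0 : ℝ) 1) :
    |(decay t s - 1) * s| ≤ t := by
  unfold decay
  split_ifs with h
  · rw [le_antisymm h hs.1]; simpa using ht
  · push Not at h
    have hc : 1 ≤ 1 / s := by rw [le_div_iff₀ h]; linarith [hs.2]
    have h1 : Real.exp (t * (1 - 1 / s)) ≤ 1 := by rw [Real.exp_le_one_iff]; nlinarith
    have h2 := Real.add_one_le_exp (t * (1 - 1 / s))
    rw [abs_le]
    have h3 : t * (1 - 1 / s) * s = t * s - t := by field_simp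
    constructor
    · nlinarith [hs.1]
    · nlinarith [hs.1]

/-- With `s = 1/(1 + c)` one has `(1 - s) s = c s²`, so the quantity is the Taylor remainder
`e^{-tc} - 1 + t c` divided by `(1 + c)²`. It identifies `-C` as the generator. -/
theorem abs_decay_taylor_le {t s : ℝ} (ht : 0 ≤ t) (hs : s ∈ Icc (0 : ℝ) 1) :
    |(decay t s - 1) * s ^ 2 + t * ((1 - s) * s)| ≤ t ^ 2 := by
  unfold decay
  split_ifs with h
  · rw [le_antisymm h hs.1]; simp; positivity
  · push Not at h
    have hc : 1 ≤ 1 / s := by rw [le_div_iff₀ h]; linarith [hs.2]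
    set x := t * (1 - 1 / s) with hx
    have hx0 : x ≤ 0 := by rw [hx]; nlinarith
    have h1 := Real.add_one_le_exp x
    -- From `e^{-x} ≥ 1 - x` one gets `e^x (1 - x) ≤ 1`, while `(1 + x + x²)(1 - x) = 1 - x³ ≥ 1`
    -- for `x ≤ 0`.
    have h4 : Real.exp x ≤ 1 + x + x ^ 2 := by
      have h5 := Real.add_one_le_exp (-x)
      rw [Real.exp_neg] at h5
      have h6 : Real.exp x * (1 - x) ≤ 1 := by
        have h7 := Real.exp_pos x
        calc Real.exp x * (1 - x) ≤ Real.exp x * (Real.exp x)⁻¹ := by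
              gcongr; linarith
          _ = 1 := mul_inv_cancel₀ h7.ne'
      have h8 : 1 ≤ (1 + x + x ^ 2) * (1 - x) := by nlinarith [pow_two_nonneg x]
      have : 0 < 1 - x := by linarith
      exact le_of_mul_le_mul_right (h6.trans h8) this
    have h3 : x * s = t * s - t := by rw [hx]; field_simp
    have h9 : (Real.exp x - 1) * s ^ 2 + t * ((1 - s) * s) = (Real.exp x - 1 - x) * s ^ 2 := by
      linear_combination s * h3
    rw [h9, abs_of_nonneg (mul_nonneg (by linarith) (sq_nonneg s))]
    calc (Real.exp x - 1 - x) * s ^ 2 ≤ x ^ 2 * s ^ 2 := by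
          gcongr; linarith
      _ = (t * (1 - s)) ^ 2 := by rw [← mul_pow, h3]; ring
      _ ≤ t ^ 2 := by
          gcongr
          · exact mul_nonneg ht (by linarith [hs.2])
          · nlinarith [hs.1]

variable {H : Type*} [NormedAddCommGroup H] [InnerProductSpace ℂ H] [CompleteSpace H]

/-- The properties of `J = (1 + C)⁻¹` for a nonnegative self-adjoint operator `C`. -/
structure IsPosResolvent (J : H →L[ℂ] H) : Prop where
  selfAdjoint : IsSelfAdjoint J
  spectrum_subset : spectrum ℝ J ⊆ Icc 0 1
  injective : Function.Injective J

/-- The semigroup `e^{-t C}`, `t ≥ 0`, where `J = (1 + C)⁻¹`. -/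
def semigroup (J : H →L[ℂ] H) (t : ℝ) : H →L[ℂ] H :=
  -- The function `decay 0` jumps from `0` to `1` at `s = 0`, which may lie in the spectrum of `J`,
  -- so the continuous functional calculus cannot supply the value at `t = 0`.
  open Classical in if t = 0 then 1 else cfc (decay t) J

/-- The operator `(1 + C) e^{-t C}`, `t > 0`, where `J = (1 + C)⁻¹`. -/
def smoothing (J : H →L[ℂ] H) (t : ℝ) : H →L[ℂ] H := cfc (fun s => decay t s / s) J

theorem semigroup_zero (J : H →L[ℂ] H) : semigroup J 0 = 1 := by simp [semigroup]

theorem semigroup_of_pos (J : H →L[ℂ] H) {t : ℝ} (ht : 0 < t) :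
    semigroup J t = cfc (decay t) J := by simp [semigroup, ht.ne']

theorem expNeg_eq_semigroup (C : H →ₗ.[ℂ] H) :
    expNeg C = semigroup (resolventOp C (-1)) 1 := by
  rw [semigroup_of_pos _ one_pos, expNeg]
  congr 1
  funext s
  simp [decay]

theorem isSelfAdjoint_semigroup (J : H →L[ℂ] H) (t : ℝ) : IsSelfAdjoint (semigroup J t) := by
  unfold semigroup
  split_ifs
  · exact .one _
  · exact cfc_predicate _ _

theorem commute_semigroup {J : H →L[ℂ] H} {T : H →L[ℂ] H} (hT : Commute J T) (t : ℝ) :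
    Commute (semigroup J t) T := by
  unfold semigroup
  split_ifs
  · exact Commute.one_left T
  · exact hT.cfc_real _

theorem commute_smoothing {J : H →L[ℂ] H} {T : H →L[ℂ] H} (hT : Commute J T) (t : ℝ) :
    Commute (smoothing J t) T := hT.cfc_real _

namespace IsPosResolvent

variable {J : H →L[ℂ] H}

theorem continuousOn_decay (hJ : IsPosResolvent J) {t : ℝ} (ht : 0 < t) : ContinuousOn (decay t) (spectrum ℝ J) :=
  (NormalExt.continuousOn_decay ht).mono hJ.spectrum_subset

theorem norm_semigroup_le (hJ : IsPosResolvent J) {t : ℝ} (ht : 0 ≤ t) : ‖semigroup J t‖ ≤ 1 := by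
  rcases eq_or_lt_of_le ht with h | h
  · rw [← h, semigroup_zero]; exact ContinuousLinearMap.norm_id_le
  · rw [semigroup_of_pos J h]
    refine norm_cfc_le zero_le_one fun s hs => ?_
    rw [Real.norm_of_nonneg (decay_nonneg _ _)]
    exact decay_le_one ht (hJ.spectrum_subset hs)

theorem norm_semigroup_apply_le (hJ : IsPosResolvent J) {t : ℝ} (ht : 0 ≤ t) (x : H) : ‖semigroup J t x‖ ≤ ‖x‖ := by
  simpa using (semigroup J t).le_of_opNorm_le (hJ.norm_semigroup_le ht) x

theorem semigroup_add (hJ : IsPosResolvent J) {t r : ℝ} (ht : 0 ≤ t) (hr : 0 ≤ r) :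
    semigroup J (t + r) = semigroup J t * semigroup J r := by
  rcases eq_or_lt_of_le ht with h | h
  · rw [← h, semigroup_zero]; simp
  rcases eq_or_lt_of_le hr with h' | h'
  · rw [← h', semigroup_zero]; simp
  rw [semigroup_of_pos J h, semigroup_of_pos J h', semigroup_of_pos J (by positivity),
    ← cfc_mul _ _ J (hJ.continuousOn_decay h) (hJ.continuousOn_decay h')]
  congr 1
  funext s
  exact decay_add s

theorem semigroup_add_apply (hJ : IsPosResolvent J) {t r : ℝ} (ht : 0 ≤ t) (hr : 0 ≤ r) (x : H) :
    semigroup J (t + r) x = semigroup J t (semigroup J r x) := by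
  rw [hJ.semigroup_add ht hr]; rfl

/-- This shows that `e^{-tC}` maps into the range of `J`, that is, into the domain of `C`. -/
theorem mul_smoothing (hJ : IsPosResolvent J) {t : ℝ} (ht : 0 < t) : J * smoothing J t = semigroup J t := by
  have hc : ContinuousOn (fun s => decay t s / s) (spectrum ℝ J) :=
    (continuousOn_decay_div ht).mono hJ.spectrum_subset
  rw [semigroup_of_pos J ht, smoothing]
  nth_rewrite 1 [← cfc_id ℝ J hJ.selfAdjoint]
  rw [← cfc_mul _ _ J continuousOn_id hc]
  refine cfc_congr fun s hs => ?_
  rcases eq_or_lt_of_le (hJ.spectrum_subset hs).1 with h | h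
  · subst h; simp [decay]
  · simp only [id]; field_simp

theorem semigroup_eq (hJ : IsPosResolvent J) {t : ℝ} (ht : 0 < t) (x : H) : semigroup J t x = J (smoothing J t x) := by
  rw [← hJ.mul_smoothing ht]; rfl

theorem norm_semigroup_sub_one_mul_le (hJ : IsPosResolvent J) {t : ℝ} (ht : 0 ≤ t) :
    ‖(semigroup J t - 1) * J‖ ≤ t := by
  rcases eq_or_lt_of_le ht with h | h
  · rw [← h, semigroup_zero]; simp
  · have hc := hJ.continuousOn_decay h
    have : (semigroup J t - 1) * J = cfc (fun s => (decay t s - 1) * s) J := by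
      rw [cfc_mul _ _ J (by fun_prop) (by fun_prop), cfc_sub _ _ J hc (by fun_prop),
        cfc_const_one ℝ J hJ.selfAdjoint, cfc_id' ℝ J hJ.selfAdjoint, semigroup_of_pos J h]
    rw [this]
    exact norm_cfc_le ht fun s hs => abs_decay_sub_one_mul_le ht (hJ.spectrum_subset hs)

theorem norm_semigroup_taylor_le (hJ : IsPosResolvent J) {t : ℝ} (ht : 0 ≤ t) :
    ‖(semigroup J t - 1) * J ^ 2 + (t : ℂ) • ((1 - J) * J)‖ ≤ t ^ 2 := by
  rcases eq_or_lt_of_le ht with h | h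
  · rw [← h, semigroup_zero]; simp
  · have hc := hJ.continuousOn_decay h
    have : (semigroup J t - 1) * J ^ 2 + (t : ℂ) • ((1 - J) * J) =
        cfc (fun s => (decay t s - 1) * s ^ 2 + t * ((1 - s) * s)) J := by
      rw [cfc_add J _ _ (by fun_prop) (by fun_prop), cfc_mul _ _ J (by fun_prop) (by fun_prop),
        cfc_sub _ _ J hc (by fun_prop),
        cfc_const_one ℝ J hJ.selfAdjoint, cfc_pow_id J 2 hJ.selfAdjoint,
        cfc_const_mul _ _ J (by fun_prop), cfc_mul _ _ J (by fun_prop) (by fun_prop),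
        cfc_sub _ _ J (by fun_prop) (by fun_prop),
        cfc_const_one ℝ J hJ.selfAdjoint, cfc_id' ℝ J hJ.selfAdjoint, semigroup_of_pos J h]
      rfl
    rw [this]
    exact norm_cfc_le (by positivity) fun s hs => abs_decay_taylor_le ht (hJ.spectrum_subset hs)

/-- The orthogonal complement of the range is the kernel of `J^* = J`, which is trivial. -/
theorem denseRange (hJ : IsPosResolvent J) : DenseRange J := by
  have h := ContinuousLinearMap.orthogonal_ker J
  have hk : J.ker = ⊥ := LinearMap.ker_eq_bot.2 hJ.injective
  have hadj : ContinuousLinearMap.adjoint J = J := hJ.selfAdjoint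
  rw [hk, hadj, Submodule.bot_orthogonal_eq_top] at h
  have := (Submodule.dense_iff_topologicalClosure_eq_top (s := J.range)).2 h.symm
  exact this

end IsPosResolvent
end NormalExt

/-! ### Strong continuity and generator of `e^{-tC}` and of `e^{-t(C-z)}`. -/

namespace NormalExt
open Filter Topology

variable {H : Type*} [NormedAddCommGroup H] [InnerProductSpace ℂ H]

/-- A three-epsilon argument: a uniform bound on the operators transports convergence from a dense
set to the whole space. -/
theorem tendsto_apply_of_dense {ι : Type*} {l : Filter ι} {T : ι → H →L[ℂ] H} {S : H →L[ℂ] H}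
    {M : ℝ} (hM : ∀ᶠ i in l, ‖T i‖ ≤ M) {s : Set H} (hs : Dense s)
    (h : ∀ x ∈ s, Tendsto (fun i => T i x) l (𝓝 (S x))) (x : H) :
    Tendsto (fun i => T i x) l (𝓝 (S x)) := by
  rw [Metric.tendsto_nhds]
  intro ε hε
  set K := |M| + ‖S‖ + 1 with hK
  have hKpos : 0 < K := by positivity
  obtain ⟨y, hy, hxy⟩ := Metric.dense_iff.1 hs x (ε / (2 * K)) (by positivity)
  have hyx : ‖x - y‖ < ε / (2 * K) := by
    rw [← dist_eq_norm, dist_comm]; exact hy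
  have h2 := (Metric.tendsto_nhds.1 (h y hxy)) (ε / 2) (by positivity)
  filter_upwards [hM, h2] with i hi hi2
  rw [dist_eq_norm] at hi2 ⊢
  have e : T i x - S x = (T i y - S y) + (T i (x - y) - S (x - y)) := by
    simp only [map_sub]; abel
  have h3 : ‖T i (x - y)‖ ≤ |M| * ‖x - y‖ :=
    ((T i).le_of_opNorm_le hi _).trans (by gcongr; exact le_abs_self M)
  have h4 := S.le_opNorm (x - y)
  have h5 : ‖T i (x - y) - S (x - y)‖ ≤ K * ‖x - y‖ := by
    refine (norm_sub_le _ _).trans ?_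
    rw [hK]; nlinarith [norm_nonneg (x - y)]
  have h6 : K * ‖x - y‖ < ε / 2 := by
    calc K * ‖x - y‖ < K * (ε / (2 * K)) := by gcongr
      _ = ε / 2 := by field_simp
  rw [e]
  exact (norm_add_le _ _).trans_lt (by linarith)

/-- Joint continuity of `t ↦ K t (x t)` for a strongly continuous bounded family `K`. -/
theorem tendsto_apply_apply {ι : Type*} {l : Filter ι} {K : ι → H →L[ℂ] H} {x : ι → H}
    {M : ℝ} (hM : ∀ᶠ i in l, ‖K i‖ ≤ M) {y z : H} (hx : Tendsto x l (𝓝 y))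
    (hK : Tendsto (fun i => K i y) l (𝓝 z)) : Tendsto (fun i => K i (x i)) l (𝓝 z) := by
  have h : Tendsto (fun i => K i (x i - y)) l (𝓝 0) := by
    have h1 : Tendsto (fun i => M * ‖x i - y‖) l (𝓝 0) := by
      have := (tendsto_iff_norm_sub_tendsto_zero.1 hx).const_mul M
      simpa using this
    refine squeeze_zero_norm' ?_ h1
    filter_upwards [hM] with i hi using (K i).le_of_opNorm_le hi _
  have := h.add hK
  simpa using this

variable [CompleteSpace H] {J : H →L[ℂ] H}

/-- The operators `e^{-t (C - z)}`. -/
def propagator (J : H →L[ℂ] H) (z : ℂ) (t : ℝ) : H →L[ℂ] H := Complex.exp (z * t) • semigroup J t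

theorem propagator_apply (z : ℂ) (t : ℝ) (x : H) :
    propagator J z t x = Complex.exp (z * t) • semigroup J t x := rfl

theorem propagator_zero (z : ℂ) : propagator J z 0 = 1 := by
  simp [propagator, semigroup_zero]

theorem norm_cexp_mul_le (z : ℂ) {t : ℝ} (ht : t ∈ Icc (0 : ℝ) 1) :
    ‖Complex.exp (z * t)‖ ≤ Real.exp ‖z‖ := by
  rw [Complex.norm_exp]
  gcongr
  refine (Complex.re_le_norm _).trans ?_
  rw [norm_mul, Complex.norm_real, Real.norm_of_nonneg ht.1]
  exact mul_le_of_le_one_right (norm_nonneg _) ht.2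

theorem commute_propagator {T : H →L[ℂ] H} (hT : Commute J T) (z : ℂ) (t : ℝ) :
    Commute (propagator J z t) T := (commute_semigroup hT t).smul_left _

namespace IsPosResolvent

theorem tendsto_semigroup_zero (hJ : IsPosResolvent J) (x : H) :
    Tendsto (fun t => semigroup J t x) (𝓝[≥] 0) (𝓝 x) := by
  have := tendsto_apply_of_dense (l := 𝓝[≥] (0 : ℝ)) (T := fun t => semigroup J t) (S := 1) (M := 1)
    (by filter_upwards [self_mem_nhdsWithin] with t ht using hJ.norm_semigroup_le ht)
    hJ.denseRange (by
      rintro _ ⟨y, rfl⟩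
      rw [tendsto_iff_norm_sub_tendsto_zero]
      have h : Tendsto (fun t : ℝ => t * ‖y‖) (𝓝[≥] 0) (𝓝 0) := by
        have : Continuous (fun t : ℝ => t * ‖y‖) := by fun_prop
        have h := this.tendsto 0
        simp only [zero_mul] at h
        exact h.mono_left nhdsWithin_le_nhds
      refine squeeze_zero' (Eventually.of_forall fun t => norm_nonneg _) ?_ h
      filter_upwards [self_mem_nhdsWithin] with t ht
      exact ((semigroup J t - 1) * J).le_of_opNorm_le (hJ.norm_semigroup_sub_one_mul_le ht) y)
  exact this x

theorem continuousOn_semigroup (hJ : IsPosResolvent J) (x : H) :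
    ContinuousOn (fun t => semigroup J t x) (Ici 0) := by
  intro s hs
  rw [ContinuousWithinAt, tendsto_iff_norm_sub_tendsto_zero]
  have habs : Tendsto (fun t : ℝ => |t - s|) (𝓝[Ici 0] s) (𝓝[≥] 0) := by
    refine tendsto_nhdsWithin_iff.2 ⟨?_, Eventually.of_forall fun t => mem_Ici.2 (abs_nonneg _)⟩
    have : Continuous (fun t : ℝ => |t - s|) := by fun_prop
    have h := this.tendsto s
    simp only [sub_self, abs_zero] at h
    exact h.mono_left nhdsWithin_le_nhds
  have h0 := (tendsto_iff_norm_sub_tendsto_zero.1 (hJ.tendsto_semigroup_zero x)).comp habs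
  refine squeeze_zero' (Eventually.of_forall fun t => norm_nonneg _) ?_ h0
  filter_upwards [self_mem_nhdsWithin] with t ht
  simp only [Function.comp]
  -- The semigroup law and contractivity reduce continuity at any time, from either side, to right
  -- continuity at `0`.
  have key : ∀ a b : ℝ, 0 ≤ a → a ≤ b →
      ‖semigroup J b x - semigroup J a x‖ ≤ ‖semigroup J (b - a) x - x‖ := by
    intro a b ha hab
    have : b = a + (b - a) := by ring
    nth_rewrite 1 [this]
    rw [hJ.semigroup_add_apply ha (sub_nonneg.2 hab), ← map_sub]
    exact hJ.norm_semigroup_apply_le ha _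
  rcases le_total s t with h | h
  · rw [abs_of_nonneg (sub_nonneg.2 h)]; exact key s t hs h
  · rw [abs_of_nonpos (sub_nonpos.2 h), neg_sub, norm_sub_rev]; exact key t s ht h

/-- The limit `J x - x` is `-C J x`. The quotients composed with `J` have norm at most `1`, so
convergence need only be checked on the range of `J`, where the Taylor estimate applies. -/
theorem tendsto_semigroup_slope (hJ : IsPosResolvent J) (x : H) :
    Tendsto (fun h : ℝ => (h : ℂ)⁻¹ • (semigroup J h (J x) - J x)) (𝓝[>] 0) (𝓝 (J x - x)) := by
  have hpos : ∀ᶠ t : ℝ in 𝓝[>] 0, 0 < t := self_mem_nhdsWithin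
  have := tendsto_apply_of_dense (l := 𝓝[>] (0 : ℝ))
    (T := fun h : ℝ => (h : ℂ)⁻¹ • ((semigroup J h - 1) * J)) (S := J - 1) (M := 1) (by
      filter_upwards [hpos] with t ht
      rw [norm_smul, norm_inv, Complex.norm_real, Real.norm_of_nonneg ht.le, inv_mul_le_one₀ ht]
      exact hJ.norm_semigroup_sub_one_mul_le ht.le)
    hJ.denseRange (by
      rintro _ ⟨y, rfl⟩
      rw [tendsto_iff_norm_sub_tendsto_zero]
      have h : Tendsto (fun t : ℝ => t * ‖y‖) (𝓝[>] 0) (𝓝 0) := by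
        have : Continuous (fun t : ℝ => t * ‖y‖) := by fun_prop
        have h := this.tendsto 0
        simp only [zero_mul] at h
        exact h.mono_left nhdsWithin_le_nhds
      refine squeeze_zero' (Eventually.of_forall fun t => norm_nonneg _) ?_ h
      filter_upwards [hpos] with t ht
      have htc : (t : ℂ) ≠ 0 := by exact_mod_cast ht.ne'
      have h1 := ((semigroup J t - 1) * J ^ 2 + (t : ℂ) • ((1 - J) * J)).le_of_opNorm_le
        (hJ.norm_semigroup_taylor_le ht.le) y
      have h2 : ((t : ℂ)⁻¹ • ((semigroup J t - 1) * J)) (J y) - (J - 1) (J y) =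
          (t : ℂ)⁻¹ • ((semigroup J t - 1) * J ^ 2 + (t : ℂ) • ((1 - J) * J) : H →L[ℂ] H) y := by
        simp [-Complex.coe_smul, pow_two, smul_smul, inv_mul_cancel₀ htc, smul_add, smul_sub]
        abel
      rw [h2, norm_smul, norm_inv, Complex.norm_real, Real.norm_of_nonneg ht.le,
        inv_mul_le_iff₀ ht]
      calc _ ≤ _ := h1
        _ = _ := by ring)
  simpa using this x

theorem norm_propagator_le (hJ : IsPosResolvent J) (z : ℂ) {t : ℝ} (ht : t ∈ Icc (0 : ℝ) 1) :
    ‖propagator J z t‖ ≤ Real.exp ‖z‖ := by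
  rw [propagator, norm_smul]
  calc _ ≤ Real.exp ‖z‖ * 1 := by
        gcongr
        · exact norm_cexp_mul_le z ht
        · exact hJ.norm_semigroup_le ht.1
    _ = _ := mul_one _

theorem propagator_add (hJ : IsPosResolvent J) (z : ℂ) {t r : ℝ} (ht : 0 ≤ t) (hr : 0 ≤ r) :
    propagator J z (t + r) = propagator J z t * propagator J z r := by
  simp only [propagator, hJ.semigroup_add ht hr, smul_mul_smul_comm, ← Complex.exp_add]
  congr 2
  push_cast; ring

theorem continuousOn_propagator (hJ : IsPosResolvent J) (z : ℂ) (x : H) :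
    ContinuousOn (fun t => propagator J z t x) (Ici 0) := by
  simp only [propagator_apply]
  exact ContinuousOn.smul (by fun_prop) (hJ.continuousOn_semigroup x)

theorem tendsto_propagator_slope (hJ : IsPosResolvent J) (z : ℂ) (x : H) :
    Tendsto (fun h : ℝ => (h : ℂ)⁻¹ • (propagator J z h (J x) - J x)) (𝓝[>] 0)
      (𝓝 (z • J x + (J x - x))) := by
  have hexp : Tendsto (fun h : ℝ => Complex.exp (z * h)) (𝓝[>] 0) (𝓝 1) := by
    have : Continuous (fun h : ℝ => Complex.exp (z * h)) := by fun_prop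
    have h := this.tendsto 0
    simp only [Complex.ofReal_zero, mul_zero, Complex.exp_zero] at h
    exact h.mono_left nhdsWithin_le_nhds
  have hslope : Tendsto (fun h : ℝ => (h : ℂ)⁻¹ * (Complex.exp (z * h) - 1)) (𝓝[>] 0) (𝓝 z) := by
    have hd : HasDerivAt (fun h : ℝ => Complex.exp (z * h)) z 0 := by
      have h1 : HasDerivAt (fun h : ℝ => z * (h : ℂ)) (z * 1) 0 :=
        (Complex.ofRealCLM.hasDerivAt (x := (0 : ℝ))).const_mul z
      simpa using h1.cexp
    have := hd.tendsto_slope_zero_right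
    simpa [Complex.real_smul] using this
  have h1 := (hexp.smul (hJ.tendsto_semigroup_slope x)).add (hslope.smul_const (J x))
  have e : (1 : ℂ) • (J x - x) + z • J x = z • J x + (J x - x) := by rw [one_smul, add_comm]
  rw [e] at h1
  refine h1.congr fun h => ?_
  rw [propagator_apply]
  module

end IsPosResolvent
end NormalExt

/-! ### Resolvents of unbounded self-adjoint operators. -/

namespace NormalExt
open Filter Topology

variable {H : Type*} [NormedAddCommGroup H] [InnerProductSpace ℂ H]

theorem app_sub (T : H →ₗ.[ℂ] H) {x y : H} (hx : x ∈ T.domain) (hy : y ∈ T.domain) :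
    app T (x - y) = app T x - app T y := by
  rw [app_of_mem T hx, app_of_mem T hy, app_of_mem T (T.domain.sub_mem hx hy), ← LinearPMap.map_sub]
  rfl

theorem app_coeff {Ar Ai : ℝ → H →ₗ.[ℂ] H} {t : ℝ} {x : H} (hr : x ∈ (Ar t).domain)
    (hi : x ∈ (Ai t).domain) :
    app (coeff Ar Ai t) x = app (Ar t) x + Complex.I • app (Ai t) x := by
  have h : x ∈ (coeff Ar Ai t).domain := ⟨hr, hi⟩
  rw [app_of_mem _ h, app_of_mem _ hr, app_of_mem _ hi]
  rfl

theorem app_vadd (c : ℂ) (C : H →ₗ.[ℂ] H) {x : H} (hx : x ∈ C.domain) :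
    app ((c • (LinearMap.id : H →ₗ[ℂ] H)) +ᵥ C) x = c • x + app C x := by
  rw [app_of_mem _ hx, app_of_mem (((c • (LinearMap.id : H →ₗ[ℂ] H)) +ᵥ C)) (x := x) hx]
  rfl

theorem IsResolventAt.vadd {C : H →ₗ.[ℂ] H} {z : ℂ} {R : H →L[ℂ] H} (h : IsResolventAt C z R)
    (c : ℂ) : IsResolventAt ((c • (LinearMap.id : H →ₗ[ℂ] H)) +ᵥ C) (c + z) R where
  mem_domain := h.mem_domain
  right_inv x := by
    rw [app_vadd c C (h.mem_domain x)]
    conv_rhs => rw [← h.right_inv x]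
    module
  left_inv x hx := by
    have hx' : x ∈ C.domain := hx
    rw [app_vadd c C hx']
    conv_rhs => rw [← h.left_inv x hx']
    congr 1
    module

/-- The domain of a self-adjoint `T` is preserved by bounded operators commuting with one of its
resolvents, and these commute with `T`. -/
theorem IsResolventAt.app_of_commute {T : H →ₗ.[ℂ] H} {z : ℂ} {Q K : H →L[ℂ] H}
    (h : IsResolventAt T z Q) (hK : Commute K Q) {x : H} (hx : x ∈ T.domain) :
    K x ∈ T.domain ∧ app T (K x) = K (app T x) := by
  have hcomm : ∀ y, K (Q y) = Q (K y) := fun y => DFunLike.congr_fun hK.eq y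
  have h1 : K x = Q (K (app T x - z • x)) := by rw [← hcomm, h.left_inv x hx]
  refine ⟨h1 ▸ h.mem_domain _, ?_⟩
  have h2 := h.right_inv (K (app T x - z • x))
  rw [← h1, map_sub, map_smul] at h2
  exact sub_left_injective h2

theorem isResolventAt_resolventOp {T : H →ₗ.[ℂ] H} {z : ℂ}
    (h : ∃ R : H →L[ℂ] H, IsResolventAt T z R) : IsResolventAt T z (resolventOp T z) := by
  rw [resolventOp, dif_pos h]
  exact h.choose_spec

namespace IsResolventAt

variable {C : H →ₗ.[ℂ] H} {J : H →L[ℂ] H}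

theorem app_add_self (h : IsResolventAt C (-1) J) (x : H) : app C (J x) + J x = x := by
  have := h.right_inv x
  rwa [neg_one_smul, sub_neg_eq_add] at this

theorem app_apply (h : IsResolventAt C (-1) J) (x : H) : app C (J x) = x - J x :=
  eq_sub_of_add_eq (h.app_add_self x)

theorem apply_add (h : IsResolventAt C (-1) J) {x : H} (hx : x ∈ C.domain) :
    J (app C x + x) = x := by
  have := h.left_inv x hx
  rwa [neg_one_smul, sub_neg_eq_add] at this

theorem commute_of_boundedCommutes (h : IsResolventAt C (-1) J) {W : H →L[ℂ] H}
    (hW : BoundedCommutes W C) : Commute J W := by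
  refine ContinuousLinearMap.ext fun x => ?_
  change J (W x) = W (J x)
  have hm := h.mem_domain x
  have h1 := h.apply_add ((hW.1 (J x)).1 hm)
  rw [← hW.2 _ hm, ← map_add, h.app_add_self] at h1
  exact h1

end IsResolventAt

variable [CompleteSpace H]

theorem inner_app_left {T : H →ₗ.[ℂ] H} (hT : IsSelfAdjoint T) {x y : H} (hx : x ∈ T.domain)
    (hy : y ∈ T.domain) : ⟪app T x, y⟫_ℂ = ⟪x, app T y⟫_ℂ := by
  have h := LinearPMap.adjoint_isFormalAdjoint hT.dense_domain
  rw [LinearPMap.isSelfAdjoint_def.1 hT] at h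
  rw [app_of_mem T hx, app_of_mem T hy]
  exact h ⟨x, hx⟩ ⟨y, hy⟩

theorem inner_app_self_im {T : H →ₗ.[ℂ] H} (hT : IsSelfAdjoint T) {x : H} (hx : x ∈ T.domain) :
    (⟪app T x, x⟫_ℂ).im = 0 := by
  have h := inner_conj_symm (𝕜 := ℂ) (app T x) x
  rw [← inner_app_left hT hx hx] at h
  exact Complex.conj_eq_iff_im.1 h

/-- The bound at `z` makes `T - z` injective with closed range, because `T` is closed. A vector
orthogonal to the range is an eigenvector of `T` for the conjugate of `z`, which the second bound
excludes. -/
theorem exists_isResolventAt {T : H →ₗ.[ℂ] H} (hT : IsSelfAdjoint T) {z : ℂ} {c : ℝ} (hc : 0 < c)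
    (h1 : ∀ x ∈ T.domain, c * ‖x‖ ≤ ‖app T x - z • x‖)
    (h2 : ∀ x ∈ T.domain, c * ‖x‖ ≤ ‖app T x - (starRingEnd ℂ z) • x‖) :
    ∃ R : H →L[ℂ] H, IsResolventAt T z R := by
  let S : T.domain →ₗ[ℂ] H := T.toFun - z • T.domain.subtype
  have hS : ∀ x : T.domain, S x = app T x - z • (x : H) := by
    intro x; rw [app_of_mem T x.2]; rfl
  have hlow : ∀ x : T.domain, c * ‖x‖ ≤ ‖S x‖ := fun x => by rw [hS]; exact h1 x x.2
  have hinj : Function.Injective S := by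
    refine (injective_iff_map_eq_zero S).2 fun x hx => ?_
    have := hlow x
    rw [hx, norm_zero] at this
    exact norm_eq_zero.1 (le_antisymm (by nlinarith [norm_nonneg x]) (norm_nonneg x))
  have hclosed : IsClosed (S.range : Set H) := by
    refine IsSeqClosed.isClosed fun y y₀ hy hlim => ?_
    choose x hx using hy
    have hcau : CauchySeq (fun n => (x n : H)) := by
      rw [Metric.cauchySeq_iff']
      intro ε hε
      obtain ⟨N, hN⟩ := Metric.cauchySeq_iff'.1 hlim.cauchySeq (c * ε) (by positivity)
      refine ⟨N, fun n hn => ?_⟩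
      have h3 := hN n hn
      rw [dist_eq_norm, ← hx, ← hx, ← map_sub] at h3
      have h4 := (hlow (x n - x N)).trans_lt h3
      rw [dist_eq_norm]
      exact lt_of_mul_lt_mul_left h4 hc.le
    obtain ⟨x₀, hx₀⟩ := cauchySeq_tendsto_of_complete hcau
    have hgraph : (x₀, y₀ + z • x₀) ∈ T.graph := by
      have hcl : IsClosed (T.graph : Set (H × H)) := hT.isClosed
      refine hcl.mem_of_tendsto (hx₀.prodMk_nhds (hlim.add (hx₀.const_smul z)))
        (Eventually.of_forall fun n => ?_)
      have : y n + z • (x n : H) = T (x n) := by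
        rw [← hx n, hS, app_of_mem T (x n).2]; simp
      rw [this]
      exact T.mem_graph (x n)
    obtain ⟨w, hw1, hw2⟩ := (LinearPMap.mem_graph_iff T).1 hgraph
    refine ⟨w, ?_⟩
    rw [hS, app_of_mem T w.2]
    simp only [Subtype.coe_eta]
    rw [hw2, hw1]
    simp
  have horth : S.rangeᗮ = ⊥ := by
    refine (Submodule.eq_bot_iff _).2 fun v hv => ?_
    have hv' : ∀ x : T.domain, ⟪(starRingEnd ℂ z) • v, (x : H)⟫_ℂ = ⟪v, T x⟫_ℂ := by
      intro x
      have h3 := (Submodule.mem_orthogonal' _ _).1 hv (S x) ⟨x, rfl⟩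
      rw [hS, app_of_mem T x.2, inner_sub_right, inner_smul_right, sub_eq_zero] at h3
      rw [inner_smul_left, Complex.conj_conj]
      exact h3.symm
    have hd : v ∈ T.adjoint.domain := LinearPMap.mem_adjoint_domain_of_exists v ⟨_, hv'⟩
    have hval := LinearPMap.adjoint_apply_eq hT.dense_domain ⟨v, hd⟩ hv'
    have hTv : app T v = (starRingEnd ℂ z) • v := by
      have hTT : T.adjoint = T := LinearPMap.isSelfAdjoint_def.1 hT
      rw [← app_of_mem T.adjoint hd, hTT] at hval
      exact hval
    have hvT : v ∈ T.domain := by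
      rw [LinearPMap.isSelfAdjoint_def.1 hT] at hd
      exact hd
    have := h2 v hvT
    rw [hTv, sub_self, norm_zero] at this
    exact norm_eq_zero.1 (le_antisymm (by nlinarith [norm_nonneg v]) (norm_nonneg v))
  have hrange : S.range = ⊤ := by
    have h3 := Submodule.topologicalClosure_eq_top_iff.2 horth
    rwa [hclosed.submodule_topologicalClosure_eq] at h3
  let e := LinearEquiv.ofBijective S ⟨hinj, LinearMap.range_eq_top.1 hrange⟩
  have he : ∀ y, S (e.symm y) = y := fun y => e.apply_symm_apply y
  let R : H →L[ℂ] H := (T.domain.subtype ∘ₗ e.symm.toLinearMap).mkContinuous c⁻¹ fun y => by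
    rw [le_inv_mul_iff₀ hc]
    have := hlow (e.symm y)
    rw [he] at this
    exact this
  have hR : ∀ y, R y = (e.symm y : H) := fun y => rfl
  refine ⟨R, fun y => by rw [hR]; exact (e.symm y).2, fun y => ?_, fun y hy => ?_⟩
  · rw [hR, ← hS, he]
  · have : app T y - z • y = e ⟨y, hy⟩ := (hS ⟨y, hy⟩).symm
    rw [this, hR, e.symm_apply_apply]

/-- The imaginary part of `⟪(T - w) x, x⟫` has modulus `|Im w| ‖x‖²`, which serves `i` and its
conjugate at once. -/
theorem exists_isResolventAt_I {T : H →ₗ.[ℂ] H} (hT : IsSelfAdjoint T) :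
    ∃ R : H →L[ℂ] H, IsResolventAt T Complex.I R := by
  have key : ∀ w : ℂ, |w.im| = 1 → ∀ x ∈ T.domain, 1 * ‖x‖ ≤ ‖app T x - w • x‖ := by
    intro w hw x hx
    have h1 : |(⟪app T x - w • x, x⟫_ℂ).im| = ‖x‖ * ‖x‖ := by
      rw [inner_sub_left, inner_smul_left, inner_self_eq_norm_sq_to_K, Complex.sub_im,
        inner_app_self_im hT hx]
      have : ((starRingEnd ℂ) w * ((‖x‖ : ℂ)) ^ 2).im = -w.im * (‖x‖ * ‖x‖) := by
        rw [pow_two, ← Complex.ofReal_mul, Complex.im_mul_ofReal, Complex.conj_im]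
      erw [this]
      rw [zero_sub, abs_neg, abs_mul, abs_neg, hw, one_mul, abs_of_nonneg (by positivity)]
    have h2 : ‖x‖ * ‖x‖ ≤ ‖app T x - w • x‖ * ‖x‖ := by
      rw [← h1]
      exact (Complex.abs_im_le_norm _).trans (norm_inner_le_norm _ _)
    rw [one_mul]
    rcases eq_or_lt_of_le (norm_nonneg x) with h | h
    · rw [← h]; exact norm_nonneg _
    · exact le_of_mul_le_mul_right h2 h
  exact exists_isResolventAt hT one_pos (key _ (by simp)) (key _ (by simp))

theorem exists_isResolventAt_neg_one {C : H →ₗ.[ℂ] H} (hC : IsSelfAdjoint C)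
    (hpos : ∀ x : C.domain, 0 ≤ (⟪C x, (x : H)⟫_ℂ).re) :
    ∃ R : H →L[ℂ] H, IsResolventAt C (-1) R := by
  have key : ∀ x ∈ C.domain, 1 * ‖x‖ ≤ ‖app C x - (-1 : ℂ) • x‖ := by
    intro x hx
    have h1 : ‖x‖ * ‖x‖ ≤ (⟪app C x - (-1 : ℂ) • x, x⟫_ℂ).re := by
      rw [neg_one_smul, sub_neg_eq_add, inner_add_left, Complex.add_re]
      have h2 := hpos ⟨x, hx⟩
      rw [← app_of_mem C hx] at h2
      have h3 := inner_self_eq_norm_mul_norm (𝕜 := ℂ) x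
      simp only [RCLike.re_to_complex] at h3
      rw [h3]
      exact le_add_of_nonneg_left h2
    have h2 : ‖x‖ * ‖x‖ ≤ ‖app C x - (-1 : ℂ) • x‖ * ‖x‖ :=
      h1.trans ((Complex.re_le_norm _).trans (norm_inner_le_norm _ _))
    rw [one_mul]
    rcases eq_or_lt_of_le (norm_nonneg x) with h | h
    · rw [← h]; exact norm_nonneg _
    · exact le_of_mul_le_mul_right h2 h
  exact exists_isResolventAt hC one_pos key (by simpa using key)

namespace IsResolventAt

variable {C : H →ₗ.[ℂ] H} {J : H →L[ℂ] H}

/-- Substituting `x = C J x + J x` gives `‖J x‖² ≤ Re ⟪J x, x⟫`, hence both `J ≥ 0` and `‖J‖ ≤ 1`.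
-/
theorem isPosResolvent (h : IsResolventAt C (-1) J) (hC : IsSelfAdjoint C)
    (hpos : ∀ x : C.domain, 0 ≤ (⟪C x, (x : H)⟫_ℂ).re) : IsPosResolvent J := by
  have hinner : ∀ x y, ⟪J x, y⟫_ℂ = ⟪x, J y⟫_ℂ := by
    intro x y
    conv_lhs => rw [← h.app_add_self y]
    conv_rhs => rw [← h.app_add_self x]
    rw [inner_add_left, inner_add_right, inner_app_left hC (h.mem_domain x) (h.mem_domain y)]
  have hsa : IsSelfAdjoint J :=
    ContinuousLinearMap.isSelfAdjoint_iff_isSymmetric.2 hinner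
  have hre : ∀ x, ‖J x‖ * ‖J x‖ ≤ (⟪J x, x⟫_ℂ).re := by
    intro x
    have e : ⟪J x, x⟫_ℂ = ⟪J x, app C (J x) + J x⟫_ℂ := by rw [h.app_add_self]
    rw [e, inner_add_right, Complex.add_re,
      ← inner_app_left hC (h.mem_domain x) (h.mem_domain x)]
    have h2 := hpos ⟨J x, h.mem_domain x⟩
    rw [← app_of_mem C (h.mem_domain x)] at h2
    have h3 := inner_self_eq_norm_mul_norm (𝕜 := ℂ) (J x)
    simp only [RCLike.re_to_complex] at h3
    rw [h3]
    exact le_add_of_nonneg_left h2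
  have hnonneg : 0 ≤ J := by
    rw [ContinuousLinearMap.nonneg_iff_isPositive]
    refine ⟨hinner, fun x => ?_⟩
    exact le_trans (by positivity) (hre x)
  have hnorm : ‖J‖ ≤ 1 := by
    refine J.opNorm_le_bound zero_le_one fun x => ?_
    rw [one_mul]
    have h2 : ‖J x‖ * ‖J x‖ ≤ ‖x‖ * ‖J x‖ := by
      refine (hre x).trans ((Complex.re_le_norm _).trans ?_)
      rw [mul_comm]
      exact norm_inner_le_norm _ _
    rcases eq_or_lt_of_le (norm_nonneg (J x)) with h' | h'
    · rw [← h']; exact norm_nonneg _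
    · exact le_of_mul_le_mul_right h2 h'
  refine ⟨hsa, fun s hs => ⟨spectrum_nonneg_of_nonneg hnonneg hs, ?_⟩, ?_⟩
  · have h2 := spectrum.norm_le_norm_mul_of_mem hs
    have h3 : ‖(1 : H →L[ℂ] H)‖ ≤ 1 := ContinuousLinearMap.norm_id_le
    calc s ≤ ‖s‖ := le_abs_self s
      _ ≤ ‖J‖ * ‖(1 : H →L[ℂ] H)‖ := h2
      _ ≤ 1 * 1 := by gcongr
      _ = 1 := one_mul 1
  · refine (injective_iff_map_eq_zero J).2 fun x hx => ?_
    have := h.app_apply x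
    rw [hx, sub_zero] at this
    rw [← this, app_of_mem C C.domain.zero_mem]
    exact C.map_zero

end IsResolventAt

end NormalExt

/-! ### The unitary evolution of `y' + i A_i(t) y = 0` and its commutation with `J`. -/

namespace NormalExt
open Filter Topology

variable {H : Type*} [NormedAddCommGroup H] [InnerProductSpace ℂ H]

theorem norm_le_one_of_forall {T : H →L[ℂ] H} (h : ∀ x, ‖T x‖ = ‖x‖) : ‖T‖ ≤ 1 :=
  T.opNorm_le_bound zero_le_one fun x => by rw [h, one_mul]

theorem hasDerivWithinAt_clm (J : H →L[ℂ] H) {y : ℝ → H} {y' : H} {s : Set ℝ} {t : ℝ}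
    (h : HasDerivWithinAt y y' s t) : HasDerivWithinAt (fun r => J (y r)) (J y') s t :=
  (J.restrictScalars ℝ).hasFDerivAt.comp_hasDerivWithinAt t h

theorem hasDerivAt_clm (J : H →L[ℂ] H) {y : ℝ → H} {y' : H} {t : ℝ}
    (h : HasDerivAt y y' t) : HasDerivAt (fun r => J (y r)) (J y') t :=
  (J.restrictScalars ℝ).hasFDerivAt.comp_hasDerivAt t h

variable [CompleteSpace H]

/-- Lebesgue measure on `(0,1)`. -/
abbrev unitMeasure : Measure ℝ := volume.restrict (Ioo (0 : ℝ) 1)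

/-- The derivative of `⟪y, y⟫` is `i ⟪A y, y⟫ - i ⟪y, A y⟫`, which vanishes by symmetry of `A`.
Applied to differences, this is also the uniqueness statement. -/
theorem norm_eq_of_hasDerivWithinAt {A : ℝ → H →ₗ.[ℂ] H}
    (hA : ∀ t ∈ Icc (0 : ℝ) 1, IsSelfAdjoint (A t)) {y : ℝ → H}
    (hmem : ∀ t ∈ Icc (0 : ℝ) 1, y t ∈ (A t).domain)
    (hy : ∀ t ∈ Icc (0 : ℝ) 1,
      HasDerivWithinAt y (-(Complex.I • app (A t) (y t))) (Icc 0 1) t)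
    {s t : ℝ} (hs : s ∈ Icc (0 : ℝ) 1) (ht : t ∈ Icc (0 : ℝ) 1) : ‖y t‖ = ‖y s‖ := by
  have hd : ∀ t ∈ Icc (0 : ℝ) 1, HasDerivWithinAt (fun r => ⟪y r, y r⟫_ℂ) 0 (Icc 0 1) t := by
    intro t ht
    have h := (hy t ht).inner ℂ (hy t ht)
    refine h.congr_deriv ?_
    rw [inner_neg_left, inner_neg_right, inner_smul_left, inner_smul_right,
      inner_app_left (hA t ht) (hmem t ht) (hmem t ht), Complex.conj_I]
    ring
  have hconst := constant_of_derivWithin_zero (fun t ht => (hd t ht).differentiableWithinAt)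
    (fun t ht => (hd t (Ico_subset_Icc_self ht)).derivWithin
      (uniqueDiffOn_Icc zero_lt_one t (Ico_subset_Icc_self ht)))
  have h := (hconst t ht).trans (hconst s hs).symm
  rw [inner_self_eq_norm_sq_to_K, inner_self_eq_norm_sq_to_K] at h
  have h2 : ‖y t‖ ^ 2 = ‖y s‖ ^ 2 := by exact_mod_cast h
  exact (pow_left_inj₀ (norm_nonneg _) (norm_nonneg _) two_ne_zero).1 h2

theorem eq_of_hasDerivWithinAt {A : ℝ → H →ₗ.[ℂ] H}
    (hA : ∀ t ∈ Icc (0 : ℝ) 1, IsSelfAdjoint (A t)) {x y : ℝ → H}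
    (hxm : ∀ t ∈ Icc (0 : ℝ) 1, x t ∈ (A t).domain)
    (hym : ∀ t ∈ Icc (0 : ℝ) 1, y t ∈ (A t).domain)
    (hx : ∀ t ∈ Icc (0 : ℝ) 1,
      HasDerivWithinAt x (-(Complex.I • app (A t) (x t))) (Icc 0 1) t)
    (hy : ∀ t ∈ Icc (0 : ℝ) 1,
      HasDerivWithinAt y (-(Complex.I • app (A t) (y t))) (Icc 0 1) t)
    {s t : ℝ} (hs : s ∈ Icc (0 : ℝ) 1) (ht : t ∈ Icc (0 : ℝ) 1) (h : x s = y s) : x t = y t := by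
  have h1 := norm_eq_of_hasDerivWithinAt hA (y := fun r => x r - y r)
    (fun r hr => Submodule.sub_mem _ (hxm r hr) (hym r hr)) (fun r hr => by
      convert! (hx r hr).sub (hy r hr) using 1
      rw [app_sub _ (hxm r hr) (hym r hr), smul_sub]
      abel) hs ht
  rw [h, sub_self, norm_zero, norm_eq_zero, sub_eq_zero] at h1
  exact h1

/-- The unitary evolution `V t = U(t,0)` and its inverse `Y t = U(0,t)`. -/
structure IsEvolutionPair (D : Submodule ℂ H) (Ai : ℝ → H →ₗ.[ℂ] H) (V Y : ℝ → H →L[ℂ] H) :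
    Prop where
  V_mem : ∀ t ∈ Icc (0 : ℝ) 1, ∀ f ∈ D, V t f ∈ D
  Y_mem : ∀ t ∈ Icc (0 : ℝ) 1, ∀ f ∈ D, Y t f ∈ D
  V_Y : ∀ t ∈ Icc (0 : ℝ) 1, ∀ x, V t (Y t x) = x
  Y_V : ∀ t ∈ Icc (0 : ℝ) 1, ∀ x, Y t (V t x) = x
  norm_V : ∀ t ∈ Icc (0 : ℝ) 1, ∀ x, ‖V t x‖ = ‖x‖
  V_zero : ∀ x, V 0 x = x
  continuousOn_V : ∀ x, ContinuousOn (fun t => V t x) (Icc 0 1)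
  deriv_V : ∀ t ∈ Icc (0 : ℝ) 1, ∀ f ∈ D,
    HasDerivWithinAt (fun r => V r f) (-(Complex.I • app (Ai t) (V t f))) (Icc 0 1) t
  norm_Y : ∀ t ∈ Icc (0 : ℝ) 1, ∀ x, ‖Y t x‖ = ‖x‖
  continuousOn_Y : ∀ x, ContinuousOn (fun t => Y t x) (Icc 0 1)
  deriv_Y : ∀ t ∈ Icc (0 : ℝ) 1, ∀ f ∈ D,
    HasDerivWithinAt (fun r => Y r f) (Y t (Complex.I • app (Ai t) f)) (Icc 0 1) t

omit [CompleteSpace H] in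
theorem IsEvolutionPair.inner_V {D : Submodule ℂ H} {Ai : ℝ → H →ₗ.[ℂ] H} {V Y : ℝ → H →L[ℂ] H}
    (h : IsEvolutionPair D Ai V Y) {t : ℝ} (ht : t ∈ Icc (0 : ℝ) 1) (x z : H) :
    ⟪x, V t z⟫_ℂ = ⟪Y t x, z⟫_ℂ := by
  have hi := (LinearMap.norm_map_iff_inner_map_map (V t)).1 (h.norm_V t ht) (Y t x) z
  rw [← hi]
  exact congrArg (fun w => ⟪w, V t z⟫_ℂ) (h.V_Y t ht x).symm

theorem IsEvolutionFamily.isEvolutionPair {D : Submodule ℂ H} (hD : Dense (D : Set H))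
    {Ai : ℝ → H →ₗ.[ℂ] H} (hAi : ∀ t ∈ Icc (0 : ℝ) 1, IsSelfAdjoint (Ai t))
    (hle : ∀ t ∈ Icc (0 : ℝ) 1, D ≤ (Ai t).domain) {U : ℝ → ℝ → H →L[ℂ] H}
    (hU : IsEvolutionFamily D Ai U) :
    IsEvolutionPair D Ai (fun t => U t 0) (fun t => U 0 t) := by
  have h0 : (0 : ℝ) ∈ Icc (0 : ℝ) 1 := ⟨le_rfl, zero_le_one⟩
  have hnormD : ∀ t ∈ Icc (0 : ℝ) 1, ∀ s ∈ Icc (0 : ℝ) 1, ∀ f ∈ D, ‖U t s f‖ = ‖f‖ := by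
    intro t ht s hs f hf
    have := norm_eq_of_hasDerivWithinAt hAi (y := fun r => U r s f)
      (fun r hr => hle r hr (hU.mem_domain r hr s hs f hf))
      (fun r hr => hU.hasDerivWithinAt r hr s hs f hf) hs ht
    rwa [hU.initial s hs f hf] at this
  have hnorm : ∀ t ∈ Icc (0 : ℝ) 1, ∀ s ∈ Icc (0 : ℝ) 1, ∀ x, ‖U t s x‖ = ‖x‖ := by
    intro t ht s hs
    exact congr_fun (Continuous.ext_on hD (by fun_prop) continuous_norm
      (fun f hf => hnormD t ht s hs f hf))
  have hcocD : ∀ t ∈ Icc (0 : ℝ) 1, ∀ s ∈ Icc (0 : ℝ) 1, ∀ r ∈ Icc (0 : ℝ) 1, ∀ f ∈ D,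
      U t s (U s r f) = U t r f := by
    intro t ht s hs r hr f hf
    have hm := hU.mem_domain s hs r hr f hf
    exact eq_of_hasDerivWithinAt hAi (x := fun q => U q s (U s r f)) (y := fun q => U q r f)
      (fun q hq => hle q hq (hU.mem_domain q hq s hs _ hm))
      (fun q hq => hle q hq (hU.mem_domain q hq r hr f hf))
      (fun q hq => hU.hasDerivWithinAt q hq s hs _ hm)
      (fun q hq => hU.hasDerivWithinAt q hq r hr f hf) hs ht (hU.initial s hs _ hm)
  have hcoc : ∀ t ∈ Icc (0 : ℝ) 1, ∀ s ∈ Icc (0 : ℝ) 1, ∀ r ∈ Icc (0 : ℝ) 1, ∀ x,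
      U t s (U s r x) = U t r x := by
    intro t ht s hs r hr
    exact congr_fun (Continuous.ext_on hD (by fun_prop) (by fun_prop)
      (fun f hf => hcocD t ht s hs r hr f hf))
  have hid : ∀ s ∈ Icc (0 : ℝ) 1, ∀ x, U s s x = x := by
    intro s hs
    exact congr_fun (Continuous.ext_on hD (by fun_prop) continuous_id
      (fun f hf => hU.initial s hs f hf))
  have hcont : ∀ s ∈ Icc (0 : ℝ) 1, ∀ x, ContinuousOn (fun t => U t s x) (Icc 0 1) := by
    intro s hs x t ht
    refine tendsto_apply_of_dense (M := 1) (T := fun t => U t s) (S := U t s) ?_ hD ?_ x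
    · filter_upwards [self_mem_nhdsWithin] with r hr
      exact norm_le_one_of_forall (hnorm r hr s hs)
    · intro f hf
      exact (hU.contDiffOn s hs f hf).continuousOn t ht
  have hcontY : ∀ x, ContinuousOn (fun t => U 0 t x) (Icc 0 1) := by
    intro x t ht
    rw [ContinuousWithinAt, tendsto_iff_norm_sub_tendsto_zero]
    have h1 := (tendsto_iff_norm_sub_tendsto_zero.1 (hcont 0 h0 (U 0 t x) t ht))
    refine h1.congr' ?_
    filter_upwards [self_mem_nhdsWithin] with r hr
    rw [hcoc t ht 0 h0 t ht, hid t ht, ← hnorm 0 h0 r hr (U r 0 (U 0 t x) - x), map_sub,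
      hcoc 0 h0 r hr 0 h0, hid 0 h0, norm_sub_rev, norm_sub_rev]
  refine ⟨fun t ht f hf => hU.mem_domain t ht 0 h0 f hf,
    fun t ht f hf => hU.mem_domain 0 h0 t ht f hf,
    fun t ht x => (hcoc t ht 0 h0 t ht x).trans (hid t ht x),
    fun t ht x => (hcoc 0 h0 t ht 0 h0 x).trans (hid 0 h0 x),
    fun t ht => hnorm t ht 0 h0, hid 0 h0, hcont 0 h0,
    fun t ht f hf => hU.hasDerivWithinAt t ht 0 h0 f hf,
    fun t ht => hnorm 0 h0 t ht, hcontY, fun t ht f hf => ?_⟩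
  rw [hasDerivWithinAt_iff_tendsto_slope]
  have hsl := hasDerivWithinAt_iff_tendsto_slope.1 (hU.hasDerivWithinAt t ht t ht f hf)
  rw [hU.initial t ht f hf] at hsl
  -- The cocycle law gives `U(0,r) f - U(0,t) f = -U(0,r) (U(r,t) f - f)`, so differentiating in the
  -- second time reduces to differentiating `U(r,t) f` in `r` at `r = t`, with `-U(0,r)` strongly
  -- continuous and bounded.
  have hlim := tendsto_apply_apply (K := fun r => -U 0 r) (M := 1) (l := 𝓝[Icc 0 1 \ {t}] t)
    (z := U 0 t (Complex.I • app (Ai t) f)) (by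
      filter_upwards [self_mem_nhdsWithin] with r hr
      rw [norm_neg]
      exact norm_le_one_of_forall (hnorm 0 h0 r hr.1)) hsl (by
      have h1 := (hcontY (Complex.I • app (Ai t) f) t ht).mono_left
        (nhdsWithin_mono t sdiff_subset : 𝓝[Icc 0 1 \ {t}] t ≤ _)
      refine h1.congr fun r => ?_
      simp)
  refine hlim.congr' ?_
  filter_upwards [self_mem_nhdsWithin] with r hr
  simp only [slope, vsub_eq_sub, neg_apply]
  rw [ContinuousLinearMap.map_smul_of_tower, map_sub, hcoc 0 h0 r hr.1 t ht, hU.initial t ht f hf, ← smul_neg, neg_sub]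

/-- For `f ∈ D`, `J V f` and `V J f` solve the same Cauchy problem; uniqueness and density of `D`
conclude. -/
theorem IsEvolutionPair.commute {D : Submodule ℂ H} (hD : Dense (D : Set H))
    {Ai : ℝ → H →ₗ.[ℂ] H} (hAi : ∀ t ∈ Icc (0 : ℝ) 1, IsSelfAdjoint (Ai t))
    (hle : ∀ t ∈ Icc (0 : ℝ) 1, D ≤ (Ai t).domain) {V Y : ℝ → H →L[ℂ] H}
    (hV : IsEvolutionPair D Ai V Y) {J : H →L[ℂ] H} (hJD : ∀ f ∈ D, J f ∈ D)
    (hJA : ∀ f ∈ D, ∀ t ∈ Icc (0 : ℝ) 1, app (Ai t) (J f) = J (app (Ai t) f))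
    {t : ℝ} (ht : t ∈ Icc (0 : ℝ) 1) : Commute J (V t) := by
  have h0 : (0 : ℝ) ∈ Icc (0 : ℝ) 1 := ⟨le_rfl, zero_le_one⟩
  refine ContinuousLinearMap.ext fun x => ?_
  revert x
  refine congr_fun (Continuous.ext_on hD (by fun_prop) (by fun_prop) (fun f hf => ?_))
  refine eq_of_hasDerivWithinAt hAi (x := fun r => J (V r f)) (y := fun r => V r (J f))
    (fun r hr => hle r hr (hJD _ (hV.V_mem r hr f hf)))
    (fun r hr => hle r hr (hV.V_mem r hr _ (hJD f hf))) (fun r hr => ?_)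
    (fun r hr => hV.deriv_V r hr _ (hJD f hf)) h0 ht (by simp only [hV.V_zero])
  refine (hasDerivWithinAt_clm J (hV.deriv_V r hr f hf)).congr_deriv ?_
  rw [hJA _ (hV.V_mem r hr f hf) r hr]
  simp

omit [CompleteSpace H] in
theorem IsEvolutionPair.commute_Y {D : Submodule ℂ H} {Ai : ℝ → H →ₗ.[ℂ] H}
    {V Y : ℝ → H →L[ℂ] H} (hV : IsEvolutionPair D Ai V Y) {J : H →L[ℂ] H} {t : ℝ}
    (ht : t ∈ Icc (0 : ℝ) 1) (h : Commute J (V t)) : Commute J (Y t) := by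
  refine ContinuousLinearMap.ext fun x => ?_
  change J (Y t x) = Y t (J x)
  have h1 : J (V t (Y t x)) = V t (J (Y t x)) := DFunLike.congr_fun h.eq (Y t x)
  rw [hV.V_Y t ht] at h1
  rw [h1, hV.Y_V t ht]

section Coefficient

variable {α : ℝ → ℝ} {Ar Ai : ℝ → H →ₗ.[ℂ] H} {C : H →ₗ.[ℂ] H} {D : Submodule ℂ H}

theorem ae_unit_of_forall {p : ℝ → Prop} (h : ∀ t ∈ Ioo (0 : ℝ) 1, p t) : ∀ᵐ t ∂unitMeasure, p t :=
  (ae_restrict_iff' measurableSet_Ioo).2 (Eventually.of_forall h)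

theorem ae_unit_mem : ∀ᵐ t ∂unitMeasure, t ∈ Ioo (0 : ℝ) 1 := ae_restrict_mem measurableSet_Ioo

instance : NeZero unitMeasure := ⟨by
  intro h
  have := congrArg (fun μ : Measure ℝ => μ univ) h
  simp at this⟩

namespace IsNormalCoeff

variable (hA : IsNormalCoeff α Ar Ai C D)
include hA

theorem ae_mem_iff : ∀ᵐ t ∂unitMeasure, ∀ f, f ∈ D ↔ f ∈ C.domain ∧ f ∈ (Ai t).domain := by
  filter_upwards [hA.re_eq, ae_unit_mem] with t h1 h2 f
  rw [← hA.domain_eq t h2]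
  have : (Ar t).domain = C.domain := by rw [h1]; rfl
  rw [← this]
  exact Iff.rfl

theorem le_domain : D ≤ C.domain := by
  obtain ⟨t, ht⟩ := hA.ae_mem_iff.exists
  exact fun f hf => ((ht f).1 hf).1

/-- Since `A_r(t)` is `C` shifted by a scalar for almost every `t`, `J` is a resolvent of `A_r(t)`
and commutes with `(A_i(t) - i)⁻¹`. -/
theorem commute_resolvent {J : H →L[ℂ] H} (hJ : IsResolventAt C (-1) J) :
    ∀ᵐ t ∂unitMeasure, ∀ f ∈ (Ai t).domain,
      J f ∈ (Ai t).domain ∧ app (Ai t) (J f) = J (app (Ai t) f) := by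
  filter_upwards [hA.re_eq, ae_unit_mem] with t h1 h2 f hf
  obtain ⟨Q, hQ⟩ := exists_isResolventAt_I (hA.selfAdjoint_im t (Ioo_subset_Icc_self h2))
  have hJr := hJ.vadd ((deriv α t / (2 * α t) : ℝ) : ℂ)
  rw [← h1] at hJr
  exact hQ.app_of_commute (hA.commute t h2 _ _ _ _ hJr hQ) hf

/-- As `D` does not depend on `t`, a single good time suffices. -/
theorem resolvent_mem {J : H →L[ℂ] H} (hJ : IsResolventAt C (-1) J) {f : H} (hf : f ∈ D) :
    J f ∈ D := by
  obtain ⟨t, h1, h2⟩ := (hA.ae_mem_iff.and (hA.commute_resolvent hJ)).exists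
  exact (h1 _).2 ⟨hJ.mem_domain f, (h2 f ((h1 f).1 hf).2).1⟩

/-- Both sides are continuous in `t`, so the almost everywhere identity holds on all of `[0,1]`,
endpoints included. -/
theorem app_resolvent {J : H →L[ℂ] H} (hJ : IsResolventAt C (-1) J) {f : H} (hf : f ∈ D)
    {t : ℝ} (ht : t ∈ Icc (0 : ℝ) 1) : app (Ai t) (J f) = J (app (Ai t) f) := by
  refine Measure.eqOn_Icc_of_ae_eq (μ := volume) (zero_ne_one' ℝ) ?_
    (hA.contDiff_im _ (hA.resolvent_mem hJ hf)).continuousOn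
    (J.continuous.comp_continuousOn (hA.contDiff_im f hf).continuousOn) ht
  rw [← restrict_Ioo_eq_restrict_Icc]
  filter_upwards [hA.commute_resolvent hJ, hA.ae_mem_iff] with t h1 h2
  exact (h1 f ((h2 f).1 hf).2).2

end IsNormalCoeff
end Coefficient
end NormalExt

/-! ### Positivity of the weight and the unitary map `y ↦ V y / √α`. -/

namespace NormalExt
open Filter Topology

theorem hasDerivAt_integral_Ioo {F : Type*} [NormedAddCommGroup F] [NormedSpace ℝ F]
    [CompleteSpace F] {k : ℝ → F} (hk : ContinuousOn k (Ioo 0 1)) {c t : ℝ}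
    (hc : c ∈ Ioo (0 : ℝ) 1) (ht : t ∈ Ioo (0 : ℝ) 1) :
    HasDerivAt (fun t => ∫ s in c..t, k s) (k t) t := by
  have hsub : uIcc c t ⊆ Ioo 0 1 := (ordConnected_Ioo (a := (0 : ℝ)) (b := 1)).uIcc_subset hc ht
  exact intervalIntegral.integral_hasDerivAt_right ((hk.mono hsub).intervalIntegrable)
    (hk.stronglyMeasurableAtFilter isOpen_Ioo t ht) (hk.continuousAt (isOpen_Ioo.mem_nhds ht))

namespace IsWeight

variable {α : ℝ → ℝ} (hα : IsWeight α)
include hα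

theorem continuousOn : ContinuousOn α (Icc 0 1) := hα.contDiffOn.continuousOn

theorem hasDerivAt {t : ℝ} (ht : t ∈ Ioo (0 : ℝ) 1) : HasDerivAt α (deriv α t) t :=
  ((hα.contDiffOn.contDiffAt (Icc_mem_nhds ht.1 ht.2)).differentiableAt two_ne_zero).hasDerivAt

theorem continuousOn_deriv : ContinuousOn (deriv α) (Ioo 0 1) :=
  (hα.contDiffOn.mono Ioo_subset_Icc_self).continuousOn_deriv_of_isOpen isOpen_Ioo one_le_two

theorem ae_ne_zero : ∀ᵐ t ∂unitMeasure, α t ≠ 0 := by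
  rw [ae_restrict_iff' measurableSet_Ioo, ae_iff]
  refine measure_mono_null (fun t ht => ?_) hα.zeros_null
  simp only [mem_ofPred_eq, Classical.not_imp, not_not] at ht
  exact ⟨Ioo_subset_Icc_self ht.1, ht.2⟩

/-- For a nonzero `f ∈ D` the coefficient `κ` in `A_r(t) f - C f = κ(t) f` is continuous on `(0,1)`
and equals `α'/(2α)` almost everywhere. Thus `α' = 2 κ α` first almost everywhere, then everywhere
by continuity. A solution of this linear equation with one zero vanishes identically, contrary to
the null zero set. -/
theorem pos {H : Type*} [NormedAddCommGroup H] [InnerProductSpace ℂ H] [CompleteSpace H]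
    [Nontrivial H] {Ar Ai : ℝ → H →ₗ.[ℂ] H} {C : H →ₗ.[ℂ] H} {D : Submodule ℂ H}
    (hA : IsNormalCoeff α Ar Ai C D) {t : ℝ} (ht : t ∈ Ioo (0 : ℝ) 1) : 0 < α t := by
  obtain ⟨f, hf, hf0⟩ : ∃ f ∈ D, f ≠ 0 := by
    by_contra! h
    have hbot : D = ⊥ := (Submodule.eq_bot_iff D).2 h
    have hd := hA.dense
    rw [hbot] at hd
    obtain ⟨x, hx⟩ := exists_ne (0 : H)
    have := hd.closure_eq ▸ mem_univ x
    simp at this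
    exact hx this
  set κ : ℝ → ℝ := fun t => (⟪f, app (Ar t) f - app C f⟫_ℂ).re / ‖f‖ ^ 2 with hκ
  have hκc : ContinuousOn κ (Ioo 0 1) := by
    have h1 : ContinuousOn (fun t => app (Ar t) f - app C f) (Ioo 0 1) :=
      (hA.contDiff_re f hf).continuousOn.sub continuousOn_const
    exact (Complex.continuous_re.comp_continuousOn
      ((innerSL ℂ f).continuous.comp_continuousOn h1)).div_const _
  have hae : (fun t => deriv α t) =ᵐ[volume.restrict (Ioo (0 : ℝ) 1)] fun t => 2 * κ t * α t := by
    filter_upwards [hA.re_eq, hα.ae_ne_zero] with t h1 h2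
    have h3 : κ t = deriv α t / (2 * α t) := by
      simp only [hκ]
      rw [h1, app_vadd _ _ (hA.le_domain hf), add_sub_cancel_right, inner_smul_right,
        inner_self_eq_norm_sq_to_K]
      have : ‖f‖ ^ 2 ≠ 0 := by positivity
      erw [← Complex.ofReal_pow, ← Complex.ofReal_mul, Complex.ofReal_re]
      field_simp
      simp
    rw [h3]
    field_simp
  have heq := Measure.eqOn_open_of_ae_eq hae isOpen_Ioo hα.continuousOn_deriv
    ((continuousOn_const.mul hκc).mul (hα.continuousOn.mono Ioo_subset_Icc_self))
  refine lt_of_le_of_ne (hα.nonneg t (Ioo_subset_Icc_self ht)) fun h0 => ?_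
  -- The exponential is the integrating factor of `α' = 2 κ α`.
  have hd : ∀ s ∈ Ioo (0 : ℝ) 1,
      HasDerivAt (fun s => α s * Real.exp (-2 * ∫ r in t..s, κ r)) 0 s := by
    intro s hs
    have h1 := (hα.hasDerivAt hs).mul (((hasDerivAt_integral_Ioo hκc ht hs).const_mul (-2)).exp)
    refine h1.congr_deriv ?_
    rw [show deriv α s = 2 * κ s * α s from heq hs]
    ring
  have hz : ∀ s ∈ Ioo (0 : ℝ) 1, α s = 0 := by
    intro s hs
    have h1 := isOpen_Ioo.is_const_of_deriv_eq_zero isPreconnected_Ioo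
      (fun s hs => (hd s hs).differentiableAt.differentiableWithinAt)
      (fun s hs => (hd s hs).deriv) hs ht
    simp only [intervalIntegral.integral_same, ← h0, zero_mul] at h1
    exact (mul_eq_zero.1 h1).resolve_right (Real.exp_pos _).ne'
  have : (∀ᵐ t ∂unitMeasure, False) := by
    filter_upwards [hα.ae_ne_zero, ae_unit_mem] with s h1 h2 using h1 (hz s h2)
  obtain ⟨_, h⟩ := this.exists
  exact h

end IsWeight

/-- A weight without zeros in `(0,1)`. -/
structure IsPosWeight (α : ℝ → ℝ) : Prop extends IsWeight α where
  pos' : ∀ t ∈ Ioo (0 : ℝ) 1, 0 < α t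

namespace IsPosWeight

variable {α : ℝ → ℝ} (hα : IsPosWeight α)
include hα

theorem aemeasurable : AEMeasurable (fun t => ENNReal.ofReal (α t)) unitMeasure :=
  ((hα.continuousOn.mono Ioo_subset_Icc_self).aemeasurable measurableSet_Ioo).ennreal_ofReal

theorem ae_iff {p : ℝ → Prop} :
    (∀ᵐ t ∂weightMeasure α, p t) ↔ ∀ᵐ t ∂unitMeasure, p t := by
  rw [weightMeasure, ae_withDensity_iff' hα.aemeasurable]
  refine eventually_congr ?_
  filter_upwards [ae_unit_mem] with t ht
  have : ENNReal.ofReal (α t) ≠ 0 := by simpa using hα.pos' t ht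
  simp [this]

theorem ae_eq : ae (weightMeasure α) = ae unitMeasure := by
  ext s
  exact hα.ae_iff (p := fun t => t ∈ s)

theorem absolutelyContinuous : unitMeasure ≪ weightMeasure α :=
  Measure.ae_le_iff_absolutelyContinuous.1 hα.ae_eq.ge

theorem absolutelyContinuous' : weightMeasure α ≪ unitMeasure :=
  Measure.ae_le_iff_absolutelyContinuous.1 hα.ae_eq.le

theorem aestronglyMeasurable_sqrt :
    AEStronglyMeasurable (fun t => ((Real.sqrt (α t) : ℝ) : ℂ)) unitMeasure :=
  (Complex.continuous_ofReal.comp_continuousOn (Real.continuous_sqrt.comp_continuousOn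
    (hα.continuousOn.mono Ioo_subset_Icc_self))).aestronglyMeasurable measurableSet_Ioo

theorem sqrt_ne_zero {t : ℝ} (ht : t ∈ Ioo (0 : ℝ) 1) : ((Real.sqrt (α t) : ℝ) : ℂ) ≠ 0 := by
  have := Real.sqrt_pos.2 (hα.pos' t ht)
  exact_mod_cast this.ne'

section

variable {H : Type*} [NormedAddCommGroup H] [NormedSpace ℂ H]

theorem aestronglyMeasurable_iff {u : ℝ → H} :
    AEStronglyMeasurable u (weightMeasure α) ↔
      AEStronglyMeasurable (fun t => ((Real.sqrt (α t) : ℝ) : ℂ) • u t) unitMeasure := by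
  constructor
  · intro h
    exact hα.aestronglyMeasurable_sqrt.smul (h.mono_ac hα.absolutelyContinuous)
  · intro h
    refine AEStronglyMeasurable.mono_ac hα.absolutelyContinuous' ?_
    have hinv : AEStronglyMeasurable (fun t => (((Real.sqrt (α t) : ℝ) : ℂ))⁻¹) unitMeasure :=
      hα.aestronglyMeasurable_sqrt.aemeasurable.inv.aestronglyMeasurable
    refine (hinv.smul h).congr ?_
    filter_upwards [ae_unit_mem] with t ht
    simp only [Pi.smul_apply']
    rw [inv_smul_smul₀ (hα.sqrt_ne_zero ht)]

theorem eLpNorm_eq (u : ℝ → H) :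
    eLpNorm u 2 (weightMeasure α) =
      eLpNorm (fun t => ((Real.sqrt (α t) : ℝ) : ℂ) • u t) 2 unitMeasure := by
  rw [eLpNorm_eq_lintegral_rpow_enorm_toReal two_ne_zero ENNReal.ofNat_ne_top,
    eLpNorm_eq_lintegral_rpow_enorm_toReal two_ne_zero ENNReal.ofNat_ne_top, weightMeasure,
    lintegral_withDensity_eq_lintegral_mul_non_measurable₀ _ hα.aemeasurable
      (Eventually.of_forall fun t => ENNReal.ofReal_lt_top)]
  congr 1
  refine lintegral_congr_ae ?_
  filter_upwards [ae_unit_mem] with t ht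
  have hp := (hα.pos' t ht).le
  have h2 : ENNReal.toReal 2 = (2 : ℕ) := by simp
  rw [Pi.mul_apply, enorm_smul, h2, ENNReal.rpow_natCast, ENNReal.rpow_natCast, mul_pow]
  congr 1
  rw [← ofReal_norm, Complex.norm_real, Real.norm_of_nonneg (Real.sqrt_nonneg _),
    ← ENNReal.ofReal_pow (Real.sqrt_nonneg _), Real.sq_sqrt hp]

theorem memLp_iff {u : ℝ → H} :
    MemLp u 2 (weightMeasure α) ↔
      MemLp (fun t => ((Real.sqrt (α t) : ℝ) : ℂ) • u t) 2 unitMeasure := by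
  rw [MemLp, MemLp, hα.eLpNorm_eq, hα.aestronglyMeasurable_iff]

end

variable {H : Type*} [NormedAddCommGroup H] [InnerProductSpace ℂ H]

theorem inner_eq (u v : WeightedL2 H α) :
    ⟪u, v⟫_ℂ = ∫ t, ⟪((Real.sqrt (α t) : ℝ) : ℂ) • u t, ((Real.sqrt (α t) : ℝ) : ℂ) • v t⟫_ℂ
      ∂unitMeasure := by
  rw [L2.inner_def]
  refine (integral_withDensity_eq_integral_toReal_smul₀ hα.aemeasurable
    (Eventually.of_forall fun t => ENNReal.ofReal_lt_top) (fun t => ⟪u t, v t⟫_ℂ)).trans ?_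
  refine integral_congr_ae ?_
  filter_upwards [ae_unit_mem] with t ht
  have hp := (hα.pos' t ht).le
  rw [ENNReal.toReal_ofReal hp, inner_smul_left, inner_smul_right, Complex.conj_ofReal, ← mul_assoc,
    ← Complex.ofReal_mul, Real.mul_self_sqrt hp]
  exact Complex.real_smul

end IsPosWeight

variable {H : Type*} [NormedAddCommGroup H] [InnerProductSpace ℂ H]

/-- Boundedness and strong continuity make `(t, x) ↦ K t x` jointly continuous once `t` is clamped
to `[0,1]`; it can then be composed with `(t, y t)`. -/
theorem aestronglyMeasurable_apply {K : ℝ → H →L[ℂ] H} {M : ℝ}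
    (hM : ∀ t ∈ Icc (0 : ℝ) 1, ‖K t‖ ≤ M)
    (hK : ∀ x, ContinuousOn (fun t => K t x) (Icc 0 1)) {y : ℝ → H}
    (hy : AEStronglyMeasurable y unitMeasure) :
    AEStronglyMeasurable (fun t => K t (y t)) unitMeasure := by
  have h01 : (0 : ℝ) ≤ 1 := zero_le_one
  have hcont : Continuous (fun p : ℝ × H => K (projIcc 0 1 h01 p.1) p.2) := by
    refine continuous_iff_continuousAt.2 fun p => ?_
    refine tendsto_apply_apply (K := fun p : ℝ × H => K (projIcc 0 1 h01 p.1)) (M := M)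
      (Eventually.of_forall fun q => hM _ (projIcc 0 1 h01 q.1).2) (continuous_snd.tendsto p) ?_
    have h1 : Continuous (fun t : ℝ => K (projIcc 0 1 h01 t) p.2) :=
      (continuousOn_iff_continuous_domRestrict.1 (hK p.2)).comp continuous_projIcc
    exact (h1.comp continuous_fst).tendsto p
  refine (hcont.comp_aestronglyMeasurable (aestronglyMeasurable_id.prodMk hy)).congr ?_
  filter_upwards [ae_unit_mem] with t ht
  simp only [id]
  rw [projIcc_of_mem h01 (Ioo_subset_Icc_self ht)]

/-- The unitary equivalence `y ↦ V y / √α` of `L²(H,(0,1))` and `L²_α(H,(0,1))`. -/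
theorem exists_weightedEquiv [CompleteSpace H] {α : ℝ → ℝ} (hα : IsPosWeight α)
    {D : Submodule ℂ H} {Ai : ℝ → H →ₗ.[ℂ] H} {V Y : ℝ → H →L[ℂ] H}
    (hV : IsEvolutionPair D Ai V Y) :
    ∃ Φ : Lp H 2 unitMeasure ≃ₗᵢ[ℂ] WeightedL2 H α, ∀ y : Lp H 2 unitMeasure,
      ∀ᵐ t ∂unitMeasure, ((Real.sqrt (α t) : ℝ) : ℂ) • Φ y t = V t (y t) := by
  have hmeasV : ∀ {y : ℝ → H}, AEStronglyMeasurable y unitMeasure →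
      AEStronglyMeasurable (fun t => V t (y t)) unitMeasure :=
    aestronglyMeasurable_apply (fun t ht => norm_le_one_of_forall (hV.norm_V t ht))
      hV.continuousOn_V
  have hmeasY : ∀ {y : ℝ → H}, AEStronglyMeasurable y unitMeasure →
      AEStronglyMeasurable (fun t => Y t (y t)) unitMeasure :=
    aestronglyMeasurable_apply (fun t ht => norm_le_one_of_forall (hV.norm_Y t ht))
      hV.continuousOn_Y
  have hmul : ∀ y : Lp H 2 unitMeasure, (fun t => ((Real.sqrt (α t) : ℝ) : ℂ) •
      (((Real.sqrt (α t) : ℝ) : ℂ)⁻¹ • V t (y t))) =ᵐ[unitMeasure] fun t => V t (y t) := by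
    intro y
    filter_upwards [ae_unit_mem] with t ht using smul_inv_smul₀ (hα.sqrt_ne_zero ht) _
  have hmem : ∀ y : Lp H 2 unitMeasure,
      MemLp (fun t => ((Real.sqrt (α t) : ℝ) : ℂ)⁻¹ • V t (y t)) 2 (weightMeasure α) := by
    intro y
    rw [hα.memLp_iff, memLp_congr_ae (hmul y)]
    refine (memLp_congr_norm (hmeasV (Lp.aestronglyMeasurable y)) (Lp.aestronglyMeasurable y) ?_).2
      (Lp.memLp y)
    filter_upwards [ae_unit_mem] with t ht using hV.norm_V t (Ioo_subset_Icc_self ht) _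
  have hcoe : ∀ y : Lp H 2 unitMeasure, ∀ᵐ t ∂unitMeasure,
      (hmem y).toLp _ t = ((Real.sqrt (α t) : ℝ) : ℂ)⁻¹ • V t (y t) := fun y =>
    hα.ae_iff.1 (hmem y).coeFn_toLp
  have hext : ∀ {u v : WeightedL2 H α}, (∀ᵐ t ∂unitMeasure, u t = v t) → u = v :=
    fun h => Lp.ext (hα.ae_iff.2 h)
  let Φ : Lp H 2 unitMeasure →ₗᵢ[ℂ] WeightedL2 H α :=
    { toFun := fun y => (hmem y).toLp _
      map_add' := fun x y => by
        refine hext ?_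
        filter_upwards [hcoe (x + y), hcoe x, hcoe y, Lp.coeFn_add x y,
          hα.ae_iff.1 (Lp.coeFn_add ((hmem x).toLp _) ((hmem y).toLp _))] with t h1 h2 h3 h4 h5
        rw [h1, h5, Pi.add_apply, h2, h3, h4, Pi.add_apply, map_add, smul_add]
      map_smul' := fun c y => by
        refine hext ?_
        filter_upwards [hcoe (c • y), hcoe y, Lp.coeFn_smul c y,
          hα.ae_iff.1 (Lp.coeFn_smul c ((hmem y).toLp _))] with t h1 h2 h3 h4
        rw [RingHom.id_apply, h1, h4, Pi.smul_apply, h2, h3, Pi.smul_apply, map_smul, smul_comm]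
      norm_map' := fun y => by
        change ‖(hmem y).toLp _‖ = ‖y‖
        rw [Lp.norm_toLp, Lp.norm_def, hα.eLpNorm_eq, eLpNorm_congr_ae (hmul y)]
        congr 1
        refine eLpNorm_congr_norm_ae ?_
        filter_upwards [ae_unit_mem] with t ht using hV.norm_V t (Ioo_subset_Icc_self ht) _ }
  have hΦ : ∀ y, ∀ᵐ t ∂unitMeasure, Φ y t = ((Real.sqrt (α t) : ℝ) : ℂ)⁻¹ • V t (y t) := hcoe
  have hsurj : Function.Surjective Φ := by
    intro u
    have hu := hα.memLp_iff.1 (Lp.memLp u)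
    have hy : MemLp (fun t => Y t (((Real.sqrt (α t) : ℝ) : ℂ) • u t)) 2 unitMeasure := by
      refine (memLp_congr_norm (hmeasY hu.1) hu.1 ?_).2 hu
      filter_upwards [ae_unit_mem] with t ht using hV.norm_Y t (Ioo_subset_Icc_self ht) _
    refine ⟨hy.toLp _, hext ?_⟩
    filter_upwards [hΦ (hy.toLp _), hy.coeFn_toLp, ae_unit_mem] with t h1 h2 h3
    rw [h1, h2, hV.V_Y t (Ioo_subset_Icc_self h3), inv_smul_smul₀ (hα.sqrt_ne_zero h3)]
  refine ⟨LinearIsometryEquiv.ofSurjective Φ hsurj, fun y => ?_⟩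
  filter_upwards [hΦ y, ae_unit_mem] with t h1 h2
  rw [LinearIsometryEquiv.coe_ofSurjective, h1, smul_inv_smul₀ (hα.sqrt_ne_zero h2)]

end NormalExt

/-! ### Adjoints of operators generated by sets of pairs. -/

namespace NormalExt
open Filter Topology

variable {E : Type*} [NormedAddCommGroup E] [InnerProductSpace ℂ E]

theorem mem_domain_of_graph {T : E →ₗ.[ℂ] E} {u v : E} (h : (u, v) ∈ T.graph) : u ∈ T.domain :=
  LinearPMap.mem_domain_of_mem_graph h

theorem app_of_graph {T : E →ₗ.[ℂ] E} {u v : E} (h : (u, v) ∈ T.graph) : app T u = v := by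
  obtain ⟨w, hw1, hw2⟩ := (LinearPMap.mem_graph_iff T).1 h
  simp only at hw1 hw2
  subst hw1
  rw [app_of_mem T w.2, ← hw2]

theorem mem_graph_app {T : E →ₗ.[ℂ] E} {u : E} (h : u ∈ T.domain) : (u, app T u) ∈ T.graph := by
  rw [app_of_mem T h]
  exact T.mem_graph ⟨u, h⟩

/-- Two sets of pairs that generate densely defined, formally adjoint operators. -/
structure IsFormalPair (G G' : Set (E × E)) : Prop where
  inner_eq : ∀ p ∈ G, ∀ q ∈ G', ⟪q.2, p.1⟫_ℂ = ⟪q.1, p.2⟫_ℂ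
  dense : ((Submodule.span ℂ (Prod.fst '' G))ᗮ : Submodule ℂ E) = ⊥
  dense' : ((Submodule.span ℂ (Prod.fst '' G'))ᗮ : Submodule ℂ E) = ⊥

namespace IsFormalPair

variable {G G' : Set (E × E)}

theorem symm (h : IsFormalPair G G') : IsFormalPair G' G where
  inner_eq p hp q hq := by
    rw [← inner_conj_symm, ← inner_conj_symm q.1, h.inner_eq q hq p hp]
  dense := h.dense'
  dense' := h.dense

/-- If `(0, v)` lies in the span of `G`, then `v` is orthogonal to all first components of `G'`,
which span a dense subspace. So the span is a genuine graph. -/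
theorem single_valued (h : IsFormalPair G G') {p : E × E} (hp : p ∈ Submodule.span ℂ G)
    (h0 : p.1 = 0) : p.2 = 0 := by
  have key : ∀ q ∈ G', ∀ p ∈ Submodule.span ℂ G, ⟪q.2, p.1⟫_ℂ = ⟪q.1, p.2⟫_ℂ := by
    intro q hq p hp
    induction hp using Submodule.span_induction with
    | mem p hp => exact h.inner_eq p hp q hq
    | zero => simp
    | add x y _ _ hx hy => simp [hx, hy]
    | smul c x _ hx => simp [hx]
  have : p.2 ∈ ((Submodule.span ℂ (Prod.fst '' G'))ᗮ : Submodule ℂ E) := by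
    rw [Submodule.mem_orthogonal]
    intro x hx
    induction hx using Submodule.span_induction with
    | mem x hx =>
      obtain ⟨q, hq, rfl⟩ := hx
      rw [← key q hq p hp, h0, inner_zero_right]
    | zero => simp
    | add x y _ _ hx hy => simp [inner_add_left, hx, hy]
    | smul c x _ hx => simp [inner_smul_left, hx]
  rwa [h.dense', Submodule.mem_bot] at this

theorem graph_eq (h : IsFormalPair G G') :
    (Submodule.span ℂ G).toLinearPMap.graph = Submodule.span ℂ G :=
  Submodule.toLinearPMap_graph_eq _ fun _ hp h0 => h.single_valued hp h0

end IsFormalPair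

variable [CompleteSpace E]

theorem adjoint_closure {T : E →ₗ.[ℂ] E} (hT : Dense (T.domain : Set E)) :
    T.closure.adjoint = T.adjoint := by
  by_cases hc : T.IsClosable
  · have hT' : Dense (T.closure.domain : Set E) := hT.mono T.le_closure.1
    refine LinearPMap.eq_of_eq_graph ?_
    rw [LinearPMap.adjoint_graph_eq_graph_adjoint hT', LinearPMap.adjoint_graph_eq_graph_adjoint hT,
      ← hc.graph_closure_eq_closure_graph]
    refine le_antisymm (fun x hx => ?_) (fun x hx => ?_)
    · rw [Submodule.mem_adjoint_iff] at hx ⊢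
      exact fun a b hab => hx a b (Submodule.le_topologicalClosure _ hab)
    · rw [Submodule.mem_adjoint_iff] at hx ⊢
      intro a b hab
      have hcl : IsClosed {p : E × E | ⟪p.2, x.1⟫_ℂ - ⟪p.1, x.2⟫_ℂ = 0} :=
        isClosed_eq (by fun_prop) continuous_const
      exact closure_minimal (fun p hp => hx p.1 p.2 hp) hcl hab
  -- For a non-closable operator, `closure` is the operator itself by convention.
  · rw [LinearPMap.closure_def' hc]

namespace IsFormalPair

variable {G G' : Set (E × E)}

theorem dense_domain (h : IsFormalPair G G') :
    Dense ((Submodule.span ℂ G).toLinearPMap.domain : Set E) := by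
  rw [Submodule.toLinearPMap_domain, Submodule.map_span]
  exact Submodule.dense_iff_topologicalClosure_eq_top.2
    (Submodule.topologicalClosure_eq_top_iff.2 h.dense)

theorem mem_graph_iff (h : IsFormalPair G G') {u v : E} :
    (u, v) ∈ (Submodule.span ℂ G).toLinearPMap.closure.adjoint.graph ↔
      ∀ p ∈ G, ⟪p.2, u⟫_ℂ = ⟪p.1, v⟫_ℂ := by
  rw [adjoint_closure h.dense_domain, LinearPMap.adjoint_graph_eq_graph_adjoint h.dense_domain,
    h.graph_eq, Submodule.mem_adjoint_iff]
  constructor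
  · intro hp p hpG
    exact sub_eq_zero.1 (hp p.1 p.2 (Submodule.subset_span hpG))
  · intro hp a b hab
    suffices ∀ p ∈ Submodule.span ℂ G, ⟪p.2, u⟫_ℂ = ⟪p.1, v⟫_ℂ from sub_eq_zero.2 (this _ hab)
    intro p hp'
    induction hp' using Submodule.span_induction with
    | mem p hpG => exact hp p hpG
    | zero => simp
    | add x y _ _ hx hy => simp [hx, hy]
    | smul c x _ hx => simp [hx]

/-- Weak closedness of the graph of an adjoint: the images need only stay bounded, because the bound
`|⟪u n, T x⟫| ≤ K ‖x‖` passes to the limit and is exactly membership in the adjoint domain. -/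
theorem exists_mem_graph_of_tendsto (h : IsFormalPair G G') {u v : ℕ → E} {u₀ : E} {K : ℝ}
    (hg : ∀ n, (u n, v n) ∈ (Submodule.span ℂ G).toLinearPMap.closure.adjoint.graph)
    (hu : Tendsto u atTop (𝓝 u₀)) (hv : ∀ n, ‖v n‖ ≤ K) :
    ∃ v₀, (u₀, v₀) ∈ (Submodule.span ℂ G).toLinearPMap.closure.adjoint.graph ∧ ‖v₀‖ ≤ K := by
  have hd := h.dense_domain
  generalize (Submodule.span ℂ G).toLinearPMap = T at hg hd ⊢
  rw [adjoint_closure hd] at hg ⊢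
  have hbound : ∀ x : T.domain, ‖⟪u₀, T x⟫_ℂ‖ ≤ K * ‖x‖ := by
    intro x
    have h1 : Tendsto (fun n => ‖⟪u n, T x⟫_ℂ‖) atTop (𝓝 ‖⟪u₀, T x⟫_ℂ‖) :=
      (hu.inner tendsto_const_nhds).norm
    refine le_of_tendsto' h1 fun n => ?_
    obtain ⟨w, hw1, hw2⟩ := (LinearPMap.mem_graph_iff _).1 (hg n)
    simp only at hw1 hw2
    have h2 := LinearPMap.adjoint_isFormalAdjoint hd w x
    rw [hw2, hw1] at h2
    rw [← h2]
    exact (norm_inner_le_norm _ _).trans (mul_le_mul_of_nonneg_right (hv n) (norm_nonneg _))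
  have hdom : u₀ ∈ T.adjoint.domain := by
    rw [LinearPMap.mem_adjoint_domain_iff]
    exact AddMonoidHomClass.continuous_of_bound ((innerₛₗ ℂ u₀).comp T.toFun) K hbound
  refine ⟨T.adjoint ⟨u₀, hdom⟩, LinearPMap.mem_graph _ ⟨u₀, hdom⟩, ?_⟩
  have hK : 0 ≤ K := (norm_nonneg _).trans (hv 0)
  set v₀ := T.adjoint ⟨u₀, hdom⟩
  have hall : ∀ x : E, ‖⟪v₀, x⟫_ℂ‖ ≤ K * ‖x‖ := by
    have hcl : IsClosed {x : E | ‖⟪v₀, x⟫_ℂ‖ ≤ K * ‖x‖} :=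
      isClosed_le (by fun_prop) (by fun_prop)
    intro x
    refine closure_minimal (fun x hx => ?_) hcl (hd x)
    have h2 := LinearPMap.adjoint_isFormalAdjoint hd ⟨u₀, hdom⟩ ⟨x, hx⟩
    change ‖⟪v₀, x⟫_ℂ‖ ≤ K * ‖x‖
    rw [h2]
    exact hbound ⟨x, hx⟩
  have h3 := hall v₀
  rw [inner_self_eq_norm_sq_to_K] at h3
  have h4 : ‖v₀‖ * ‖v₀‖ ≤ K * ‖v₀‖ := by
    simpa [pow_two] using h3
  rcases eq_or_lt_of_le (norm_nonneg v₀) with h5 | h5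
  · rw [← h5]; exact hK
  · exact le_of_mul_le_mul_right h4 h5

end IsFormalPair

end NormalExt

/-! ### Test functions and the generators of `L₀'` and its formal adjoint after multiplication by
`√α`. -/

namespace NormalExt
open Filter Topology

/-- The compact support lies inside `(0,1)`, so `F` is differentiable on the whole line with
derivative the extension of `F'` by zero, and no boundary terms arise. -/
theorem integral_eq_zero_of_compact_support {F F' : ℝ → ℂ} {K : Set ℝ} (hK : IsCompact K)
    (hKs : K ⊆ Ioo 0 1) (hF : ∀ t ∉ K, F t = 0) (hd : ∀ t ∈ Ioo (0 : ℝ) 1, HasDerivAt F (F' t) t)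
    (hi : Integrable F' unitMeasure) : ∫ t, F' t ∂unitMeasure = 0 := by
  have hder : ∀ t, HasDerivAt F ((Ioo (0 : ℝ) 1).indicator F' t) t := by
    intro t
    by_cases ht : t ∈ Ioo (0 : ℝ) 1
    · rw [indicator_of_mem ht]; exact hd t ht
    · rw [indicator_of_notMem ht]
      have h0 : F =ᶠ[𝓝 t] fun _ => 0 := by
        filter_upwards [hK.isClosed.isOpen_compl.mem_nhds fun h => ht (hKs h)] with s hs using hF s hs
      exact (hasDerivAt_const t (0 : ℂ)).congr_of_eventuallyEq h0
  have hcont : Continuous F := continuous_iff_continuousAt.2 fun t => (hder t).continuousAt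
  have hsupp : HasCompactSupport F := HasCompactSupport.intro hK hF
  have := integral_eq_zero_of_hasDerivAt_of_integrable hder
    ((integrable_indicator_iff measurableSet_Ioo).2 hi) (hcont.integrable_of_hasCompactSupport hsupp)
  rwa [integral_indicator measurableSet_Ioo] at this

theorem memLp_of_compact_support {F : Type*} [NormedAddCommGroup F] {k : ℝ → F} {K : Set ℝ}
    (hK : IsCompact K) (hKs : K ⊆ Ioo 0 1) (hk : ContinuousOn k (Ioo 0 1))
    (h0 : ∀ t ∉ K, k t = 0) : MemLp k 2 unitMeasure := by
  obtain ⟨M, hM⟩ := hK.exists_bound_of_continuousOn (hk.mono hKs)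
  refine MemLp.of_bound (hk.aestronglyMeasurable measurableSet_Ioo) (max M 0)
    (Eventually.of_forall fun t => ?_)
  by_cases ht : t ∈ K
  · exact (hM t ht).trans (le_max_left _ _)
  · rw [h0 t ht, norm_zero]; exact le_max_right _ _

/-- The derivative of `⟪y, z⟫` when `z` is merely continuous but `⟪y t, z⟫` is differentiable. -/
theorem hasDerivAt_inner_of_continuousAt {H : Type*} [NormedAddCommGroup H] [InnerProductSpace ℂ H]
    {y z : ℝ → H} {y' : H} {c : ℂ} {t : ℝ} (hy : HasDerivAt y y' t) (hz : ContinuousAt z t)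
    (hc : HasDerivAt (fun r => ⟪y t, z r⟫_ℂ) c t) :
    HasDerivAt (fun r => ⟪y r, z r⟫_ℂ) (⟪y', z t⟫_ℂ + c) t := by
  rw [hasDerivAt_iff_tendsto_slope] at hy hc ⊢
  have h1 : Tendsto (fun r => ⟪slope y t r, z r⟫_ℂ) (𝓝[≠] t) (𝓝 ⟪y', z t⟫_ℂ) :=
    hy.inner (hz.tendsto.mono_left nhdsWithin_le_nhds)
  refine (h1.add hc).congr fun r => ?_
  simp only [slope, vsub_eq_sub]
  rw [← Complex.coe_smul (r - t)⁻¹ (y r - y t), inner_smul_left, Complex.conj_ofReal, inner_sub_left,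
    Complex.real_smul, Complex.real_smul]
  ring

theorem IsTestFun.compact {φ : ℝ → ℂ} (hφ : IsTestFun φ) : IsCompact (tsupport φ) := hφ.2.1

theorem IsTestFun.hasDerivAt {φ : ℝ → ℂ} (hφ : IsTestFun φ) (t : ℝ) :
    HasDerivAt φ (deriv φ t) t :=
  (hφ.1.differentiable (by simp) t).hasDerivAt

theorem IsTestFun.continuous_deriv {φ : ℝ → ℂ} (hφ : IsTestFun φ) : Continuous (deriv φ) :=
  hφ.1.continuous_deriv (by simp)

theorem IsTestFun.eq_zero {φ : ℝ → ℂ} {t : ℝ} (ht : t ∉ tsupport φ) : φ t = 0 :=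
  image_eq_zero_of_notMem_tsupport ht

theorem IsTestFun.deriv_eq_zero {φ : ℝ → ℂ} {t : ℝ} (ht : t ∉ tsupport φ) : deriv φ t = 0 := by
  by_contra h
  exact ht (support_deriv_subset (by simpa using h))

/-- `√α φ`. -/
def weightedTest (α : ℝ → ℝ) (φ : ℝ → ℂ) (t : ℝ) : ℂ := ((Real.sqrt (α t) : ℝ) : ℂ) * φ t

/-- The derivative of `√α φ`. -/
def weightedTestDeriv (α : ℝ → ℝ) (φ : ℝ → ℂ) (t : ℝ) : ℂ :=
  ((deriv α t / (2 * Real.sqrt (α t)) : ℝ) : ℂ) * φ t + ((Real.sqrt (α t) : ℝ) : ℂ) * deriv φ t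

theorem weightedTest_eq_zero {α : ℝ → ℝ} {φ : ℝ → ℂ} {t : ℝ} (ht : t ∉ tsupport φ) :
    weightedTest α φ t = 0 := by
  rw [weightedTest, IsTestFun.eq_zero ht, mul_zero]

theorem IsPosWeight.hasDerivAt_weightedTest {α : ℝ → ℝ} (hα : IsPosWeight α) {φ : ℝ → ℂ}
    (hφ : IsTestFun φ) {t : ℝ} (ht : t ∈ Ioo (0 : ℝ) 1) :
    HasDerivAt (weightedTest α φ) (weightedTestDeriv α φ t) t :=
  ((hα.hasDerivAt ht).sqrt (hα.pos' t ht).ne').ofReal_comp.mul (hφ.hasDerivAt t)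

variable {H : Type*} [NormedAddCommGroup H] [InnerProductSpace ℂ H] [CompleteSpace H]

/-- The generators of the graph of the operator `L₀'`. -/
def generators (α : ℝ → ℝ) (Ar Ai : ℝ → H →ₗ.[ℂ] H) (D : Submodule ℂ H) :
    Set (WeightedL2 H α × WeightedL2 H α) :=
  {p | ∃ φ : ℝ → ℂ, IsTestFun φ ∧ ∃ f ∈ D,
      (∀ᵐ t ∂(weightMeasure α), p.1 t = φ t • f) ∧
      (∀ᵐ t ∂(weightMeasure α),
        p.2 t = deriv φ t • f + φ t • app (coeff Ar Ai t) f)}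

/-- The generators for the formally adjoint expression. -/
def generatorsPlus (α : ℝ → ℝ) (Ar Ai : ℝ → H →ₗ.[ℂ] H) (D : Submodule ℂ H) :
    Set (WeightedL2 H α × WeightedL2 H α) :=
  {p | ∃ φ : ℝ → ℂ, IsTestFun φ ∧ ∃ f ∈ D,
      (∀ᵐ t ∂(weightMeasure α), p.1 t = φ t • f) ∧
      (∀ᵐ t ∂(weightMeasure α),
        p.2 t = -((deriv (fun s => (α s : ℂ) * φ s) t / (α t : ℂ)) • f)
          + φ t • app (coeff Ar Ai t).adjoint f)}

/-- The data of the problem with positive weight, the resolvent `J = (1 + C)⁻¹` and the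
evolution operators `V t = U(t,0)`, `Y t = U(0,t)`. -/
structure IsSystem (α : ℝ → ℝ) (Ar Ai : ℝ → H →ₗ.[ℂ] H) (C : H →ₗ.[ℂ] H) (D : Submodule ℂ H)
    (J : H →L[ℂ] H) (V Y : ℝ → H →L[ℂ] H) : Prop where
  weight : IsPosWeight α
  coeff : IsNormalCoeff α Ar Ai C D
  resolvent : IsResolventAt C (-1) J
  evolution : IsEvolutionPair D Ai V Y

section Generators

variable {α : ℝ → ℝ} {Ar Ai : ℝ → H →ₗ.[ℂ] H} {C : H →ₗ.[ℂ] H} {D : Submodule ℂ H}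

namespace IsNormalCoeff

theorem mem_re (hA : IsNormalCoeff α Ar Ai C D) {t : ℝ} (ht : t ∈ Ioo (0 : ℝ) 1) {f : H}
    (hf : f ∈ D) : f ∈ (Ar t).domain := by
  have h := hA.domain_eq t ht ▸ hf
  exact h.1

theorem app_coeff (hA : IsNormalCoeff α Ar Ai C D) {t : ℝ} (ht : t ∈ Ioo (0 : ℝ) 1) {f : H}
    (hf : f ∈ D) : app (coeff Ar Ai t) f = app (Ar t) f + Complex.I • app (Ai t) f :=
  NormalExt.app_coeff (hA.mem_re ht hf) (hA.le_domain_im t (Ioo_subset_Icc_self ht) hf)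

theorem app_coeff_adjoint (hA : IsNormalCoeff α Ar Ai C D) {t : ℝ} (ht : t ∈ Ioo (0 : ℝ) 1) {f : H}
    (hf : f ∈ D) : app (coeff Ar Ai t).adjoint f = app (Ar t) f - Complex.I • app (Ai t) f := by
  have htc := Ioo_subset_Icc_self ht
  have key : ∀ x : (coeff Ar Ai t).domain,
      ⟪app (Ar t) f - Complex.I • app (Ai t) f, (x : H)⟫_ℂ = ⟪f, coeff Ar Ai t x⟫_ℂ := by
    intro x
    have hx : (x : H) ∈ D := hA.domain_eq t ht ▸ x.2
    rw [← app_of_mem _ x.2, hA.app_coeff ht hx, inner_sub_left, inner_add_right, inner_smul_left,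
      inner_smul_right, inner_app_left (hA.selfAdjoint_re t ht) (hA.mem_re ht hf) (hA.mem_re ht hx),
      inner_app_left (hA.selfAdjoint_im t htc) (hA.le_domain_im t htc hf)
        (hA.le_domain_im t htc hx), Complex.conj_I]
    ring
  have hd : f ∈ (coeff Ar Ai t).adjoint.domain :=
    LinearPMap.mem_adjoint_domain_of_exists f ⟨_, key⟩
  rw [app_of_mem _ hd]
  refine LinearPMap.adjoint_apply_eq ?_ ⟨f, hd⟩ key
  rw [hA.domain_eq t ht]
  exact hA.dense

theorem ae_app_re (hA : IsNormalCoeff α Ar Ai C D) :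
    ∀ᵐ t ∂unitMeasure, ∀ f ∈ D,
      app (Ar t) f = ((deriv α t / (2 * α t) : ℝ) : ℂ) • f + app C f := by
  filter_upwards [hA.re_eq] with t ht f hf
  rw [ht, app_vadd _ _ (hA.le_domain hf)]

end IsNormalCoeff

theorem sqrt_smul_identity {α : ℝ → ℝ} (hα : IsPosWeight α) {t : ℝ} (ht : t ∈ Ioo (0 : ℝ) 1) :
    ((Real.sqrt (α t) : ℝ) : ℂ) * ((deriv α t / (2 * α t) : ℝ) : ℂ) =
      ((deriv α t / (2 * Real.sqrt (α t)) : ℝ) : ℂ) := by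
  have h := hα.pos' t ht
  have h1 := Real.sqrt_pos.2 h
  rw [← Complex.ofReal_mul]
  congr 1
  nth_rewrite 2 [← Real.mul_self_sqrt h.le]
  field_simp

/-- The term `α'/(2α)` of `A_r` combines with `√α φ'` into the derivative of `√α φ`, and only `C + i
A_i` remains. -/
theorem generators_ae (hα : IsPosWeight α) (hA : IsNormalCoeff α Ar Ai C D)
    {p : WeightedL2 H α × WeightedL2 H α} (hp : p ∈ generators α Ar Ai D) :
    ∃ φ : ℝ → ℂ, IsTestFun φ ∧ ∃ f ∈ D, ∀ᵐ t ∂unitMeasure,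
      ((Real.sqrt (α t) : ℝ) : ℂ) • p.1 t = weightedTest α φ t • f ∧
      ((Real.sqrt (α t) : ℝ) : ℂ) • p.2 t = weightedTestDeriv α φ t • f +
        weightedTest α φ t • (app C f + Complex.I • app (Ai t) f) := by
  obtain ⟨φ, hφ, f, hf, h1, h2⟩ := hp
  refine ⟨φ, hφ, f, hf, ?_⟩
  filter_upwards [hα.ae_iff.1 h1, hα.ae_iff.1 h2, hA.ae_app_re, ae_unit_mem] with t h1 h2 h3 ht
  constructor
  · rw [h1, smul_smul]; rfl
  · rw [h2, hA.app_coeff ht hf, h3 f hf, weightedTestDeriv, weightedTest, ← sqrt_smul_identity hα ht]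
    module

/-- Here `-(α φ)'/α` contributes `-α'/α`, and `A_r` gives back `α'/(2α)`; after multiplication by
`√α` the net result is `-(√α φ)'`. -/
theorem generatorsPlus_ae (hα : IsPosWeight α) (hA : IsNormalCoeff α Ar Ai C D)
    {p : WeightedL2 H α × WeightedL2 H α} {φ : ℝ → ℂ} (hφ : IsTestFun φ) {f : H} (hf : f ∈ D)
    (h1 : ∀ᵐ t ∂(weightMeasure α), p.1 t = φ t • f)
    (h2 : ∀ᵐ t ∂(weightMeasure α),
        p.2 t = -((deriv (fun s => (α s : ℂ) * φ s) t / (α t : ℂ)) • f)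
          + φ t • app (coeff Ar Ai t).adjoint f) :
    ∀ᵐ t ∂unitMeasure,
      ((Real.sqrt (α t) : ℝ) : ℂ) • p.1 t = weightedTest α φ t • f ∧
      ((Real.sqrt (α t) : ℝ) : ℂ) • p.2 t = -(weightedTestDeriv α φ t • f) +
        weightedTest α φ t • (app C f - Complex.I • app (Ai t) f) := by
  filter_upwards [hα.ae_iff.1 h1, hα.ae_iff.1 h2, hA.ae_app_re, ae_unit_mem] with t h1 h2 h3 ht
  constructor
  · rw [h1, smul_smul]; rfl
  · have hd : deriv (fun s => (α s : ℂ) * φ s) t = ((deriv α t : ℝ) : ℂ) * φ t + (α t : ℂ) * deriv φ t :=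
      ((hα.hasDerivAt ht).ofReal_comp.mul (hφ.hasDerivAt t)).deriv
    have hα0 : (α t : ℂ) ≠ 0 := by exact_mod_cast (hα.pos' t ht).ne'
    have hdiv : (((deriv α t : ℝ) : ℂ) * φ t + (α t : ℂ) * deriv φ t) / (α t : ℂ) =
        2 * ((deriv α t / (2 * α t) : ℝ) : ℂ) * φ t + deriv φ t := by
      push_cast
      field_simp
    rw [h2, hd, hdiv, hA.app_coeff_adjoint ht hf, h3 f hf, weightedTestDeriv, weightedTest,
      ← sqrt_smul_identity hα ht]
    module

end Generators
end NormalExt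

/-! ### Green's formulas for `z' + C z` and `-z' + C z`. -/

namespace NormalExt
open Filter Topology

variable {H : Type*} [NormedAddCommGroup H] [InnerProductSpace ℂ H]

theorem integrable_inner_of_memLp {u v : ℝ → H} (hu : MemLp u 2 unitMeasure)
    (hv : MemLp v 2 unitMeasure) : Integrable (fun t => ⟪u t, v t⟫_ℂ) unitMeasure := by
  refine (L2.integrable_inner (𝕜 := ℂ) (hu.toLp u) (hv.toLp v)).congr ?_
  filter_upwards [hu.coeFn_toLp, hv.coeFn_toLp] with t h1 h2
  rw [h1, h2]

variable {α : ℝ → ℝ} {Ar Ai : ℝ → H →ₗ.[ℂ] H} {C : H →ₗ.[ℂ] H} {D : Submodule ℂ H}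
  {J : H →L[ℂ] H} {V Y : ℝ → H →L[ℂ] H}

/-- Integrability of `F` is automatic, as `F` is almost everywhere a difference of inner products of
square-integrable functions. -/
theorem IsPosWeight.inner_eq_of_integral (hα : IsPosWeight α) {u v u' v' : WeightedL2 H α}
    {F : ℝ → ℂ} (hF : ∀ᵐ t ∂unitMeasure,
      ⟪((Real.sqrt (α t) : ℝ) : ℂ) • u t, ((Real.sqrt (α t) : ℝ) : ℂ) • v t⟫_ℂ -
      ⟪((Real.sqrt (α t) : ℝ) : ℂ) • u' t, ((Real.sqrt (α t) : ℝ) : ℂ) • v' t⟫_ℂ = F t)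
    (h0 : Integrable F unitMeasure → ∫ t, F t ∂unitMeasure = 0) : ⟪u, v⟫_ℂ = ⟪u', v'⟫_ℂ := by
  have h1 := integrable_inner_of_memLp (hα.memLp_iff.1 (Lp.memLp u)) (hα.memLp_iff.1 (Lp.memLp v))
  have h2 := integrable_inner_of_memLp (hα.memLp_iff.1 (Lp.memLp u'))
    (hα.memLp_iff.1 (Lp.memLp v'))
  rw [hα.inner_eq, hα.inner_eq, ← sub_eq_zero, ← integral_sub h1 h2, integral_congr_ae hF]
  exact h0 ((h1.sub h2).congr hF)

variable [CompleteSpace H]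

namespace IsSystem

variable (S : IsSystem α Ar Ai C D J V Y)
include S

theorem isPosResolvent : IsPosResolvent J :=
  S.resolvent.isPosResolvent S.coeff.selfAdjoint_const S.coeff.nonneg_const

theorem inner_J (x y : H) : ⟪J x, y⟫_ℂ = ⟪x, J y⟫_ℂ :=
  ContinuousLinearMap.isSelfAdjoint_iff_isSymmetric.1 S.isPosResolvent.selfAdjoint x y

theorem commute_V {t : ℝ} (ht : t ∈ Icc (0 : ℝ) 1) : Commute J (V t) :=
  S.evolution.commute S.coeff.dense S.coeff.selfAdjoint_im S.coeff.le_domain_im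
    (fun _ hf => S.coeff.resolvent_mem S.resolvent hf)
    (fun _ hf _ ht => S.coeff.app_resolvent S.resolvent hf ht) ht

theorem commute_Y {t : ℝ} (ht : t ∈ Icc (0 : ℝ) 1) : Commute J (Y t) :=
  S.evolution.commute_Y ht (S.commute_V ht)

theorem Y_eq {t : ℝ} (ht : t ∈ Icc (0 : ℝ) 1) {f : H} (hf : f ∈ D) :
    Y t f = J (Y t (app C f + f)) := by
  have h : J (Y t (app C f + f)) = Y t (J (app C f + f)) :=
    DFunLike.congr_fun (S.commute_Y ht).eq (app C f + f)
  rw [h, S.resolvent.apply_add (S.coeff.le_domain hf)]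

/-- This expresses `⟪Y t f, x⟫` through `J x` alone. For a mild solution `z` only `J z` is
differentiable, and this makes the pairing with `z` itself differentiable. -/
theorem inner_Y {t : ℝ} (ht : t ∈ Icc (0 : ℝ) 1) {f : H} (hf : f ∈ D) (x : H) :
    ⟪Y t f, x⟫_ℂ = ⟪Y t (app C f), J x⟫_ℂ + ⟪Y t f, J x⟫_ℂ := by
  conv_lhs => rw [S.Y_eq ht hf]
  rw [S.inner_J, map_add, inner_add_left]

theorem hasDerivAt_test {φ : ℝ → ℂ} (hφ : IsTestFun φ) {f : H} (hf : f ∈ D) {t : ℝ}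
    (ht : t ∈ Ioo (0 : ℝ) 1) :
    HasDerivAt (fun r => weightedTest α φ r • Y r f)
      (weightedTestDeriv α φ t • Y t f +
        weightedTest α φ t • Y t (Complex.I • app (Ai t) f)) t := by
  have h1 := (S.evolution.deriv_Y t (Ioo_subset_Icc_self ht) f hf).hasDerivAt (Icc_mem_nhds ht.1 ht.2)
  refine ((S.weight.hasDerivAt_weightedTest hφ ht).smul h1).congr_deriv ?_
  rw [add_comm]

/-- The hypothesis on `J z` is the weak form of `z' + C z = η`. The difference of the two integrands
is minus the derivative of `⟪√α φ Y f, z⟫`, which has compact support. This puts mild solutions in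
the domain of `L`. -/
theorem inner_generatorsPlus {q : WeightedL2 H α × WeightedL2 H α}
    (hq : q ∈ generatorsPlus α Ar Ai D) {z η : ℝ → H} {u v : WeightedL2 H α}
    (hz : ContinuousOn z (Ioo 0 1))
    (hJz : ∀ t ∈ Ioo (0 : ℝ) 1, HasDerivAt (fun r => J (z r)) (J (η t) + J (z t) - z t) t)
    (hu : ∀ᵐ t ∂unitMeasure, ((Real.sqrt (α t) : ℝ) : ℂ) • u t = V t (z t))
    (hv : ∀ᵐ t ∂unitMeasure, ((Real.sqrt (α t) : ℝ) : ℂ) • v t = V t (η t)) :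
    ⟪q.2, u⟫_ℂ = ⟪q.1, v⟫_ℂ := by
  obtain ⟨φ, hφ, f, hf, hq1, hq2⟩ := hq
  have hq := generatorsPlus_ae S.weight S.coeff hφ hf hq1 hq2
  set ψ := weightedTest α φ with hψ
  set ψ' := weightedTestDeriv α φ with hψ'
  -- Formally `⟪ψ Y f, η - C z⟫`, with `C` moved onto `f` because `z` need not lie in its domain.
  let c : ℝ → ℂ := fun t =>
    (starRingEnd ℂ) (ψ t) * (⟪Y t f, η t⟫_ℂ - ⟪Y t (app C f), z t⟫_ℂ)
  let F' : ℝ → ℂ := fun t =>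
    ⟪ψ' t • Y t f + ψ t • Y t (Complex.I • app (Ai t) f), z t⟫_ℂ + c t
  have hc : ∀ t ∈ Ioo (0 : ℝ) 1, HasDerivAt (fun r => ⟪ψ t • Y t f, z r⟫_ℂ) (c t) t := by
    intro t ht
    have htc := Ioo_subset_Icc_self ht
    have h1 : HasDerivAt (fun r => ⟪Y t (app C f) + Y t f, J (z r)⟫_ℂ)
        ⟪Y t (app C f) + Y t f, J (η t) + J (z t) - z t⟫_ℂ t := by
      refine ((hasDerivAt_const t (Y t (app C f) + Y t f)).inner ℂ (hJz t ht)).congr_deriv ?_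
      rw [inner_zero_left, add_zero]
    refine (h1.const_mul ((starRingEnd ℂ) (ψ t))).congr_deriv ?_ |>.congr_of_eventuallyEq ?_
    · simp only [c]
      rw [S.inner_Y htc hf (η t)]
      have h2 := S.inner_Y htc hf (z t)
      simp only [inner_add_left, inner_add_right, inner_sub_right]
      rw [h2]
      ring
    · refine Eventually.of_forall fun r => ?_
      simp only [inner_smul_left]
      rw [S.inner_Y htc hf, inner_add_left]
  have hF : ∀ t ∈ Ioo (0 : ℝ) 1, HasDerivAt (fun r => ⟪ψ r • Y r f, z r⟫_ℂ) (F' t) t :=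
    fun t ht => hasDerivAt_inner_of_continuousAt (S.hasDerivAt_test hφ hf ht)
      (hz.continuousAt (isOpen_Ioo.mem_nhds ht)) (hc t ht)
  refine S.weight.inner_eq_of_integral (F := fun t => -F' t) ?_ fun hi => ?_
  · filter_upwards [hq, hu, hv, ae_unit_mem] with t h1 h2 h3 ht
    have htc := Ioo_subset_Icc_self ht
    rw [h1.1, h1.2, h2, h3, S.evolution.inner_V htc, S.evolution.inner_V htc]
    simp only [F', c, map_add, map_sub, map_neg, map_smul, inner_add_left, inner_sub_left,
      inner_neg_left, inner_smul_left]
    ring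
  · rw [integral_neg, integral_eq_zero_of_compact_support hφ.compact hφ.2.2 (fun t ht => ?_) hF
      (by simpa using hi.neg), neg_zero]
    simp only [hψ]
    rw [weightedTest_eq_zero ht, zero_smul, inner_zero_left]

/-- Here `ζ = C z`, as the relation `J ζ = z - J z` says, so `v` corresponds to `-z' + C z`. -/
theorem inner_generators {p : WeightedL2 H α × WeightedL2 H α}
    (hp : p ∈ generators α Ar Ai D) {z z' ζ : ℝ → H} {u v : WeightedL2 H α}
    (hz : ∀ t ∈ Ioo (0 : ℝ) 1, HasDerivAt z (z' t) t)
    (hζ : ∀ t ∈ Ioo (0 : ℝ) 1, J (ζ t) = z t - J (z t))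
    (hu : ∀ᵐ t ∂unitMeasure, ((Real.sqrt (α t) : ℝ) : ℂ) • u t = V t (z t))
    (hv : ∀ᵐ t ∂unitMeasure, ((Real.sqrt (α t) : ℝ) : ℂ) • v t = V t (ζ t - z' t)) :
    ⟪p.2, u⟫_ℂ = ⟪p.1, v⟫_ℂ := by
  obtain ⟨φ, hφ, f, hf, hp⟩ := generators_ae S.weight S.coeff hp
  set ψ := weightedTest α φ with hψ
  set ψ' := weightedTestDeriv α φ with hψ'
  let F' : ℝ → ℂ := fun t => ⟪ψ t • Y t f, z' t⟫_ℂ +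
    ⟪ψ' t • Y t f + ψ t • Y t (Complex.I • app (Ai t) f), z t⟫_ℂ
  have hF : ∀ t ∈ Ioo (0 : ℝ) 1, HasDerivAt (fun r => ⟪ψ r • Y r f, z r⟫_ℂ) (F' t) t :=
    fun t ht => (S.hasDerivAt_test hφ hf ht).inner ℂ (hz t ht)
  refine S.weight.inner_eq_of_integral (F := F') ?_ fun hi => ?_
  · filter_upwards [hp, hu, hv, ae_unit_mem] with t h1 h2 h3 ht
    have htc := Ioo_subset_Icc_self ht
    have h4 : ⟪Y t (app C f), z t⟫_ℂ = ⟪Y t f, ζ t⟫_ℂ := by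
      rw [S.inner_Y htc hf (ζ t), hζ t ht, inner_sub_right, inner_sub_right, S.inner_Y htc hf (z t)]
      ring
    rw [h1.1, h1.2, h2, h3, S.evolution.inner_V htc, S.evolution.inner_V htc]
    simp only [F', map_add, map_smul, inner_add_left, inner_sub_right, inner_smul_left, h4]
    ring
  · refine integral_eq_zero_of_compact_support hφ.compact hφ.2.2 (fun t ht => ?_) hF hi
    simp only [hψ]
    rw [weightedTest_eq_zero ht, zero_smul, inner_zero_left]

/-- A generator of `L₀'` corresponds to `z = √α φ Y f`, to which the Green formula for `L` applies.
-/
theorem inner_generators_generatorsPlus {p : WeightedL2 H α × WeightedL2 H α}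
    (hp : p ∈ generators α Ar Ai D) {q : WeightedL2 H α × WeightedL2 H α}
    (hq : q ∈ generatorsPlus α Ar Ai D) : ⟪q.2, p.1⟫_ℂ = ⟪q.1, p.2⟫_ℂ := by
  obtain ⟨φ, hφ, f, hf, hp⟩ := generators_ae S.weight S.coeff hp
  refine S.inner_generatorsPlus hq (z := fun t => weightedTest α φ t • Y t f)
    (η := fun t => weightedTestDeriv α φ t • Y t f +
      weightedTest α φ t • Y t (app C f + Complex.I • app (Ai t) f)) ?_ ?_ ?_ ?_
  · exact fun t ht => (S.hasDerivAt_test hφ hf ht).continuousAt.continuousWithinAt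
  · intro t ht
    refine (hasDerivAt_clm J (S.hasDerivAt_test hφ hf ht)).congr_deriv ?_
    have h1 := S.Y_eq (Ioo_subset_Icc_self ht) hf
    have h2 : J (Y t (app C f)) = Y t f - J (Y t f) := by
      rw [map_add, map_add] at h1
      rw [eq_sub_iff_add_eq]
      exact h1.symm
    simp only [map_add, map_smul, smul_add, h2]
    module
  · filter_upwards [hp, ae_unit_mem] with t h1 ht
    rw [h1.1, map_smul, S.evolution.V_Y t (Ioo_subset_Icc_self ht)]
  · filter_upwards [hp, ae_unit_mem] with t h1 ht
    rw [h1.2, map_add, map_smul, map_smul, S.evolution.V_Y t (Ioo_subset_Icc_self ht),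
      S.evolution.V_Y t (Ioo_subset_Icc_self ht)]

end IsSystem
end NormalExt

/-! ### Density of the generators and weak descriptions of the maximal operators. -/

namespace NormalExt
open Filter Topology

theorem isTestFun_ofReal {g : ℝ → ℝ} (h1 : ContDiff ℝ ∞ g) (h2 : HasCompactSupport g)
    (h3 : tsupport g ⊆ Ioo 0 1) : IsTestFun (fun t => (g t : ℂ)) :=
  ⟨Complex.ofRealCLM.contDiff.comp h1, h2.comp_left (g := Complex.ofReal) Complex.ofReal_zero,
    (closure_mono (Function.support_comp_subset Complex.ofReal_zero g)).trans h3⟩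

variable {H : Type*} [NormedAddCommGroup H] [InnerProductSpace ℂ H]
  {α : ℝ → ℝ} {Ar Ai : ℝ → H →ₗ.[ℂ] H} {C : H →ₗ.[ℂ] H} {D : Submodule ℂ H}
  {J : H →L[ℂ] H} {V Y : ℝ → H →L[ℂ] H}

theorem IsPosWeight.continuousOn_sqrt (hα : IsPosWeight α) :
    ContinuousOn (fun t => ((Real.sqrt (α t) : ℝ) : ℂ)) (Ioo 0 1) :=
  Complex.continuous_ofReal.comp_continuousOn (Real.continuous_sqrt.comp_continuousOn
    (hα.continuousOn.mono Ioo_subset_Icc_self))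

theorem IsPosWeight.memLp_of_test (hα : IsPosWeight α) {φ : ℝ → ℂ} (hφ : IsTestFun φ) {k : ℝ → H}
    (hk : ContinuousOn k (Ioo 0 1)) (h0 : ∀ t ∉ tsupport φ, k t = 0) :
    MemLp k 2 (weightMeasure α) := by
  rw [hα.memLp_iff]
  refine memLp_of_compact_support hφ.compact hφ.2.2 (hα.continuousOn_sqrt.smul hk) fun t ht => ?_
  rw [h0 t ht, smul_zero]

/-- Varying the test function gives `⟪f, √α u⟫ = 0` almost everywhere for each `f ∈ D`; density of
`D` and separability of `H` give `u = 0`. -/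
theorem orthogonal_span_eq_bot [TopologicalSpace.SeparableSpace H] (hα : IsPosWeight α)
    (hD : Dense (D : Set H)) {G : Set (WeightedL2 H α × WeightedL2 H α)}
    (hG : ∀ φ : ℝ → ℂ, IsTestFun φ → ∀ f ∈ D, ∃ p ∈ G, ∀ᵐ t ∂unitMeasure, p.1 t = φ t • f) :
    (Submodule.span ℂ (Prod.fst '' G))ᗮ = ⊥ := by
  refine (Submodule.eq_bot_iff _).2 fun u hu => ?_
  have hu2 := hα.memLp_iff.1 (Lp.memLp u)
  have hD0 : ∀ f ∈ D, ∀ᵐ t ∂unitMeasure, ⟪f, ((Real.sqrt (α t) : ℝ) : ℂ) • u t⟫_ℂ = 0 := by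
    intro f hf
    set m : ℝ → ℂ := fun t =>
      ((Real.sqrt (α t) : ℝ) : ℂ) * ⟪f, ((Real.sqrt (α t) : ℝ) : ℂ) • u t⟫_ℂ with hm
    have hmi : IntegrableOn m (Ioo 0 1) volume := by
      have h1 : Integrable (fun t => ⟪f, ((Real.sqrt (α t) : ℝ) : ℂ) • u t⟫_ℂ) unitMeasure :=
        (hu2.const_inner f).integrable one_le_two
      obtain ⟨M, hM⟩ := isCompact_Icc.exists_bound_of_continuousOn
        (Complex.continuous_ofReal.comp_continuousOn
          (Real.continuous_sqrt.comp_continuousOn hα.continuousOn))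
      refine h1.bdd_mul hα.aestronglyMeasurable_sqrt (c := M) ?_
      filter_upwards [ae_unit_mem] with t ht using hM t (Ioo_subset_Icc_self ht)
    have h2 := isOpen_Ioo.ae_eq_zero_of_integral_contDiff_smul_eq_zero
      hmi.locallyIntegrableOn (fun g hg1 hg2 hg3 => by
        obtain ⟨p, hp, hp1⟩ := hG _ (isTestFun_ofReal hg1 hg2 hg3) f hf
        have h3 := (Submodule.mem_orthogonal _ _).1 hu p.1
          (Submodule.subset_span (mem_image_of_mem _ hp))
        rw [hα.inner_eq] at h3
        rw [← setIntegral_eq_integral_of_forall_compl_eq_zero (s := Ioo (0 : ℝ) 1), ← h3]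
        · refine integral_congr_ae ?_
          filter_upwards [hp1] with t ht
          rw [ht, inner_smul_left, inner_smul_left, Complex.conj_ofReal, Complex.conj_ofReal,
            Complex.real_smul]
          simp only [hm]
          ring
        · intro t ht
          rw [image_eq_zero_of_notMem_tsupport fun h => ht (hg3 h), zero_smul])
    filter_upwards [(ae_restrict_iff' measurableSet_Ioo).2 h2, ae_unit_mem] with t h3 ht
    exact (mul_eq_zero.1 h3).resolve_left (hα.sqrt_ne_zero ht)
  have hall : ∀ c : H, (fun t => ⟪c, ((Real.sqrt (α t) : ℝ) : ℂ) • u t⟫_ℂ) =ᵐ[unitMeasure] 0 := by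
    intro c
    -- The exceptional null set depends on `f`, so `c` is approached along a sequence in `D`.
    obtain ⟨f, hf, hlim⟩ := mem_closure_iff_seq_limit.1 (hD c)
    have h1 : ∀ᵐ t ∂unitMeasure, ∀ n, ⟪f n, ((Real.sqrt (α t) : ℝ) : ℂ) • u t⟫_ℂ = 0 :=
      ae_all_iff.2 fun n => hD0 (f n) (hf n)
    filter_upwards [h1] with t ht
    have h2 : Tendsto (fun n => ⟪f n, ((Real.sqrt (α t) : ℝ) : ℂ) • u t⟫_ℂ) atTop
        (𝓝 ⟪c, ((Real.sqrt (α t) : ℝ) : ℂ) • u t⟫_ℂ) := hlim.inner tendsto_const_nhds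
    simp only [ht] at h2
    exact tendsto_nhds_unique h2 tendsto_const_nhds
  have : SecondCountableTopology H := UniformSpace.secondCountable_of_separable H
  have h0 := ae_eq_zero_of_forall_inner hall
  refine Lp.ext (hα.ae_iff.2 ?_)
  filter_upwards [h0, hα.ae_iff.1 (Lp.coeFn_zero H 2 (weightMeasure α)), ae_unit_mem]
    with t h1 h2 ht
  rw [h2]
  exact (smul_eq_zero.1 h1).resolve_left (hα.sqrt_ne_zero ht)

variable [CompleteSpace H]

namespace IsSystem

theorem exists_generator (S : IsSystem α Ar Ai C D J V Y) {φ : ℝ → ℂ} (hφ : IsTestFun φ) {f : H}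
    (hf : f ∈ D) : ∃ p ∈ generators α Ar Ai D, ∀ᵐ t ∂unitMeasure, p.1 t = φ t • f := by
  have h1 : MemLp (fun t => φ t • f) 2 (weightMeasure α) :=
    S.weight.memLp_of_test hφ (hφ.1.continuous.smul continuous_const).continuousOn fun t ht => by
      rw [IsTestFun.eq_zero ht, zero_smul]
  have h2 : MemLp (fun t => deriv φ t • f + φ t • app (NormalExt.coeff Ar Ai t) f) 2 (weightMeasure α) := by
    refine S.weight.memLp_of_test hφ ?_ fun t ht => by
      rw [IsTestFun.eq_zero ht, IsTestFun.deriv_eq_zero ht, zero_smul, zero_smul, add_zero]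
    refine (hφ.continuous_deriv.smul continuous_const).continuousOn.add
      (hφ.1.continuous.continuousOn.smul ?_)
    refine ((S.coeff.contDiff_re f hf).continuousOn.add
      (((S.coeff.contDiff_im f hf).continuousOn.mono Ioo_subset_Icc_self).const_smul
        Complex.I)).congr fun t ht => S.coeff.app_coeff ht hf
  exact ⟨(h1.toLp _, h2.toLp _), ⟨φ, hφ, f, hf, h1.coeFn_toLp, h2.coeFn_toLp⟩,
    S.weight.ae_iff.1 h1.coeFn_toLp⟩

theorem exists_generatorPlus (S : IsSystem α Ar Ai C D J V Y) {φ : ℝ → ℂ} (hφ : IsTestFun φ) {f : H}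
    (hf : f ∈ D) : ∃ p ∈ generatorsPlus α Ar Ai D, (∀ᵐ t ∂(weightMeasure α), p.1 t = φ t • f) ∧
      ∀ᵐ t ∂(weightMeasure α), p.2 t = -((deriv (fun s => (α s : ℂ) * φ s) t / (α t : ℂ)) • f)
        + φ t • app (NormalExt.coeff Ar Ai t).adjoint f := by
  have h1 : MemLp (fun t => φ t • f) 2 (weightMeasure α) :=
    S.weight.memLp_of_test hφ (hφ.1.continuous.smul continuous_const).continuousOn fun t ht => by
      rw [IsTestFun.eq_zero ht, zero_smul]
  have h2 : MemLp (fun t => -((deriv (fun s => (α s : ℂ) * φ s) t / (α t : ℂ)) • f)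
          + φ t • app (NormalExt.coeff Ar Ai t).adjoint f) 2 (weightMeasure α) := by
    refine S.weight.memLp_of_test hφ ?_ fun t ht => ?_
    · have hαc : ContinuousOn (fun t => (α t : ℂ)) (Ioo 0 1) :=
        Complex.continuous_ofReal.comp_continuousOn
          (S.weight.continuousOn.mono Ioo_subset_Icc_self)
      have hd : ContinuousOn (fun t => deriv (fun s => (α s : ℂ) * φ s) t) (Ioo 0 1) := by
        have h3 : ContinuousOn (fun t => ((deriv α t : ℝ) : ℂ) * φ t + (α t : ℂ) * deriv φ t)
            (Ioo 0 1) :=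
          ((Complex.continuous_ofReal.comp_continuousOn S.weight.continuousOn_deriv).mul
            hφ.1.continuous.continuousOn).add (hαc.mul hφ.continuous_deriv.continuousOn)
        exact h3.congr fun t ht =>
          ((S.weight.hasDerivAt ht).ofReal_comp.mul (hφ.hasDerivAt t)).deriv
      have h4 : ContinuousOn (fun t => deriv (fun s => (α s : ℂ) * φ s) t / (α t : ℂ)) (Ioo 0 1) :=
        hd.div hαc fun t ht => by exact_mod_cast (S.weight.pos' t ht).ne'
      refine (h4.smul continuousOn_const).neg.add (hφ.1.continuous.continuousOn.smul ?_)
      refine ((S.coeff.contDiff_re f hf).continuousOn.sub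
        (((S.coeff.contDiff_im f hf).continuousOn.mono Ioo_subset_Icc_self).const_smul
          Complex.I)).congr fun t ht => S.coeff.app_coeff_adjoint ht hf
    · have h3 : (fun s => (α s : ℂ) * φ s) =ᶠ[𝓝 t] fun _ => 0 := by
        filter_upwards [(isClosed_tsupport φ).isOpen_compl.mem_nhds ht] with s hs
        rw [IsTestFun.eq_zero hs, mul_zero]
      rw [IsTestFun.eq_zero ht, h3.deriv_eq]
      simp
  exact ⟨(h1.toLp _, h2.toLp _), ⟨φ, hφ, f, hf, h1.coeFn_toLp, h2.coeFn_toLp⟩,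
    h1.coeFn_toLp, h2.coeFn_toLp⟩

theorem isFormalPair [TopologicalSpace.SeparableSpace H] (S : IsSystem α Ar Ai C D J V Y) :
    IsFormalPair (generators α Ar Ai D) (generatorsPlus α Ar Ai D) where
  inner_eq _ hp _ hq := S.inner_generators_generatorsPlus hp hq
  dense := orthogonal_span_eq_bot S.weight S.coeff.dense fun _ hφ _ hf => S.exists_generator hφ hf
  dense' := orthogonal_span_eq_bot S.weight S.coeff.dense
    fun _ hφ _ hf =>
      let ⟨p, hp, h, _⟩ := S.exists_generatorPlus hφ hf
      ⟨p, hp, S.weight.ae_iff.1 h⟩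

variable [TopologicalSpace.SeparableSpace H]

theorem mem_graph_maximalOp_iff (S : IsSystem α Ar Ai C D J V Y) {u v : WeightedL2 H α} :
    (u, v) ∈ (maximalOp α Ar Ai D).graph ↔
      ∀ q ∈ generatorsPlus α Ar Ai D, ⟪q.2, u⟫_ℂ = ⟪q.1, v⟫_ℂ :=
  S.isFormalPair.symm.mem_graph_iff

theorem mem_graph_maximalOpPlus_iff (S : IsSystem α Ar Ai C D J V Y) {u v : WeightedL2 H α} :
    (u, v) ∈ (maximalOpPlus α Ar Ai D).graph ↔
      ∀ p ∈ generators α Ar Ai D, ⟪p.2, u⟫_ℂ = ⟪p.1, v⟫_ℂ :=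
  S.isFormalPair.mem_graph_iff

theorem exists_mem_graph_maximalOpPlus (S : IsSystem α Ar Ai C D J V Y)
    {u v : ℕ → WeightedL2 H α} {u₀ : WeightedL2 H α} {K : ℝ}
    (hg : ∀ n, (u n, v n) ∈ (maximalOpPlus α Ar Ai D).graph)
    (hu : Tendsto u atTop (𝓝 u₀)) (hv : ∀ n, ‖v n‖ ≤ K) :
    ∃ v₀, (u₀, v₀) ∈ (maximalOpPlus α Ar Ai D).graph ∧ ‖v₀‖ ≤ K :=
  S.isFormalPair.exists_mem_graph_of_tendsto hg hu hv

end IsSystem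

end NormalExt

/-! ### Continuous functions in `L²(H,(0,1))` and the vanishing energy term. -/

namespace NormalExt
open Filter Topology

section

variable {H : Type*} [NormedAddCommGroup H]

theorem memLp_of_continuousOn {z : ℝ → H} (hz : ContinuousOn z (Icc 0 1)) :
    MemLp z 2 unitMeasure := by
  obtain ⟨M, hM⟩ := isCompact_Icc.exists_bound_of_continuousOn hz
  refine MemLp.of_bound ((hz.mono Ioo_subset_Icc_self).aestronglyMeasurable measurableSet_Ioo) M ?_
  filter_upwards [ae_unit_mem] with t ht using hM t (Ioo_subset_Icc_self ht)

/-- The element of `L²(H,(0,1))` given by a function that is continuous on `[0,1]`. -/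
def toL2 {z : ℝ → H} (hz : ContinuousOn z (Icc 0 1)) : Lp H 2 unitMeasure :=
  (memLp_of_continuousOn hz).toLp z

theorem coeFn_toL2 {z : ℝ → H} (hz : ContinuousOn z (Icc 0 1)) :
    ∀ᵐ t ∂unitMeasure, toL2 hz t = z t := (memLp_of_continuousOn hz).coeFn_toLp

theorem toL2_eq {z : ℝ → H} (hz : ContinuousOn z (Icc 0 1)) {y : Lp H 2 unitMeasure}
    (h : ∀ᵐ t ∂unitMeasure, y t = z t) : toL2 hz = y := by
  refine Lp.ext ?_
  filter_upwards [coeFn_toL2 hz, h] with t h1 h2 using h1.trans h2.symm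

theorem norm_toL2_le {z : ℝ → H} (hz : ContinuousOn z (Icc 0 1)) {M : ℝ} (hM : 0 ≤ M)
    (h : ∀ t ∈ Ioo (0 : ℝ) 1, ‖z t‖ ≤ M) : ‖toL2 hz‖ ≤ M := by
  rw [toL2, Lp.norm_toLp]
  refine ENNReal.toReal_le_of_le_ofReal hM ?_
  have h1 := eLpNorm_le_of_ae_bound (p := 2) (ae_unit_of_forall h)
  refine h1.trans ?_
  simp

end

variable {H : Type*} [NormedAddCommGroup H] [InnerProductSpace ℂ H]

theorem inner_toL2 {z y : ℝ → H} (hz : ContinuousOn z (Icc 0 1)) (hy : ContinuousOn y (Icc 0 1)) :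
    ⟪toL2 hz, toL2 hy⟫_ℂ = ∫ t in (0 : ℝ)..1, ⟪z t, y t⟫_ℂ := by
  rw [intervalIntegral.integral_of_le zero_le_one, integral_Ioc_eq_integral_Ioo, L2.inner_def]
  refine integral_congr_ae ?_
  filter_upwards [coeFn_toL2 hz, coeFn_toL2 hy] with t h1 h2
  rw [h1, h2]

/-- With `y = J q` one has `q - J q = C y`, so the integrand is `⟪C y, y'⟫`. Twice its real part is
the derivative of `⟪C y, y⟫`, whose values at `0` and `1` agree because `W` is isometric and
commutes with `J`. -/
theorem integral_re_inner_eq_zero {J : H →L[ℂ] H} (hJs : ∀ x y, ⟪J x, y⟫_ℂ = ⟪x, J y⟫_ℂ) {W : H →L[ℂ] H}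
    (hWi : ∀ x y, ⟪W x, W y⟫_ℂ = ⟪x, y⟫_ℂ) (hWJ : Commute J W) {q q' : ℝ → H}
    (hq : ContinuousOn q (Icc 0 1)) (hq' : ContinuousOn (fun t => J (q' t)) (Icc 0 1))
    (hd : ∀ t ∈ Ioo (0 : ℝ) 1, HasDerivAt q (q' t) t) (hb : q 1 = W (q 0)) :
    (∫ t in (0 : ℝ)..1, ⟪q t - J (q t), J (q' t)⟫_ℂ).re = 0 := by
  have hJq : ContinuousOn (fun t => J (q t)) (Icc 0 1) := J.continuous.comp_continuousOn hq
  set k : ℝ → ℂ := fun t => ⟪q t - J (q t), J (q' t)⟫_ℂ with hk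
  have hkc : ContinuousOn k (Icc 0 1) := (hq.sub hJq).inner hq'
  have hki : IntervalIntegrable k volume 0 1 := hkc.intervalIntegrable_of_Icc zero_le_one
  have hder : ∀ t ∈ Ioo (0 : ℝ) 1, HasDerivAt (fun r => (⟪q r - J (q r), J (q r)⟫_ℂ).re)
      (2 * (k t).re) t := by
    intro t ht
    have h1 := ((hd t ht).sub (hasDerivAt_clm J (hd t ht))).inner ℂ (hasDerivAt_clm J (hd t ht))
    have h2 := (Complex.reCLM.hasFDerivAt.comp_hasDerivAt t h1)
    refine h2.congr_deriv ?_
    have h3 : ⟪q' t - J (q' t), J (q t)⟫_ℂ = (starRingEnd ℂ) (k t) := by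
      simp only [hk]
      rw [inner_conj_symm, inner_sub_left, inner_sub_right, ← hJs (q' t)]
    simp only [Complex.reCLM_apply, Complex.add_re, Pi.sub_apply]
    rw [h3, Complex.conj_re]
    ring
  have hkre : IntervalIntegrable (fun t => 2 * (k t).re) volume 0 1 :=
    (continuousOn_const.mul (Complex.continuous_re.comp_continuousOn hkc)).intervalIntegrable_of_Icc
      zero_le_one
  have h1 := intervalIntegral.integral_eq_sub_of_hasDerivAt_of_le zero_le_one
    (Complex.continuous_re.comp_continuousOn ((hq.sub hJq).inner hJq)) hder hkre
  have hWJ' : ∀ x, J (W x) = W (J x) := fun x => DFunLike.congr_fun hWJ.eq x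
  simp only [Pi.sub_apply, hb, hWJ', ← map_sub, hWi, Function.comp, sub_self] at h1
  rw [intervalIntegral.integral_const_mul] at h1
  have h2 := Complex.reCLM.intervalIntegral_comp_comm hki
  simp only [Complex.reCLM_apply] at h2
  rw [← h2]
  linarith

variable [CompleteSpace H] {J : H →L[ℂ] H}

theorem IsPosResolvent.tendsto_toL2_semigroup (hJ : IsPosResolvent J) {z : ℝ → H}
    (hz : ContinuousOn z (Icc 0 1)) {ε : ℕ → ℝ} (hε : ∀ n, 0 ≤ ε n) (hlim : Tendsto ε atTop (𝓝 0))
    (hzε : ∀ n, ContinuousOn (fun t => semigroup J (ε n) (z t)) (Icc 0 1)) :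
    Tendsto (fun n => toL2 (hzε n)) atTop (𝓝 (toL2 hz)) := by
  obtain ⟨M, hM⟩ := isCompact_Icc.exists_bound_of_continuousOn hz
  rw [tendsto_iff_norm_sub_tendsto_zero]
  have hsub : ∀ n, ContinuousOn (fun t => semigroup J (ε n) (z t) - z t) (Icc 0 1) :=
    fun n => (hzε n).sub hz
  have heq : ∀ n, toL2 (hzε n) - toL2 hz = toL2 (hsub n) := by
    intro n
    refine (toL2_eq _ ?_).symm
    filter_upwards [Lp.coeFn_sub (toL2 (hzε n)) (toL2 hz), coeFn_toL2 hz, coeFn_toL2 (hzε n)]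
      with t h1 h2 h3
    rw [h1, Pi.sub_apply, h2, h3]
  have hsq : Tendsto (fun n => ⟪toL2 (hsub n), toL2 (hsub n)⟫_ℂ) atTop (𝓝 0) := by
    simp only [inner_toL2]
    have h0 : (∫ t in (0 : ℝ)..1, (0 : ℂ)) = 0 := by simp
    rw [← h0]
    refine intervalIntegral.tendsto_integral_filter_of_dominated_convergence
      (fun _ => (2 * M) * (2 * M)) (Eventually.of_forall fun n => ?_)
      (Eventually.of_forall fun n => Eventually.of_forall fun t ht => ?_)
      intervalIntegrable_const (Eventually.of_forall fun t ht => ?_)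
    · rw [uIoc_of_le zero_le_one]
      exact (((hsub n).inner (hsub n)).mono Ioc_subset_Icc_self).aestronglyMeasurable
        measurableSet_Ioc
    · rw [uIoc_of_le zero_le_one] at ht
      have h1 : ‖semigroup J (ε n) (z t) - z t‖ ≤ 2 * M := by
        have h2 := hM t (Ioc_subset_Icc_self ht)
        have h3 := hJ.norm_semigroup_apply_le (hε n) (z t)
        linarith [norm_sub_le (semigroup J (ε n) (z t)) (z t)]
      refine (norm_inner_le_norm _ _).trans ?_
      have h4 := norm_nonneg (semigroup J (ε n) (z t) - z t)
      exact mul_le_mul h1 h1 h4 (h4.trans h1)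
    · have h1 : Tendsto (fun n => semigroup J (ε n) (z t)) atTop (𝓝 (z t)) :=
        (hJ.tendsto_semigroup_zero (z t)).comp
          (tendsto_nhdsWithin_iff.2 ⟨hlim, Eventually.of_forall hε⟩)
      have h2 : Tendsto (fun n => semigroup J (ε n) (z t) - z t) atTop (𝓝 0) := by
        simpa using h1.sub_const (z t)
      simpa using h2.inner (𝕜 := ℂ) h2
  have h2 : Tendsto (fun n => ‖toL2 (hsub n)‖ ^ 2) atTop (𝓝 0) := by
    have h3 := hsq.norm
    simp only [norm_zero] at h3
    refine h3.congr fun n => ?_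
    rw [inner_self_eq_norm_sq_to_K]
    simp
  have h3 := h2.sqrt
  simp only [Real.sqrt_zero] at h3
  refine h3.congr fun n => ?_
  rw [Real.sqrt_sq (norm_nonneg _), heq]

/-- The theorem of Pythagoras for `a - (b - a)` and `a + (b - a)`. It is used with `a = C y` and `b
= y' + C y`, so that `2 a - b = -y' + C y`. -/
theorem norm_two_smul_sub_eq {E : Type*} [NormedAddCommGroup E] [InnerProductSpace ℂ E] {a b : E}
    (h : (⟪a, b - a⟫_ℂ).re = 0) : ‖(2 : ℂ) • a - b‖ = ‖b‖ := by
  have h1 : (2 : ℂ) • a - b = a - (b - a) := by module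
  have h2 : b = a + (b - a) := by abel
  have h3 := norm_sub_sq (𝕜 := ℂ) a (b - a)
  have h4 := norm_add_sq (𝕜 := ℂ) a (b - a)
  simp only [RCLike.re_to_complex, h] at h3 h4
  rw [← h2] at h4
  rw [h1]
  exact (pow_left_inj₀ (norm_nonneg _) (norm_nonneg _) two_ne_zero).1 (by linarith)

/-- `z` is a mild solution of `z' + C z = η`, where `J = (1 + C)⁻¹`. -/
structure IsMildSolution (J : H →L[ℂ] H) (z η : ℝ → H) : Prop where
  continuousOn : ContinuousOn z (Icc 0 1)
  continuousOn_rhs : ContinuousOn η (Icc 0 1)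
  hasDerivAt : ∀ t ∈ Ioo (0 : ℝ) 1, HasDerivAt (fun r => J (z r)) (J (η t) + J (z t) - z t) t

end NormalExt

/-! ### Mild solutions with `z(1) = W z(0)` belong to the domain of `L_W`. -/

namespace NormalExt
open Filter Topology

variable {H : Type*} [NormedAddCommGroup H] [InnerProductSpace ℂ H] [CompleteSpace H]
  {α : ℝ → ℝ} {Ar Ai : ℝ → H →ₗ.[ℂ] H} {C : H →ₗ.[ℂ] H} {D : Submodule ℂ H}
  {J : H →L[ℂ] H} {V Y : ℝ → H →L[ℂ] H} {U : ℝ → ℝ → H →L[ℂ] H} {W : H →L[ℂ] H}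

theorem mem_graph_extensionOp_iff {u v : WeightedL2 H α} :
    (u, v) ∈ (extensionOp α Ar Ai D U W).graph ↔ u ∈ (maximalOpPlus α Ar Ai D).domain ∧
      u ∈ boundaryCondition α (U 1 0 * W) ∧ (u, v) ∈ (maximalOp α Ar Ai D).graph := by
  have hle : extensionOp α Ar Ai D U W ≤ maximalOp α Ar Ai D := LinearPMap.domRestrict_le
  constructor
  · intro h
    have h1 : u ∈ (extensionOp α Ar Ai D U W).domain := mem_domain_of_graph h
    have h2 : u ∈ ((maximalOpPlus α Ar Ai D).domain ⊓ boundaryCondition α (U 1 0 * W)) ⊓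
      (maximalOp α Ar Ai D).domain := h1
    exact ⟨h2.1.1, h2.1.2, LinearPMap.le_graph_of_le hle h⟩
  · rintro ⟨h1, h2, h3⟩
    have hd : u ∈ (extensionOp α Ar Ai D U W).domain := ⟨⟨h1, h2⟩, mem_domain_of_graph h3⟩
    have h4 := mem_graph_app hd
    have h5 := LinearPMap.mem_graph_snd_inj _ (LinearPMap.le_graph_of_le hle h4) h3 rfl
    rwa [h5] at h4

/-- The weighted equivalence `y ↦ V y / √α`. -/
def IsWeightedEquiv (V : ℝ → H →L[ℂ] H) (Φ : Lp H 2 unitMeasure ≃ₗᵢ[ℂ] WeightedL2 H α) : Prop :=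
  ∀ y : Lp H 2 unitMeasure, ∀ᵐ t ∂unitMeasure, ((Real.sqrt (α t) : ℝ) : ℂ) • Φ y t = V t (y t)

omit [CompleteSpace H] in
theorem IsWeightedEquiv.toL2 {Φ : Lp H 2 unitMeasure ≃ₗᵢ[ℂ] WeightedL2 H α}
    (hΦ : IsWeightedEquiv V Φ) {z : ℝ → H} (hz : ContinuousOn z (Icc 0 1)) :
    ∀ᵐ t ∂unitMeasure, ((Real.sqrt (α t) : ℝ) : ℂ) • Φ (toL2 hz) t = V t (z t) := by
  filter_upwards [hΦ (NormalExt.toL2 hz), coeFn_toL2 hz] with t h1 h2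
  rw [h1, h2]

namespace IsSystem

variable [TopologicalSpace.SeparableSpace H]
  {Φ : Lp H 2 unitMeasure ≃ₗᵢ[ℂ] WeightedL2 H α}

theorem mem_graph_maximalOp (S : IsSystem α Ar Ai C D J V Y) (hΦ : IsWeightedEquiv V Φ)
    {z η : ℝ → H} (h : IsMildSolution J z η) :
    (Φ (toL2 h.continuousOn), Φ (toL2 h.continuousOn_rhs)) ∈ (maximalOp α Ar Ai D).graph :=
  S.mem_graph_maximalOp_iff.2 fun _ hq =>
    S.inner_generatorsPlus hq (h.continuousOn.mono Ioo_subset_Icc_self) h.hasDerivAt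
      (hΦ.toL2 _) (hΦ.toL2 _)

theorem mem_graph_maximalOpPlus (S : IsSystem α Ar Ai C D J V Y) (hΦ : IsWeightedEquiv V Φ)
    {z z' ζ ξ : ℝ → H} (hz : ContinuousOn z (Icc 0 1)) (hξ : ContinuousOn ξ (Icc 0 1))
    (hd : ∀ t ∈ Ioo (0 : ℝ) 1, HasDerivAt z (z' t) t)
    (hζ : ∀ t ∈ Ioo (0 : ℝ) 1, J (ζ t) = z t - J (z t))
    (hξ' : ∀ t ∈ Ioo (0 : ℝ) 1, ξ t = ζ t - z' t) :
    (Φ (toL2 hz), Φ (toL2 hξ)) ∈ (maximalOpPlus α Ar Ai D).graph := by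
  refine S.mem_graph_maximalOpPlus_iff.2 fun _ hp =>
    S.inner_generators hp hd hζ (hΦ.toL2 hz) ?_
  filter_upwards [hΦ.toL2 hξ, ae_unit_mem] with t h1 ht
  rw [h1, hξ' t ht]

/-- The energy identity for the smoothed solution: `l⁺` of it has the norm of the smoothed
right-hand side. -/
theorem exists_mem_graph_smoothed (S : IsSystem α Ar Ai C D J V Y) (hΦ : IsWeightedEquiv V Φ)
    (hWi : ∀ x y, ⟪W x, W y⟫_ℂ = ⟪x, y⟫_ℂ) (hWJ : Commute J W)
    {z η : ℝ → H} (h : IsMildSolution J z η) (hb : z 1 = W (z 0)) {ε : ℝ} (hε : 0 < ε)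
    (hzε : ContinuousOn (fun t => semigroup J (ε + ε) (z t)) (Icc 0 1)) :
    ∃ v, (Φ (toL2 hzε), v) ∈ (maximalOpPlus α Ar Ai D).graph ∧
      ‖v‖ ≤ ‖Φ (toL2 h.continuousOn_rhs)‖ := by
  have hJ := S.isPosResolvent
  set N := smoothing J ε with hN
  have hNJ : ∀ x, N (J x) = J (N x) := fun x =>
    DFunLike.congr_fun (commute_smoothing (Commute.refl J) ε).eq x
  have hNW : ∀ x, N (W x) = W (N x) := fun x => DFunLike.congr_fun (commute_smoothing hWJ ε).eq x
  have hJW : ∀ x, J (W x) = W (J x) := fun x => DFunLike.congr_fun hWJ.eq x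
  have hE : ∀ x, semigroup J (ε + ε) x = J (N (N (J x))) := by
    intro x
    rw [hJ.semigroup_add_apply hε.le hε.le, hJ.semigroup_eq hε, hJ.semigroup_eq hε, ← hN, ← hNJ x]
  -- The function `q = (1 + C) e^{-2εC} z` must be differentiable, and only `J z` is. Splitting the
  -- smoothing into two factors makes `q` the image of `J z` under the bounded operator `N * N`.
  set T : H →L[ℂ] H := N * N with hT
  set q : ℝ → H := fun t => T (J (z t)) with hq
  set q' : ℝ → H := fun t => T (J (η t) + J (z t) - z t) with hq'
  have hqc : ContinuousOn q (Icc 0 1) := (T * J).continuous.comp_continuousOn h.continuousOn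
  have hJqc : ContinuousOn (fun t => J (q t)) (Icc 0 1) := J.continuous.comp_continuousOn hqc
  have hqd : ∀ t ∈ Ioo (0 : ℝ) 1, HasDerivAt q (q' t) t :=
    fun t ht => hasDerivAt_clm T (h.hasDerivAt t ht)
  have hq'c : ContinuousOn (fun t => J (q' t)) (Icc 0 1) :=
    (J * T).continuous.comp_continuousOn (((J.continuous.comp_continuousOn h.continuousOn_rhs).add
      (J.continuous.comp_continuousOn h.continuousOn)).sub h.continuousOn)
  have hA : ContinuousOn (fun t => q t - J (q t)) (Icc 0 1) := hqc.sub hJqc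
  have hB : ContinuousOn (fun t => semigroup J (ε + ε) (η t)) (Icc 0 1) :=
    (semigroup J (ε + ε)).continuous.comp_continuousOn h.continuousOn_rhs
  have hJq' : ∀ t, J (q' t) = semigroup J (ε + ε) (η t) - (q t - J (q t)) := by
    intro t
    rw [hE]
    -- This is the smoothed equation `y' + C y = e^{-2εC} η` for `y = J q`.
    simp only [hq, hq', hT, map_add, map_sub]
    change J (N (N (J (η t)))) + J (N (N (J (z t)))) - J (N (N (z t))) = J (N (N (J (η t)))) -
      (N (N (J (z t))) - J (N (N (J (z t)))))
    have h1 : N (N (J (z t))) = J (N (N (z t))) := by rw [hNJ, hNJ]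
    rw [h1]
    abel
  have hsub : ∀ᵐ t ∂unitMeasure, (toL2 hB - toL2 hA) t = J (q' t) := by
    filter_upwards [Lp.coeFn_sub (toL2 hB) (toL2 hA), coeFn_toL2 hB, coeFn_toL2 hA] with t h1 h2 h3
    rw [h1, Pi.sub_apply, h2, h3, hJq']
  have horth : (⟪toL2 hA, toL2 hB - toL2 hA⟫_ℂ).re = 0 := by
    rw [← toL2_eq hq'c hsub, inner_toL2]
    refine integral_re_inner_eq_zero S.inner_J hWi hWJ hqc hq'c hqd ?_
    simp only [hq, hT]
    change N (N (J (z 1))) = W (N (N (J (z 0))))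
    rw [hb, hJW, hNW, hNW]
  have hξ : ContinuousOn (fun t => (2 : ℂ) • (q t - J (q t)) - semigroup J (ε + ε) (η t))
      (Icc 0 1) := (hA.const_smul (2 : ℂ)).sub hB
  have hξeq : toL2 hξ = (2 : ℂ) • toL2 hA - toL2 hB := by
    refine toL2_eq _ ?_
    filter_upwards [Lp.coeFn_sub ((2 : ℂ) • toL2 hA) (toL2 hB), Lp.coeFn_smul (2 : ℂ) (toL2 hA),
      coeFn_toL2 hB, coeFn_toL2 hA] with t h1 h2 h3 h4
    rw [h1, Pi.sub_apply, h2, Pi.smul_apply, h3, h4]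
  refine ⟨Φ (toL2 hξ), S.mem_graph_maximalOpPlus hΦ (z' := fun t => J (q' t))
    (ζ := fun t => q t - J (q t)) hzε hξ (fun t ht => ?_) (fun t _ => ?_) (fun t _ => ?_), ?_⟩
  · refine (hasDerivAt_clm J (hqd t ht)).congr_of_eventuallyEq (Eventually.of_forall fun r => ?_)
    exact hE _
  · rw [hE, map_sub]
    rfl
  · rw [hJq']
    module
  · rw [Φ.norm_map, Φ.norm_map, hξeq, norm_two_smul_sub_eq horth]
    refine Lp.norm_le_norm_of_ae_le ?_
    filter_upwards [coeFn_toL2 hB, coeFn_toL2 h.continuousOn_rhs] with t h1 h2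
    rw [h1, h2]
    exact hJ.norm_semigroup_apply_le (by positivity) _

/-- The smoothed solutions converge as `ε → 0`, and their images under `L⁺` are bounded by the norm
of the right-hand side; weak closedness of the adjoint `L⁺` does the rest. -/
theorem exists_mem_graph_maximalOpPlus_of_mild (S : IsSystem α Ar Ai C D J V Y)
    (hΦ : IsWeightedEquiv V Φ)
    (hWi : ∀ x y, ⟪W x, W y⟫_ℂ = ⟪x, y⟫_ℂ) (hWJ : Commute J W)
    {z η : ℝ → H} (h : IsMildSolution J z η) (hb : z 1 = W (z 0)) :
    ∃ v, (Φ (toL2 h.continuousOn), v) ∈ (maximalOpPlus α Ar Ai D).graph ∧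
      ‖v‖ ≤ ‖Φ (toL2 h.continuousOn_rhs)‖ := by
  have hpos : ∀ n : ℕ, 0 < 1 / ((n : ℝ) + 1) := fun n => by positivity
  have hzε : ∀ n : ℕ, ContinuousOn
      (fun t => semigroup J (1 / ((n : ℝ) + 1) + 1 / ((n : ℝ) + 1)) (z t)) (Icc 0 1) := fun n =>
    (semigroup J _).continuous.comp_continuousOn h.continuousOn
  choose v hv hvn using fun n => S.exists_mem_graph_smoothed hΦ hWi hWJ h hb (hpos n) (hzε n)
  refine S.exists_mem_graph_maximalOpPlus hv ?_ hvn
  have hlim : Tendsto (fun n : ℕ => 1 / ((n : ℝ) + 1) + 1 / ((n : ℝ) + 1)) atTop (𝓝 0) := by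
    simpa using tendsto_one_div_add_atTop_nhds_zero_nat.add
      (tendsto_one_div_add_atTop_nhds_zero_nat (𝕜 := ℝ))
  exact (Φ.continuous.tendsto _).comp
    (S.isPosResolvent.tendsto_toL2_semigroup h.continuousOn
      (fun n => add_nonneg (hpos n).le (hpos n).le) hlim hzε)

omit [TopologicalSpace.SeparableSpace H] in
theorem mem_boundaryCondition (S : IsSystem α Ar Ai C D J V Y) (hΦ : IsWeightedEquiv V Φ)
    {z : ℝ → H} (hz : ContinuousOn z (Icc 0 1)) (hb : z 1 = W (z 0)) :
    Φ (toL2 hz) ∈ boundaryCondition α (V 1 * W) := by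
  refine ⟨fun t => V t (z t), fun t ht => ?_, S.weight.ae_iff.2 (hΦ.toL2 hz), ?_⟩
  · refine tendsto_apply_apply (M := 1) ?_ (hz t ht) (S.evolution.continuousOn_V (z t) t ht)
    filter_upwards [self_mem_nhdsWithin] with r hr
    exact norm_le_one_of_forall (S.evolution.norm_V r hr)
  · change V 1 (z 1) = V 1 (W (V 0 (z 0)))
    rw [S.evolution.V_zero, hb]

end IsSystem
end NormalExt

/-! ### Duhamel's formula and mild solutions of the inhomogeneous equation. -/

namespace NormalExt
open Filter Topology

/-- A continuous function with continuous right derivative `k` is a primitive of `k`. Semigroup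
difference quotients are only available to the right. -/
theorem hasDerivAt_of_hasDerivWithinAt_Ioi {F : Type*} [NormedAddCommGroup F] [NormedSpace ℝ F]
    [CompleteSpace F] {f k : ℝ → F} (hf : ContinuousOn f (Ioo 0 1)) (hk : ContinuousOn k (Ioo 0 1))
    (hd : ∀ t ∈ Ioo (0 : ℝ) 1, HasDerivWithinAt f (k t) (Ioi t) t) {t : ℝ}
    (ht : t ∈ Ioo (0 : ℝ) 1) : HasDerivAt f (k t) t := by
  have h1 := (hasDerivAt_integral_Ioo hk ht ht).const_add (f t)
  refine h1.congr_of_eventuallyEq ?_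
  filter_upwards [isOpen_Ioo.mem_nhds ht] with r hr
  have hsub : uIcc t r ⊆ Ioo 0 1 := (ordConnected_Ioo (a := (0 : ℝ)) (b := 1)).uIcc_subset ht hr
  rw [intervalIntegral.integral_eq_sub_of_hasDeriv_right (hf.mono hsub)
    (fun x hx => hd x (hsub (Ioo_subset_Icc_self hx))) ((hk.mono hsub).intervalIntegrable)]
  abel

variable {H : Type*} [NormedAddCommGroup H] [InnerProductSpace ℂ H] [CompleteSpace H]
  {J : H →L[ℂ] H}

/-- The solution `∫₀ᵗ e^{-(t-s)(C-z)} γ(s) ds` of the inhomogeneous equation. -/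
def duhamel (J : H →L[ℂ] H) (z : ℂ) (γ : ℝ → H) (t : ℝ) : H :=
  ∫ s, (Iio t).indicator (fun s => propagator J z (t - s) (γ s)) s ∂unitMeasure

theorem duhamel_congr {z : ℂ} {γ γ' : ℝ → H} (h : γ =ᵐ[unitMeasure] γ') (t : ℝ) :
    duhamel J z γ t = duhamel J z γ' t := by
  refine integral_congr_ae ?_
  filter_upwards [h] with s hs
  simp only [indicator, hs]

namespace IsPosResolvent

theorem norm_indicator_le (hJ : IsPosResolvent J) (z : ℂ) (γ : ℝ → H) {t s : ℝ}
    (ht : t ≤ 1) (hs : 0 ≤ s) :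
    ‖(Iio t).indicator (fun s => propagator J z (t - s) (γ s)) s‖ ≤ Real.exp ‖z‖ * ‖γ s‖ := by
  by_cases h : s ∈ Iio t
  · rw [indicator_of_mem h]
    have h' : s < t := h
    exact (propagator J z (t - s)).le_of_opNorm_le
      (hJ.norm_propagator_le z ⟨by linarith, by linarith⟩) _
  · rw [indicator_of_notMem h, norm_zero]
    positivity

theorem aestronglyMeasurable_duhamel (hJ : IsPosResolvent J) (z : ℂ) {γ : ℝ → H}
    (hγ : AEStronglyMeasurable γ unitMeasure) {t : ℝ} (ht : t ∈ Icc (0 : ℝ) 1) :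
    AEStronglyMeasurable ((Iio t).indicator (fun s => propagator J z (t - s) (γ s)))
      unitMeasure := by
  -- Strong continuity is available only for nonnegative times, so the time is clamped at `0`; the
  -- indicator removes the part where this matters.
  have h1 : AEStronglyMeasurable (fun s => propagator J z (max (t - s) 0) (γ s)) unitMeasure := by
    refine aestronglyMeasurable_apply (K := fun s => propagator J z (max (t - s) 0))
      (M := Real.exp ‖z‖) (fun s hs => hJ.norm_propagator_le z
        ⟨le_max_right _ _, max_le (by linarith [hs.1, ht.2]) zero_le_one⟩) (fun x => ?_) hγ
    exact (hJ.continuousOn_propagator z x).comp (by fun_prop) fun s _ => mem_Ici.2 (le_max_right _ _)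
  refine (h1.indicator (measurableSet_Iio (a := t))).congr (Eventually.of_forall fun s => ?_)
  by_cases h : s ∈ Iio t
  · have h' : s < t := h
    simp only [indicator_of_mem h]
    rw [max_eq_left (by linarith)]
  · simp only [indicator_of_notMem h]

theorem integrable_duhamel (hJ : IsPosResolvent J) (z : ℂ) {γ : ℝ → H}
    (hγ : Integrable γ unitMeasure) {t : ℝ} (ht : t ∈ Icc (0 : ℝ) 1) :
    Integrable ((Iio t).indicator (fun s => propagator J z (t - s) (γ s))) unitMeasure := by
  refine (hγ.norm.const_mul (Real.exp ‖z‖)).mono'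
    (hJ.aestronglyMeasurable_duhamel z hγ.1 ht) ?_
  filter_upwards [ae_unit_mem] with s hs using hJ.norm_indicator_le z γ ht.2 hs.1.le

theorem norm_duhamel_le (hJ : IsPosResolvent J) (z : ℂ) {γ : ℝ → H}
    (hγ : Integrable γ unitMeasure) {t : ℝ} (ht : t ∈ Icc (0 : ℝ) 1) :
    ‖duhamel J z γ t‖ ≤ Real.exp ‖z‖ * ∫ s, ‖γ s‖ ∂unitMeasure := by
  rw [← integral_const_mul]
  refine norm_integral_le_of_norm_le (hγ.norm.const_mul (Real.exp ‖z‖)) ?_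
  filter_upwards [ae_unit_mem] with s hs using hJ.norm_indicator_le z γ ht.2 hs.1.le

/-- Dominated convergence: for fixed `s` the integrand is discontinuous in `t` only at `t = s`, so
at a given `t₀` only the null set `s = t₀` is lost. -/
theorem continuousOn_duhamel (hJ : IsPosResolvent J) (z : ℂ) {γ : ℝ → H}
    (hγ : Integrable γ unitMeasure) : ContinuousOn (duhamel J z γ) (Icc 0 1) := by
  intro t₀ ht₀
  refine continuousWithinAt_of_dominated (bound := fun s => Real.exp ‖z‖ * ‖γ s‖) ?_ ?_
    (hγ.norm.const_mul (Real.exp ‖z‖)) ?_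
  · filter_upwards [self_mem_nhdsWithin] with t ht
      using hJ.aestronglyMeasurable_duhamel z hγ.1 ht
  · filter_upwards [self_mem_nhdsWithin] with t ht
    filter_upwards [ae_unit_mem] with s hs using hJ.norm_indicator_le z γ ht.2 hs.1.le
  · have hne : ∀ᵐ s ∂unitMeasure, s ≠ t₀ := ae_restrict_of_ae (Measure.ae_ne volume t₀)
    filter_upwards [hne] with s hs
    rcases lt_or_gt_of_ne hs with h | h
    · have h1 : (fun t => (Iio t).indicator (fun s => propagator J z (t - s) (γ s)) s)
          =ᶠ[𝓝 t₀] fun t => propagator J z (t - s) (γ s) := by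
        filter_upwards [lt_mem_nhds h] with t ht
        rw [indicator_of_mem (mem_Iio.2 ht)]
      have h2 : ContinuousAt (fun t => propagator J z (t - s) (γ s)) t₀ := by
        have h3 := (hJ.continuousOn_propagator z (γ s)).continuousAt
          (Ici_mem_nhds (sub_pos.2 h))
        exact ContinuousAt.comp (f := fun t => t - s) h3 (by fun_prop)
      exact (h2.congr h1.symm).continuousWithinAt
    · have h1 : (fun t => (Iio t).indicator (fun s => propagator J z (t - s) (γ s)) s)
          =ᶠ[𝓝 t₀] fun _ => 0 := by
        filter_upwards [gt_mem_nhds h] with t ht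
        have hn : s ∉ Iio t := fun hc => lt_asymm ht hc
        rw [indicator_of_notMem hn]
      exact (continuousAt_const.congr h1.symm).continuousWithinAt

theorem duhamel_eq_intervalIntegral {z : ℂ} {γ : ℝ → H} {t : ℝ} (ht : t ∈ Icc (0 : ℝ) 1) :
    duhamel J z γ t = ∫ s in (0 : ℝ)..t, propagator J z (t - s) (γ s) := by
  rw [duhamel, integral_indicator measurableSet_Iio, Measure.restrict_restrict measurableSet_Iio,
    intervalIntegral.integral_of_le ht.1, integral_Ioc_eq_integral_Ioo]
  congr 2
  ext s
  constructor
  · rintro ⟨h1, h2⟩; exact ⟨h2.1, h1⟩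
  · rintro ⟨h1, h2⟩; exact ⟨h2, h1, lt_of_lt_of_le h2 ht.2⟩

theorem continuousOn_propagator_comp (hJ : IsPosResolvent J) (z : ℂ) {γ : ℝ → H}
    (hγ : Continuous γ) {t : ℝ} (ht : t ≤ 1) :
    ContinuousOn (fun s => propagator J z (t - s) (γ s)) (Icc 0 t) := by
  intro s hs
  refine tendsto_apply_apply (K := fun s => propagator J z (t - s)) (M := Real.exp ‖z‖) ?_
    (hγ.continuousWithinAt (s := Icc 0 t) (x := s)) ?_
  · filter_upwards [self_mem_nhdsWithin] with r hr
    exact hJ.norm_propagator_le z ⟨by linarith [hr.2], by linarith [hr.1]⟩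
  · exact (((hJ.continuousOn_propagator z (γ s)).comp (f := fun r => t - r) (s := Icc 0 t)
      (by fun_prop) fun r hr => sub_nonneg.2 hr.2) s hs)

theorem duhamel_add (hJ : IsPosResolvent J) (z : ℂ) {γ : ℝ → H} (hγ : Continuous γ) {t h : ℝ}
    (ht : 0 ≤ t) (hh : 0 ≤ h) (hth : t + h ≤ 1) :
    duhamel J z γ (t + h) = propagator J z h (duhamel J z γ t) +
      ∫ s in t..(t + h), propagator J z (t + h - s) (γ s) := by
  rw [duhamel_eq_intervalIntegral ⟨by linarith, hth⟩,
    duhamel_eq_intervalIntegral ⟨ht, by linarith⟩]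
  have hc := hJ.continuousOn_propagator_comp z hγ hth
  rw [← intervalIntegral.integral_add_adjacent_intervals (b := t)
    ((hc.mono (Icc_subset_Icc_right (by linarith))).intervalIntegrable_of_Icc ht)
    ((hc.mono (Icc_subset_Icc_left ht)).intervalIntegrable_of_Icc (by linarith)),
    ← ContinuousLinearMap.intervalIntegral_comp_comm _
      ((hJ.continuousOn_propagator_comp z hγ (by linarith)).intervalIntegrable_of_Icc ht)]
  congr 1
  refine intervalIntegral.integral_congr fun s hs => ?_
  rw [uIcc_of_le ht] at hs
  have e : t + h - s = h + (t - s) := by ring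
  rw [e, hJ.propagator_add z hh (sub_nonneg.2 hs.2)]
  rfl

/-- The map `(r, s) ↦ e^{-r(C-z)} γ(s)` is jointly continuous at `(0, t)` with value `γ t`, and the
integrand samples it near that point. -/
theorem tendsto_average (hJ : IsPosResolvent J) (z : ℂ) {γ : ℝ → H} (hγ : Continuous γ) {t : ℝ}
    (ht : t ∈ Ioo (0 : ℝ) 1) :
    Tendsto (fun h : ℝ => (h : ℂ)⁻¹ • ∫ s in t..(t + h), propagator J z (t + h - s) (γ s))
      (𝓝[>] 0) (𝓝 (γ t)) := by
  rw [Metric.tendsto_nhds]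
  intro ε hε
  have h1 : Tendsto (fun p : ℝ × ℝ => propagator J z p.1 (γ p.2)) (𝓝[Icc 0 1] 0 ×ˢ 𝓝 t)
      (𝓝 (γ t)) := by
    refine tendsto_apply_apply (K := fun p : ℝ × ℝ => propagator J z p.1) (M := Real.exp ‖z‖) ?_
      ((hγ.tendsto t).comp tendsto_snd) ?_
    · have : ∀ᶠ r in 𝓝[Icc (0 : ℝ) 1] 0, ‖propagator J z r‖ ≤ Real.exp ‖z‖ := by
        filter_upwards [self_mem_nhdsWithin] with r hr using hJ.norm_propagator_le z hr
      exact tendsto_fst.eventually this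
    · have h2 := ((hJ.continuousOn_propagator z (γ t)) 0 self_mem_Ici).mono
        (Icc_subset_Ici_self : Icc (0 : ℝ) 1 ⊆ Ici 0)
      have h3 : Tendsto (fun r => propagator J z r (γ t)) (𝓝[Icc 0 1] 0) (𝓝 (γ t)) := by
        have h4 := h2.tendsto
        rwa [propagator_zero] at h4
      exact h3.comp tendsto_fst
  have h2 := Metric.tendsto_nhds.1 h1 (ε / 2) (by positivity)
  obtain ⟨pa, hpa, pb, hpb, hp⟩ := eventually_prod_iff.1 h2
  obtain ⟨δ₁, hδ₁, h3⟩ := Metric.mem_nhdsWithin_iff.1 hpa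
  obtain ⟨δ₂, hδ₂, h4⟩ := Metric.mem_nhds_iff.1 hpb
  have hδ : 0 < min (min δ₁ δ₂) (1 - t) := lt_min (lt_min hδ₁ hδ₂) (by linarith [ht.2])
  filter_upwards [Ioo_mem_nhdsGT hδ] with h hh
  have hh1 : h < δ₁ := hh.2.trans_le ((min_le_left _ _).trans (min_le_left _ _))
  have hh2 : h < δ₂ := hh.2.trans_le ((min_le_left _ _).trans (min_le_right _ _))
  have hh3 : h < 1 - t := hh.2.trans_le (min_le_right _ _)
  have hh0 : 0 < h := hh.1
  have hint : IntervalIntegrable (fun s => propagator J z (t + h - s) (γ s)) volume t (t + h) :=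
    ((hJ.continuousOn_propagator_comp z hγ (t := t + h) (by linarith)).mono
      (Icc_subset_Icc_left ht.1.le)).intervalIntegrable_of_Icc (by linarith)
  have hbound : ‖∫ s in t..(t + h), (propagator J z (t + h - s) (γ s) - γ t)‖ ≤
      ε / 2 * |t + h - t| := by
    refine intervalIntegral.norm_integral_le_of_norm_le_const fun s hs => ?_
    rw [uIoc_of_le (by linarith)] at hs
    have hs1 := hs.1
    have hs2 := hs.2
    have h5 : pa (t + h - s) := h3 ⟨by
      rw [Metric.mem_ball, Real.dist_eq, sub_zero, abs_of_nonneg (by linarith)]; linarith,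
      by linarith, by linarith [ht.1]⟩
    have h6 : pb s := h4 (by
      rw [Metric.mem_ball, Real.dist_eq, abs_of_nonneg (by linarith)]; linarith)
    have h7 := hp h5 h6
    rw [dist_eq_norm] at h7
    exact h7.le
  rw [intervalIntegral.integral_sub hint intervalIntegrable_const,
    intervalIntegral.integral_const, add_sub_cancel_left, abs_of_pos hh0] at hbound
  have hhc : (h : ℂ) ≠ 0 := by exact_mod_cast hh0.ne'
  rw [dist_eq_norm]
  have e : (h : ℂ)⁻¹ • (∫ s in t..(t + h), propagator J z (t + h - s) (γ s)) - γ t =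
      (h : ℂ)⁻¹ • ((∫ s in t..(t + h), propagator J z (t + h - s) (γ s)) - h • γ t) := by
    rw [smul_sub, ← Complex.coe_smul h, inv_smul_smul₀ hhc]
  rw [e, norm_smul, norm_inv, Complex.norm_real, Real.norm_of_nonneg hh0.le]
  calc h⁻¹ * _ ≤ h⁻¹ * (ε / 2 * h) := by gcongr
    _ = ε / 2 := by field_simp
    _ < ε := by linarith

/-- By the semigroup law the increment of `y` over `[t, t + h]` is the increment of the propagator
at `y t` plus an average of `γ`. After applying `J` both quotients converge, and the continuous
right derivative is upgraded to a derivative. -/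
theorem isMildSolution (hJ : IsPosResolvent J) (z : ℂ) {γ : ℝ → H} (hγ : Continuous γ) (x : H) :
    IsMildSolution J (fun t => propagator J z t x + duhamel J z γ t)
      (fun t => z • (propagator J z t x + duhamel J z γ t) + γ t) := by
  have hγi : Integrable γ unitMeasure :=
    (hγ.continuousOn.integrableOn_Icc (a := (0 : ℝ)) (b := 1)).mono_set Ioo_subset_Icc_self
  set y : ℝ → H := fun t => propagator J z t x + duhamel J z γ t with hy
  have hyc : ContinuousOn y (Icc 0 1) :=
    ((hJ.continuousOn_propagator z x).mono Icc_subset_Ici_self).add (hJ.continuousOn_duhamel z hγi)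
  have hηc : ContinuousOn (fun t => z • y t + γ t) (Icc 0 1) :=
    (hyc.const_smul z).add hγ.continuousOn
  have hstep : ∀ t ∈ Ioo (0 : ℝ) 1, ∀ h, 0 < h → t + h ≤ 1 → y (t + h) =
      propagator J z h (y t) + ∫ s in t..(t + h), propagator J z (t + h - s) (γ s) := by
    intro t ht h hh hth
    simp only [hy]
    rw [hJ.duhamel_add z hγ ht.1.le hh.le hth, (propagator J z h).map_add, add_comm t h,
      hJ.propagator_add z hh.le ht.1.le]
    change _ = (propagator J z h * propagator J z t) x + _ + _
    abel
  change IsMildSolution J y (fun t => z • y t + γ t)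
  clear_value y
  refine ⟨hyc, hηc, fun t ht => ?_⟩
  refine hasDerivAt_of_hasDerivWithinAt_Ioi
    (J.continuous.comp_continuousOn (hyc.mono Ioo_subset_Icc_self))
    (k := fun t => J (z • y t + γ t) + J (y t) - y t) ?_ ?_ ht
  · refine ContinuousOn.mono ?_ Ioo_subset_Icc_self
    exact ((J.continuous.comp_continuousOn hηc).add (J.continuous.comp_continuousOn hyc)).sub hyc
  · intro t ht
    rw [hasDerivWithinAt_iff_tendsto_slope' self_notMem_Ioi]
    have hstep := fun h hh => hstep t ht h hh
    have h1 := (hJ.tendsto_propagator_slope z (y t)).add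
      ((J.continuous.tendsto _).comp (hJ.tendsto_average z hγ ht))
    have hmap : Tendsto (fun r => r - t) (𝓝[>] t) (𝓝[>] 0) := by
      refine tendsto_nhdsWithin_iff.2 ⟨?_, ?_⟩
      · have : Continuous (fun r : ℝ => r - t) := by fun_prop
        have h2 := this.tendsto t
        rw [sub_self] at h2
        exact h2.mono_left nhdsWithin_le_nhds
      · filter_upwards [self_mem_nhdsWithin] with r hr using mem_Ioi.2 (sub_pos.2 (mem_Ioi.1 hr))
    have h2 := h1.comp hmap
    have e : z • J (y t) + (J (y t) - y t) + J (γ t) = J (z • y t + γ t) + J (y t) - y t := by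
      rw [J.map_add, J.map_smul]; abel
    rw [e] at h2
    refine h2.congr' ?_
    filter_upwards [Ioo_mem_nhdsGT ht.2] with r hr
    have hr' : t + (r - t) = r := by ring
    have h3 := hstep (r - t) (sub_pos.2 hr.1) (by linarith [hr.2])
    rw [hr'] at h3
    simp only [Function.comp, slope, vsub_eq_sub]
    rw [hr', h3, J.map_add, ← Complex.coe_smul, map_smul]
    have h4 : J (propagator J z (r - t) (y t)) = propagator J z (r - t) (J (y t)) :=
      (DFunLike.congr_fun (commute_propagator (Commute.refl J) z (r - t)).eq (y t)).symm
    rw [h4]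
    push_cast
    module

theorem isMildSolution_propagator (hJ : IsPosResolvent J) (z : ℂ) (x : H) :
    IsMildSolution J (fun t => propagator J z t x) (fun t => z • propagator J z t x) := by
  have h := hJ.isMildSolution z (γ := fun _ => 0) continuous_const x
  have h0 : ∀ t, duhamel J z (fun _ => (0 : H)) t = 0 := by
    intro t
    simp [duhamel]
  simpa only [h0, add_zero] using h

end IsPosResolvent

end NormalExt

/-! ### The solution operator of the boundary value problem. -/

namespace NormalExt
open Filter Topology

instance : IsProbabilityMeasure unitMeasure :=
  ⟨by rw [Measure.restrict_apply_univ, Real.volume_Ioo]; simp⟩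

theorem integrable_coeFn {H : Type*} [NormedAddCommGroup H] (γ : Lp H 2 unitMeasure) :
    Integrable γ unitMeasure := (Lp.memLp γ).integrable one_le_two

theorem integral_norm_le_norm {H : Type*} [NormedAddCommGroup H] (γ : Lp H 2 unitMeasure) :
    ∫ t, ‖γ t‖ ∂unitMeasure ≤ ‖γ‖ := by
  rw [integral_norm_eq_lintegral_enorm (integrable_coeFn γ).1, ← eLpNorm_one_eq_lintegral_enorm,
    Lp.norm_def]
  exact ENNReal.toReal_mono (Lp.eLpNorm_ne_top γ)
    (eLpNorm_le_eLpNorm_of_exponent_le one_le_two (integrable_coeFn γ).1)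

variable {H : Type*} [NormedAddCommGroup H] [InnerProductSpace ℂ H] [CompleteSpace H]
  {J : H →L[ℂ] H}

theorem duhamel_zero_right (z : ℂ) (γ : ℝ → H) : duhamel J z γ 0 = 0 := by
  rw [duhamel, ← integral_zero ℝ H (μ := unitMeasure)]
  refine integral_congr_ae ?_
  filter_upwards [ae_unit_mem] with s hs
  have hn : s ∉ Iio (0 : ℝ) := fun h => lt_asymm h hs.1
  rw [indicator_of_notMem hn]

theorem duhamel_smul (z c : ℂ) (γ : ℝ → H) (t : ℝ) :
    duhamel J z (fun s => c • γ s) t = c • duhamel J z γ t := by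
  rw [duhamel, duhamel, ← integral_smul]
  refine integral_congr_ae (Eventually.of_forall fun s => ?_)
  simp only [indicator, map_smul]
  split_ifs <;> simp

theorem duhamel_add_fun (hJ : IsPosResolvent J) (z : ℂ) {γ γ' : ℝ → H}
    (hγ : Integrable γ unitMeasure) (hγ' : Integrable γ' unitMeasure) {t : ℝ}
    (ht : t ∈ Icc (0 : ℝ) 1) :
    duhamel J z (fun s => γ s + γ' s) t = duhamel J z γ t + duhamel J z γ' t := by
  rw [duhamel, duhamel, duhamel, ← integral_add (hJ.integrable_duhamel z hγ ht)
    (hJ.integrable_duhamel z hγ' ht)]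
  refine integral_congr_ae (Eventually.of_forall fun s => ?_)
  simp only [indicator, map_add]
  split_ifs <;> simp

/-- The mild solution of `y' + C y = z y + γ` with initial value `Q (∫₀¹ e^{-(1-s)(C-z)} γ(s) ds)`. -/
def solution (J Q : H →L[ℂ] H) (z : ℂ) (γ : ℝ → H) (t : ℝ) : H :=
  propagator J z t (Q (duhamel J z γ 1)) + duhamel J z γ t

theorem solution_congr {Q : H →L[ℂ] H} {z : ℂ} {γ γ' : ℝ → H} (h : γ =ᵐ[unitMeasure] γ') :
    solution J Q z γ = solution J Q z γ' := by
  funext t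
  rw [solution, solution, duhamel_congr h, duhamel_congr h]

/-- The hypothesis says that `Q` is a right inverse of `W - e^z e^{-C}`, which is exactly how the
initial value must be chosen. -/
theorem solution_boundary {Q W : H →L[ℂ] H} {z : ℂ}
    (hQ : ∀ d, propagator J z 1 (Q d) + d = W (Q d)) (γ : ℝ → H) :
    solution J Q z γ 1 = W (solution J Q z γ 0) := by
  rw [solution, solution, hQ, propagator_zero, duhamel_zero_right, add_zero]
  rfl

namespace IsPosResolvent

variable (hJ : IsPosResolvent J)

theorem continuousOn_solution (hJ : IsPosResolvent J) (Q : H →L[ℂ] H) (z : ℂ) {γ : ℝ → H}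
    (hγ : Integrable γ unitMeasure) : ContinuousOn (solution J Q z γ) (Icc 0 1) :=
  ((hJ.continuousOn_propagator z _).mono Icc_subset_Ici_self).add (hJ.continuousOn_duhamel z hγ)

theorem norm_solution_le (hJ : IsPosResolvent J) (Q : H →L[ℂ] H) (z : ℂ) (γ : Lp H 2 unitMeasure)
    {t : ℝ} (ht : t ∈ Icc (0 : ℝ) 1) : ‖solution J Q z γ t‖ ≤
      (Real.exp ‖z‖ * (‖Q‖ * Real.exp ‖z‖) + Real.exp ‖z‖) * ‖γ‖ := by
  have h1 : ∀ r ∈ Icc (0 : ℝ) 1, ‖duhamel J z γ r‖ ≤ Real.exp ‖z‖ * ‖γ‖ := fun r hr =>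
    (hJ.norm_duhamel_le z (integrable_coeFn γ) hr).trans
      (mul_le_mul_of_nonneg_left (integral_norm_le_norm γ) (Real.exp_pos _).le)
  have h2 : ‖propagator J z t (Q (duhamel J z γ 1))‖ ≤
      Real.exp ‖z‖ * (‖Q‖ * (Real.exp ‖z‖ * ‖γ‖)) := by
    refine ((propagator J z t).le_of_opNorm_le (hJ.norm_propagator_le z ht) _).trans ?_
    gcongr
    exact Q.le_opNorm_of_le (h1 1 ⟨zero_le_one, le_rfl⟩)
  refine (norm_add_le _ _).trans ((add_le_add h2 (h1 t ht)).trans_eq ?_)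
  ring

/-- The solution operator `γ ↦ solution J Q z γ` on `L²(H,(0,1))`. -/
def solutionOp (hJ : IsPosResolvent J) (Q : H →L[ℂ] H) (z : ℂ) :
    Lp H 2 unitMeasure →L[ℂ] Lp H 2 unitMeasure :=
  LinearMap.mkContinuous
    { toFun := fun γ => toL2 (hJ.continuousOn_solution Q z (integrable_coeFn γ))
      map_add' := fun γ γ' => by
        refine toL2_eq _ ?_
        filter_upwards [Lp.coeFn_add (toL2 (hJ.continuousOn_solution Q z (integrable_coeFn γ)))
          (toL2 (hJ.continuousOn_solution Q z (integrable_coeFn γ'))),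
          coeFn_toL2 (hJ.continuousOn_solution Q z (integrable_coeFn γ)),
          coeFn_toL2 (hJ.continuousOn_solution Q z (integrable_coeFn γ')), ae_unit_mem]
          with t h1 h2 h3 ht
        rw [h1, Pi.add_apply, h2, h3, solution_congr (Lp.coeFn_add γ γ')]
        have h4 := fun r hr => duhamel_add_fun hJ z (integrable_coeFn γ) (integrable_coeFn γ')
          (t := r) hr
        simp only [solution]
        have h5 := h4 1 ⟨zero_le_one, le_rfl⟩
        have h6 := h4 t (Ioo_subset_Icc_self ht)
        change (_ + _ : H) = propagator J z t (Q (duhamel J z (fun s => γ s + γ' s) 1)) +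
          duhamel J z (fun s => γ s + γ' s) t
        rw [h5, h6, map_add, map_add]
        abel
      map_smul' := fun c γ => by
        refine toL2_eq _ ?_
        filter_upwards [Lp.coeFn_smul c (toL2 (hJ.continuousOn_solution Q z (integrable_coeFn γ))),
          coeFn_toL2 (hJ.continuousOn_solution Q z (integrable_coeFn γ))] with t h1 h2
        simp only [RingHom.id_apply]
        rw [h1, Pi.smul_apply, h2, solution_congr (Lp.coeFn_smul c γ)]
        change c • (propagator J z t (Q (duhamel J z γ 1)) + duhamel J z γ t) =
          propagator J z t (Q (duhamel J z (fun s => c • γ s) 1)) +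
          duhamel J z (fun s => c • γ s) t
        rw [duhamel_smul, duhamel_smul, map_smul, map_smul, smul_add] }
    (Real.exp ‖z‖ * (‖Q‖ * Real.exp ‖z‖) + Real.exp ‖z‖)
    fun γ => norm_toL2_le (hJ.continuousOn_solution Q z (integrable_coeFn γ)) (by positivity)
      fun t ht => hJ.norm_solution_le Q z γ (Ioo_subset_Icc_self ht)

theorem solutionOp_apply (Q : H →L[ℂ] H) (z : ℂ) (γ : Lp H 2 unitMeasure) :
    hJ.solutionOp Q z γ = toL2 (hJ.continuousOn_solution Q z (integrable_coeFn γ)) := rfl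

theorem exists_isMildSolution (Q : H →L[ℂ] H) (z : ℂ) {g : ℝ → H} (hg : Continuous g)
    {γ : Lp H 2 unitMeasure} (h : γ =ᵐ[unitMeasure] g) :
    ∃ (y η : ℝ → H) (hy : IsMildSolution J y η), y = solution J Q z γ ∧
      toL2 hy.continuousOn = hJ.solutionOp Q z γ ∧
      toL2 hy.continuousOn_rhs = z • hJ.solutionOp Q z γ + γ := by
  have hy := hJ.isMildSolution z hg (Q (duhamel J z g 1))
  have e : (fun t => propagator J z t (Q (duhamel J z g 1)) + duhamel J z g t) =
      solution J Q z γ := (solution_congr h).symm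
  refine ⟨_, _, hy, e, ?_, ?_⟩
  · refine toL2_eq _ ?_
    filter_upwards [coeFn_toL2 (hJ.continuousOn_solution Q z (integrable_coeFn γ))] with t h1
    rw [solutionOp_apply, h1, ← e]
  · refine toL2_eq _ ?_
    filter_upwards [coeFn_toL2 (hJ.continuousOn_solution Q z (integrable_coeFn γ)), h,
      Lp.coeFn_add (z • hJ.solutionOp Q z γ) γ, Lp.coeFn_smul z (hJ.solutionOp Q z γ)]
      with t h1 h2 h3 h4
    rw [h3, Pi.add_apply, h4, Pi.smul_apply, solutionOp_apply, h1, ← e, h2]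

end IsPosResolvent

variable [TopologicalSpace.SeparableSpace H]
  {α : ℝ → ℝ} {Ar Ai : ℝ → H →ₗ.[ℂ] H} {C : H →ₗ.[ℂ] H} {D : Submodule ℂ H}
  {V Y : ℝ → H →L[ℂ] H} {U : ℝ → ℝ → H →L[ℂ] H} {W Q : H →L[ℂ] H}
  {Φ : Lp H 2 unitMeasure ≃ₗᵢ[ℂ] WeightedL2 H α}

omit [CompleteSpace H] in
theorem exists_continuous_tendsto (γ : Lp H 2 unitMeasure) :
    ∃ γ' : ℕ → Lp H 2 unitMeasure, (∀ n, ∃ g : ℝ → H, Continuous g ∧ γ' n =ᵐ[unitMeasure] g) ∧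
      Tendsto γ' atTop (𝓝 γ) := by
  have : SecondCountableTopology H := UniformSpace.secondCountable_of_separable H
  have hd := BoundedContinuousFunction.toLp_denseRange (E := H) (p := 2) (μ := unitMeasure) (𝕜 := ℂ)
    ENNReal.ofNat_ne_top
  obtain ⟨γ', h1, h2⟩ := mem_closure_iff_seq_limit.1 (hd γ)
  refine ⟨γ', fun n => ?_, h2⟩
  obtain ⟨g, hg⟩ := h1 n
  exact ⟨g, g.continuous, hg ▸ BoundedContinuousFunction.coeFn_toLp 2 unitMeasure ℂ g⟩

namespace IsSystem

/-- The differential equation is known for continuous `γ`, which are dense. The boundary condition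
holds directly for every `γ`, and the graph relation for `L` passes to the limit in its weak form.
-/
theorem mem_graph_solutionOp (S : IsSystem α Ar Ai C D J V Y) (hΦ : IsWeightedEquiv V Φ)
    (hV : V 1 = U 1 0) (hWi : ∀ x y, ⟪W x, W y⟫_ℂ = ⟪x, y⟫_ℂ) (hWJ : Commute J W) {z : ℂ}
    (hQ : ∀ d, propagator J z 1 (Q d) + d = W (Q d)) (γ : Lp H 2 unitMeasure) :
    (Φ (S.isPosResolvent.solutionOp Q z γ), Φ (z • S.isPosResolvent.solutionOp Q z γ + γ)) ∈
      (extensionOp α Ar Ai D U W).graph := by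
  obtain ⟨γ', hγ', hlim⟩ := exists_continuous_tendsto γ
  choose g hg hγg using hγ'
  have hmem : Φ (S.isPosResolvent.solutionOp Q z γ) ∈ boundaryCondition α (V 1 * W) :=
    S.mem_boundaryCondition hΦ (S.isPosResolvent.continuousOn_solution Q z (integrable_coeFn γ))
      (solution_boundary hQ _)
  choose y η hy hyb hyT hηT using fun n =>
    S.isPosResolvent.exists_isMildSolution Q z (hg n) (hγg n)
  generalize S.isPosResolvent.solutionOp Q z = T at *
  have hlimT : Tendsto (fun n => Φ (T (γ' n))) atTop (𝓝 (Φ (T γ))) :=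
    ((Φ.continuous.comp T.continuous).tendsto _).comp hlim
  have hlimR : Tendsto (fun n => Φ (z • T (γ' n) + γ' n)) atTop (𝓝 (Φ (z • T γ + γ))) := by
    have hc : Continuous fun γ => Φ (z • T γ + γ) :=
      Φ.continuous.comp ((T.continuous.const_smul z).add continuous_id)
    exact (hc.tendsto _).comp hlim
  refine mem_graph_extensionOp_iff.2 ⟨?_, ?_, ?_⟩
  -- The `L⁺`-images are dominated by a convergent, hence bounded, sequence of right-hand sides;
  -- their own convergence is not needed.
  · obtain ⟨K, hK⟩ := hlimR.norm.bddAbove_range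
    choose v hv hvn using fun n => S.exists_mem_graph_maximalOpPlus_of_mild hΦ hWi hWJ (hy n)
      (by rw [hyb n]; exact solution_boundary hQ _)
    obtain ⟨v₀, h1, -⟩ := S.exists_mem_graph_maximalOpPlus (u₀ := Φ (T γ)) (K := K) hv
      (by simpa only [hyT] using hlimT)
      fun n => (hvn n).trans (by rw [hηT n]; exact hK (mem_range_self n))
    exact mem_domain_of_graph h1
  · rw [← hV]
    exact hmem
  · refine S.mem_graph_maximalOp_iff.2 fun q hq => ?_
    refine tendsto_nhds_unique (tendsto_const_nhds.inner hlimT)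
      ((tendsto_const_nhds.inner hlimR).congr fun n => ?_)
    have h1 := S.mem_graph_maximalOp_iff.1 (S.mem_graph_maximalOp hΦ (hy n)) q hq
    rw [hyT n, hηT n] at h1
    exact h1.symm

end IsSystem
end NormalExt

/-! ### Weak derivatives of scalar functions. -/

namespace NormalExt
open Filter Topology

theorem integrable_of_compact_support {k : ℝ → ℂ} {K : Set ℝ}
    (hK : IsCompact K) (hKs : K ⊆ Ioo 0 1) (hk : ContinuousOn k (Ioo 0 1))
    (h0 : ∀ t ∉ K, k t = 0) : Integrable k unitMeasure :=
  (memLp_of_compact_support hK hKs hk h0).integrable one_le_two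

theorem exists_primitive {h : ℝ → ℝ} (h1 : ContDiff ℝ ∞ h) (h2 : HasCompactSupport h)
    (h3 : tsupport h ⊆ Ioo 0 1) (h0 : ∫ x, h x = 0) :
    ∃ g : ℝ → ℝ, ContDiff ℝ ∞ g ∧ HasCompactSupport g ∧ tsupport g ⊆ Ioo 0 1 ∧ deriv g = h := by
  rcases (tsupport h).eq_empty_or_nonempty with he | hne
  · have : h = fun _ => 0 := tsupport_eq_empty_iff.1 he
    refine ⟨fun _ => 0, contDiff_const, HasCompactSupport.zero, by simp [tsupport], ?_⟩
    rw [this]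
    exact deriv_const' 0
  · obtain ⟨a, ha⟩ := h2.exists_isLeast hne
    obtain ⟨b, hb⟩ := h2.exists_isGreatest hne
    have hab : Icc a b ⊆ Ioo 0 1 := fun x hx =>
      ⟨(h3 ha.1).1.trans_le hx.1, hx.2.trans_lt (h3 hb.1).2⟩
    have hd : ∀ t, HasDerivAt (fun t => ∫ s in (0 : ℝ)..t, h s) (h t) t := fun t =>
      (h1.continuous.integral_hasStrictDerivAt 0 t).hasDerivAt
    have hde : deriv (fun t => ∫ s in (0 : ℝ)..t, h s) = h := funext fun t => (hd t).deriv
    -- To the left of the support the integral is over a region where `h` vanishes; to the right it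
    -- is the full integral, which is zero.
    have hz : ∀ t ∉ Icc a b, ∫ s in (0 : ℝ)..t, h s = 0 := by
      intro t ht
      have ha0 := (h3 ha.1).1
      rcases lt_or_ge t a with hta | hta
      · refine intervalIntegral.integral_zero_ae (Eventually.of_forall fun x hx => ?_)
        refine image_eq_zero_of_notMem_tsupport fun hx' => ?_
        have h4 := ha.2 hx'
        have h5 : x ≤ max 0 t := hx.2
        exact absurd (h4.trans h5) (not_le.2 (max_lt ha0 hta))
      · have htb : b < t := not_le.1 fun h => ht ⟨hta, h⟩
        rw [intervalIntegral.integral_eq_integral_of_support_subset, h0]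
        intro x hx
        have hx' := subset_tsupport h hx
        exact ⟨(h3 hx').1, (hb.2 hx').trans htb.le⟩
    refine ⟨fun t => ∫ s in (0 : ℝ)..t, h s, contDiff_infty_iff_deriv.2
      ⟨fun t => (hd t).differentiableAt, by rwa [hde]⟩,
      HasCompactSupport.intro isCompact_Icc hz, ?_, hde⟩
    refine (closure_minimal (fun t ht => ?_) isClosed_Icc).trans hab
    by_contra hc
    exact ht (hz t hc)

/-- The lemma of du Bois-Reymond. -/
theorem exists_eq_const {b : ℝ → ℂ} (hb : ContinuousOn b (Ioo 0 1))
    (h : ∀ g : ℝ → ℝ, ContDiff ℝ ∞ g → HasCompactSupport g → tsupport g ⊆ Ioo 0 1 →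
      ∫ t, ((deriv g t : ℝ) : ℂ) * b t ∂unitMeasure = 0) :
    ∃ β : ℂ, ∀ t ∈ Ioo (0 : ℝ) 1, b t = β := by
  let f : ContDiffBump (1 / 2 : ℝ) := ⟨1 / 8, 1 / 4, by norm_num, by norm_num⟩
  set ψ : ℝ → ℝ := f.normed volume with hψ
  have hψ1 : ContDiff ℝ ∞ ψ := f.contDiff_normed
  have hψ2 : HasCompactSupport ψ := f.hasCompactSupport_normed
  have hψ3 : tsupport ψ ⊆ Ioo 0 1 := by
    rw [hψ, f.tsupport_normed_eq, Real.closedBall_eq_Icc]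
    refine Icc_subset_Ioo ?_ ?_ <;> norm_num [f]
  have hψi : ∫ x, ψ x = 1 := f.integral_normed
  have hint : ∀ g : ℝ → ℝ, Continuous g → HasCompactSupport g → tsupport g ⊆ Ioo 0 1 →
      Integrable (fun t => (g t : ℂ) * b t) unitMeasure := fun g h1 h2 h3 =>
    integrable_of_compact_support h2 h3
      ((Complex.continuous_ofReal.comp h1).continuousOn.mul hb) fun t ht => by
        rw [image_eq_zero_of_notMem_tsupport ht]; simp
  have hci : ∀ (g : ℝ → ℝ), tsupport g ⊆ Ioo 0 1 → ∀ k : ℝ → ℂ,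
      ∫ t, (g t : ℂ) * k t = ∫ t, (g t : ℂ) * k t ∂unitMeasure := fun g h3 k =>
    (setIntegral_eq_integral_of_forall_compl_eq_zero fun t ht => by
      rw [image_eq_zero_of_notMem_tsupport fun h => ht (h3 h)]; simp).symm
  set β : ℂ := ∫ t, (ψ t : ℂ) * b t ∂unitMeasure with hβ
  refine ⟨β, ?_⟩
  have hae : ∀ᵐ t, t ∈ Ioo (0 : ℝ) 1 → b t - β = 0 := by
    refine isOpen_Ioo.ae_eq_zero_of_integral_contDiff_smul_eq_zero
      ((hb.sub continuousOn_const).locallyIntegrableOn measurableSet_Ioo) fun g h1 h2 h3 => ?_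
    set c : ℝ := ∫ x, g x with hc
    have hs : tsupport (fun t => g t - c * ψ t) ⊆ tsupport g ∪ tsupport ψ := by
      refine closure_minimal (fun t ht => ?_)
        ((isClosed_tsupport g).union (isClosed_tsupport ψ))
      by_contra hn
      rw [mem_union, not_or] at hn
      exact ht (by simp [image_eq_zero_of_notMem_tsupport hn.1,
        image_eq_zero_of_notMem_tsupport hn.2])
    have hs1 := hs.trans (union_subset h3 hψ3)
    have hs2 : HasCompactSupport (fun t => g t - c * ψ t) :=
      (h2.isCompact.union hψ2.isCompact).of_isClosed_subset (isClosed_tsupport _) hs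
    have hgi : Integrable g := h1.continuous.integrable_of_hasCompactSupport h2
    have hψI : Integrable ψ := hψ1.continuous.integrable_of_hasCompactSupport hψ2
    -- As `ψ` has integral one, `g - c ψ` has mean zero and is the derivative of a test function.
    obtain ⟨G, hG1, hG2, hG3, hG⟩ := exists_primitive (h := fun t => g t - c * ψ t)
      (h1.sub (contDiff_const.mul hψ1)) hs2 hs1 (by
        rw [integral_sub hgi (hψI.const_mul c), integral_const_mul, hψi, mul_one, sub_self])
    have h4 := h G hG1 hG2 hG3
    rw [hG] at h4
    have e1 : (∫ t, (g t : ℂ) * b t ∂unitMeasure) - c * β = 0 := by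
      rw [← h4, hβ, ← integral_const_mul, ← integral_sub (hint g h1.continuous h2 h3)
        ((hint ψ hψ1.continuous hψ2 hψ3).const_mul _)]
      refine integral_congr_ae (Eventually.of_forall fun t => ?_)
      push_cast
      ring
    have hgc : Integrable (fun t => (g t : ℂ) * β) := hgi.ofReal.mul_const β
    have hgb : Integrable (fun t => (g t : ℂ) * b t) := by
      refine (integrableOn_iff_integrable_of_support_subset (s := Ioo (0 : ℝ) 1) fun t ht => ?_).1
        (hint g h1.continuous h2 h3)
      by_contra hc
      exact ht (by simp [image_eq_zero_of_notMem_tsupport fun h => hc (h3 h)])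
    have e2 : ∫ t, (g t : ℂ) * β = c * β := by
      rw [integral_mul_const, integral_complex_ofReal]
    calc ∫ t, g t • (b t - β) = ∫ t, ((g t : ℂ) * b t - (g t : ℂ) * β) := by
          refine integral_congr_ae (Eventually.of_forall fun t => ?_)
          simp only [Complex.real_smul, mul_sub]
      _ = 0 := by rw [integral_sub hgb hgc, hci g h3, e2, e1]
  have h1 : b =ᵐ[unitMeasure] fun _ => β := by
    filter_upwards [ae_restrict_of_ae hae, ae_unit_mem] with t h1 ht using sub_eq_zero.1 (h1 ht)
  exact Measure.eqOn_open_of_ae_eq h1 isOpen_Ioo hb continuousOn_const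

/-- Subtracting a primitive of `m` from `a` leaves a continuous function with zero weak derivative,
hence a constant. -/
theorem hasDerivAt_of_weak {a m : ℝ → ℂ} (ha : ContinuousOn a (Ioo 0 1))
    (hm : ContinuousOn m (Ioo 0 1))
    (h : ∀ g : ℝ → ℝ, ContDiff ℝ ∞ g → HasCompactSupport g → tsupport g ⊆ Ioo 0 1 →
      ∫ t, (((deriv g t : ℝ) : ℂ) * a t + (g t : ℂ) * m t) ∂unitMeasure = 0) {t : ℝ}
    (ht : t ∈ Ioo (0 : ℝ) 1) : HasDerivAt a (m t) t := by
  set M : ℝ → ℂ := fun t => ∫ s in (1 / 2 : ℝ)..t, m s with hM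
  have hMd : ∀ t ∈ Ioo (0 : ℝ) 1, HasDerivAt M (m t) t := fun t ht =>
    hasDerivAt_integral_Ioo hm ⟨by norm_num, by norm_num⟩ ht
  have hMc : ContinuousOn M (Ioo 0 1) := fun t ht => (hMd t ht).continuousAt.continuousWithinAt
  obtain ⟨β, hβ⟩ := exists_eq_const (ha.sub hMc) fun g h1 h2 h3 => by
    have hgc := h1.continuous
    have hgd : Continuous (deriv g) := h1.continuous_deriv (by norm_cast)
    have hg0 : ∀ t ∉ tsupport g, deriv g t = 0 := fun t ht =>
      image_eq_zero_of_notMem_tsupport fun h => ht (tsupport_deriv_subset h)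
    have hgv : ∀ t ∉ tsupport g, g t = 0 := fun t ht => image_eq_zero_of_notMem_tsupport ht
    have i1 : Integrable (fun t => ((deriv g t : ℝ) : ℂ) * a t + (g t : ℂ) * m t) unitMeasure :=
      integrable_of_compact_support h2 h3
        (((Complex.continuous_ofReal.comp hgd).continuousOn.mul ha).add
          ((Complex.continuous_ofReal.comp hgc).continuousOn.mul hm))
        fun t ht => by simp [hg0 t ht, hgv t ht]
    have i2 : Integrable (fun t => ((deriv g t : ℝ) : ℂ) * M t + (g t : ℂ) * m t) unitMeasure :=
      integrable_of_compact_support h2 h3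
        (((Complex.continuous_ofReal.comp hgd).continuousOn.mul hMc).add
          ((Complex.continuous_ofReal.comp hgc).continuousOn.mul hm))
        fun t ht => by simp [hg0 t ht, hgv t ht]
    have h4 : ∫ t, (((deriv g t : ℝ) : ℂ) * M t + (g t : ℂ) * m t) ∂unitMeasure = 0 :=
      integral_eq_zero_of_compact_support (F := fun t => (g t : ℂ) * M t) h2 h3
        (fun t ht => by simp [hgv t ht])
        (fun t ht => ((h1.differentiable (by simp)).differentiableAt.hasDerivAt.ofReal_comp).mul
          (hMd t ht)) i2
    have h5 := h g h1 h2 h3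
    rw [← sub_eq_zero.2 (h5.trans h4.symm), ← integral_sub i1 i2]
    refine integral_congr_ae (Eventually.of_forall fun t => ?_)
    simp only [Pi.sub_apply]
    ring
  refine ((hMd t ht).const_add β).congr_of_eventuallyEq ?_
  filter_upwards [isOpen_Ioo.mem_nhds ht] with r hr
  rw [← hβ r hr]
  simp

end NormalExt

/-! ### Uniqueness: the kernel of `L_W - λ`. -/

namespace NormalExt
open Filter Topology

variable {H : Type*} [NormedAddCommGroup H] [InnerProductSpace ℂ H] [CompleteSpace H]
  {α : ℝ → ℝ} {Ar Ai : ℝ → H →ₗ.[ℂ] H} {C : H →ₗ.[ℂ] H} {D : Submodule ℂ H}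
  {J : H →L[ℂ] H} {V Y : ℝ → H →L[ℂ] H} {U : ℝ → ℝ → H →L[ℂ] H} {W : H →L[ℂ] H}

/-- A function satisfying `(J z)' = J η + J z - z` weakly on a dense set satisfies it strongly. -/
theorem isMildSolution_of_inner {z η : ℝ → H} (hz : ContinuousOn z (Icc 0 1))
    (hη : ContinuousOn η (Icc 0 1)) (hD : Dense (D : Set H))
    (h : ∀ f ∈ D, ∀ t ∈ Ioo (0 : ℝ) 1, HasDerivAt (fun r => ⟪f, J (z r)⟫_ℂ)
      ⟪f, J (η t) + J (z t) - z t⟫_ℂ t) : IsMildSolution J z η := by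
  refine ⟨hz, hη, fun t ht => ?_⟩
  set k : ℝ → H := fun t => J (η t) + J (z t) - z t with hk
  have hkc : ContinuousOn k (Ioo 0 1) := (((J.continuous.comp_continuousOn hη).add
    (J.continuous.comp_continuousOn hz)).sub hz).mono Ioo_subset_Icc_self
  refine ((hasDerivAt_integral_Ioo hkc ht ht).const_add (J (z t))).congr_of_eventuallyEq ?_
  filter_upwards [isOpen_Ioo.mem_nhds ht] with r hr
  have hsub : uIcc t r ⊆ Ioo 0 1 := (ordConnected_Ioo (a := (0 : ℝ)) (b := 1)).uIcc_subset ht hr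
  refine hD.eq_of_inner_right (𝕜 := ℂ) fun f hf => ?_
  have h1 := intervalIntegral.integral_eq_sub_of_hasDerivAt
    (fun x hx => h f hf x (hsub hx))
    ((continuousOn_const.inner (𝕜 := ℂ) (hkc.mono hsub)).intervalIntegrable)
  have h2 := (innerSL ℂ f).intervalIntegral_comp_comm (hkc.mono hsub).intervalIntegrable (μ := volume)
  simp only [innerSL_apply_apply] at h2
  rw [inner_add_right, ← h2, h1]
  ring

namespace IsSystem

theorem app_V (S : IsSystem α Ar Ai C D J V Y) {t : ℝ} (ht : t ∈ Icc (0 : ℝ) 1) {f : H}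
    (hf : f ∈ D) : app C (V t f) = V t (app C f) := by
  have hJV : ∀ x, J (V t x) = V t (J x) := fun x => DFunLike.congr_fun (S.commute_V ht).eq x
  have h1 := S.resolvent.apply_add (S.coeff.le_domain hf)
  have h2 : V t f = J (V t (app C f + f)) := by rw [hJV, h1]
  have h3 := S.resolvent.app_apply (V t (app C f + f))
  rw [← h2] at h3
  rw [h3, map_add]
  abel

/-- Since `J d` lies in the domain of `C` and is differentiable, `C ≥ 0` makes `e^{-2 Re(λ) t} ‖J
d‖²` nonincreasing. It starts at zero, and `J` is injective. -/
theorem eq_zero_of_isMildSolution (S : IsSystem α Ar Ai C D J V Y) {lam : ℂ} {d : ℝ → H}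
    (h : IsMildSolution J d (fun t => lam • d t)) (h0 : d 0 = 0) {t : ℝ}
    (ht : t ∈ Icc (0 : ℝ) 1) : d t = 0 := by
  set g : ℝ → ℝ := fun t => Real.exp (-(2 * lam.re) * t) * ‖J (d t)‖ ^ 2 with hg
  have hJd : ContinuousOn (fun t => J (d t)) (Icc 0 1) :=
    J.continuous.comp_continuousOn h.continuousOn
  have hgc : ContinuousOn g (Icc 0 1) :=
    (Continuous.continuousOn (by fun_prop)).mul (hJd.norm.pow 2)
  have hgd : ∀ t ∈ Ioo (0 : ℝ) 1, HasDerivAt g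
      (-2 * Real.exp (-(2 * lam.re) * t) * (⟪J (d t), app C (J (d t))⟫_ℂ).re) t := by
    intro t ht
    have h1 := (h.hasDerivAt t ht).inner ℂ (h.hasDerivAt t ht)
    have h2 := (Complex.reCLM.hasFDerivAt.comp_hasDerivAt t h1)
    have h3 : HasDerivAt (fun r => ‖J (d r)‖ ^ 2)
        (2 * (⟪J (d t), lam • J (d t) - app C (J (d t))⟫_ℂ).re) t := by
      refine (h2.congr_of_eventuallyEq (Eventually.of_forall fun r => ?_)).congr_deriv ?_
      · simp only [Function.comp, Complex.reCLM_apply]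
        rw [inner_self_eq_norm_sq_to_K]
        norm_cast
      · have e : J (lam • d t) + J (d t) - d t = lam • J (d t) - app C (J (d t)) := by
          rw [map_smul, S.resolvent.app_apply]
          abel
        rw [e]
        simp only [Complex.reCLM_apply, Complex.add_re]
        rw [← inner_conj_symm (lam • J (d t) - app C (J (d t))), Complex.conj_re]
        ring
    have h4 : HasDerivAt (fun r : ℝ => Real.exp (-(2 * lam.re) * r))
        (Real.exp (-(2 * lam.re) * t) * (-(2 * lam.re))) t := by
      simpa using ((hasDerivAt_id t).const_mul (-(2 * lam.re))).exp
    refine (h4.mul h3).congr_deriv ?_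
    have h5 : (lam * (‖J (d t)‖ : ℂ) ^ 2).re = lam.re * ‖J (d t)‖ ^ 2 := by
      rw [← Complex.ofReal_pow, Complex.re_mul_ofReal]
    rw [inner_sub_right, inner_smul_right, inner_self_eq_norm_sq_to_K, Complex.sub_re]
    simp only [Complex.coe_algebraMap]
    rw [h5]
    ring
  have hanti : AntitoneOn g (Icc 0 1) := by
    refine antitoneOn_of_deriv_nonpos (convex_Icc 0 1) hgc ?_ ?_
    · rw [interior_Icc]
      exact fun t ht => (hgd t ht).differentiableAt.differentiableWithinAt
    · rw [interior_Icc]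
      intro t ht
      rw [(hgd t ht).deriv]
      have h1 := S.coeff.nonneg_const ⟨_, S.resolvent.mem_domain (d t)⟩
      rw [← app_of_mem] at h1
      rw [← inner_conj_symm, Complex.conj_re]
      have h2 := Real.exp_pos (-(2 * lam.re) * t)
      simp only at h1
      nlinarith [mul_nonneg h2.le h1]
  have h1 := hanti (left_mem_Icc.2 zero_le_one) ht ht.1
  have h2 : g 0 = 0 := by simp [hg, h0]
  rw [h2] at h1
  have h3 : ‖J (d t)‖ ^ 2 ≤ 0 := by
    by_contra hc
    exact absurd h1 (not_le.2 (mul_pos (Real.exp_pos _) (not_le.1 hc)))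
  have h4 : J (d t) = 0 := by
    rw [← norm_eq_zero]
    exact pow_eq_zero_iff (two_ne_zero) |>.1 (le_antisymm h3 (sq_nonneg _))
  exact S.isPosResolvent.injective (h4.trans (map_zero J).symm)

theorem eq_propagator (S : IsSystem α Ar Ai C D J V Y) {lam : ℂ} {z : ℝ → H}
    (h : IsMildSolution J z (fun t => lam • z t)) {t : ℝ} (ht : t ∈ Icc (0 : ℝ) 1) :
    z t = propagator J lam t (z 0) := by
  have h' := S.isPosResolvent.isMildSolution_propagator lam (z 0)
  refine sub_eq_zero.1 (S.eq_zero_of_isMildSolution (lam := lam)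
    (d := fun t => z t - propagator J lam t (z 0)) ⟨h.continuousOn.sub h'.continuousOn,
      (h.continuousOn.sub h'.continuousOn).const_smul lam, fun t ht => ?_⟩ ?_ ht)
  · have h1 := (h.hasDerivAt t ht).sub (h'.hasDerivAt t ht)
    refine (h1.congr_of_eventuallyEq (Eventually.of_forall fun r => map_sub J _ _)).congr_deriv ?_
    simp only [map_sub, map_smul, smul_sub]
    abel
  · rw [propagator_zero]
    exact sub_self _

variable [TopologicalSpace.SeparableSpace H]

/-- The scalar equation satisfied by a continuous representative of `√α u`. -/
theorem hasDerivAt_inner_of_mem_graph (S : IsSystem α Ar Ai C D J V Y) {lam : ℂ}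
    {u : WeightedL2 H α} (hu : (u, lam • u) ∈ (maximalOp α Ar Ai D).graph) {w : ℝ → H}
    (hw : ContinuousOn w (Icc 0 1))
    (huw : ∀ᵐ t ∂unitMeasure, ((Real.sqrt (α t) : ℝ) : ℂ) • u t = w t) {f : H} (hf : f ∈ D)
    {t : ℝ} (ht : t ∈ Ioo (0 : ℝ) 1) :
    HasDerivAt (fun r => ⟪f, w r⟫_ℂ)
      (lam * ⟪f, w t⟫_ℂ - ⟪app C f - Complex.I • app (Ai t) f, w t⟫_ℂ) t := by
  have hw' := hw.mono Ioo_subset_Icc_self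
  set b : ℝ → ℂ := fun t => ⟪f, w t⟫_ℂ with hb
  set k : ℝ → ℂ := fun t =>
    lam * ⟪f, w t⟫_ℂ - ⟪app C f - Complex.I • app (Ai t) f, w t⟫_ℂ with hk
  have hbc : ContinuousOn b (Ioo 0 1) := continuousOn_const.inner hw'
  have hkc : ContinuousOn k (Ioo 0 1) :=
    (continuousOn_const.mul hbc).sub ((continuousOn_const.sub
      (((S.coeff.contDiff_im f hf).continuousOn.mono Ioo_subset_Icc_self).const_smul _)).inner hw')
  set s : ℝ → ℂ := fun t => ((Real.sqrt (α t) : ℝ) : ℂ) with hs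
  set s' : ℝ → ℂ := fun t => ((deriv α t / (2 * Real.sqrt (α t)) : ℝ) : ℂ) with hs'
  have hsd : ∀ t ∈ Ioo (0 : ℝ) 1, HasDerivAt s (s' t) t := fun t ht =>
    ((S.weight.hasDerivAt ht).sqrt (S.weight.pos' t ht).ne').ofReal_comp
  have hsc : ContinuousOn s (Ioo 0 1) := S.weight.continuousOn_sqrt
  have hs'c : ContinuousOn s' (Ioo 0 1) := by
    refine Complex.continuous_ofReal.comp_continuousOn (S.weight.continuousOn_deriv.div
      (continuousOn_const.mul (Real.continuous_sqrt.comp_continuousOn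
        (S.weight.continuousOn.mono Ioo_subset_Icc_self))) fun t ht => ?_)
    have := Real.sqrt_pos.2 (S.weight.pos' t ht)
    positivity
  -- The pairing in `L²_α` tests `√α ⟪f, w⟫` rather than `⟪f, w⟫`, so the equation is proved for the
  -- product and the factor `√α` is divided out.
  have hweak := hasDerivAt_of_weak (a := fun t => s t * b t)
    (m := fun t => s' t * b t + s t * k t) (hsc.mul hbc) ((hs'c.mul hbc).add (hsc.mul hkc))
    (fun g h1 h2 h3 => ?_) ht
  · have h4 := hweak.div (hsd t ht) (S.weight.sqrt_ne_zero ht)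
    have h5 := S.weight.sqrt_ne_zero ht
    change s t ≠ 0 at h5
    refine (h4.congr_of_eventuallyEq ?_).congr_deriv ?_
    · filter_upwards [isOpen_Ioo.mem_nhds ht] with r hr
      have h6 := S.weight.sqrt_ne_zero hr
      change s r ≠ 0 at h6
      simp only [Pi.div_apply]
      field_simp
    · field_simp
      ring
  · have hφ := isTestFun_ofReal h1 h2 h3
    obtain ⟨q, hq, hq1, hq2⟩ := S.exists_generatorPlus hφ hf
    have hq1 := generatorsPlus_ae S.weight S.coeff hφ hf hq1 hq2
    have h4 := S.mem_graph_maximalOp_iff.1 hu q hq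
    rw [inner_smul_right, ← sub_eq_zero, S.weight.inner_eq, S.weight.inner_eq,
      ← integral_const_mul, ← integral_sub
      (integrable_inner_of_memLp (S.weight.memLp_iff.1 (Lp.memLp _))
        (S.weight.memLp_iff.1 (Lp.memLp _)))
      ((integrable_inner_of_memLp (S.weight.memLp_iff.1 (Lp.memLp _))
        (S.weight.memLp_iff.1 (Lp.memLp _))).const_mul _)] at h4
    rw [← neg_eq_zero, ← h4, ← integral_neg]
    refine integral_congr_ae ?_
    filter_upwards [hq1, huw] with t h5 h6
    rw [h5.1, h5.2, h6]
    have h7 : deriv (fun t => (g t : ℂ)) t = ((deriv g t : ℝ) : ℂ) :=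
      ((h1.differentiable (by simp)).differentiableAt.hasDerivAt.ofReal_comp).deriv
    simp only [weightedTest, weightedTestDeriv, h7, inner_add_left, inner_neg_left, inner_smul_left,
      map_add, map_mul, Complex.conj_ofReal]
    simp only [hb, hk, hs, hs']
    ring

/-- Since `⟪f, Y w⟫ = ⟪V f, w⟫`, the scalar equation is used with the moving vector `V t f`, whose
derivative cancels the `A_i` term. -/
theorem isMildSolution_of_mem_graph (S : IsSystem α Ar Ai C D J V Y) {lam : ℂ}
    {u : WeightedL2 H α} (hu : (u, lam • u) ∈ (maximalOp α Ar Ai D).graph) {w : ℝ → H}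
    (hw : ContinuousOn w (Icc 0 1))
    (huw : ∀ᵐ t ∂unitMeasure, ((Real.sqrt (α t) : ℝ) : ℂ) • u t = w t) :
    IsMildSolution J (fun t => Y t (w t)) (fun t => lam • Y t (w t)) := by
  have hz : ContinuousOn (fun t => Y t (w t)) (Icc 0 1) := fun t ht => by
    refine tendsto_apply_apply (M := 1) ?_ (hw t ht) (S.evolution.continuousOn_Y (w t) t ht)
    filter_upwards [self_mem_nhdsWithin] with r hr
    exact norm_le_one_of_forall (S.evolution.norm_Y r hr)
  have hin : ∀ x, ∀ t ∈ Icc (0 : ℝ) 1, ⟪V t x, w t⟫_ℂ = ⟪x, Y t (w t)⟫_ℂ := fun x t ht => by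
    have h1 := S.evolution.inner_V ht (V t x) (Y t (w t))
    rwa [S.evolution.V_Y t ht, S.evolution.Y_V t ht] at h1
  have hd : ∀ f ∈ D, ∀ t ∈ Ioo (0 : ℝ) 1, HasDerivAt (fun r => ⟪f, Y r (w r)⟫_ℂ)
      (lam * ⟪f, Y t (w t)⟫_ℂ - ⟪app C f, Y t (w t)⟫_ℂ) t := by
    intro f hf t ht
    have htc := Ioo_subset_Icc_self ht
    have h1 := hasDerivAt_inner_of_continuousAt
      ((S.evolution.deriv_V t htc f hf).hasDerivAt (Icc_mem_nhds ht.1 ht.2))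
      ((hw t htc).continuousAt (Icc_mem_nhds ht.1 ht.2))
      (S.hasDerivAt_inner_of_mem_graph hu hw huw (S.evolution.V_mem t htc f hf) ht)
    refine (h1.congr_of_eventuallyEq ?_).congr_deriv ?_
    · filter_upwards [isOpen_Ioo.mem_nhds ht] with r hr
        using (hin f r (Ioo_subset_Icc_self hr)).symm
    · rw [S.app_V htc hf, inner_sub_left, inner_neg_left, hin _ t htc, hin _ t htc]
      ring
  refine isMildSolution_of_inner hz (hz.const_smul lam) S.coeff.dense fun f hf t ht => ?_
  -- Testing with `J f` replaces `C` by the bounded operator `C J = 1 - J`.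
  have h1 := hd (J f) (S.coeff.resolvent_mem S.resolvent hf) t ht
  refine (h1.congr_of_eventuallyEq (Eventually.of_forall fun r => (S.inner_J _ _).symm)).congr_deriv ?_
  rw [S.resolvent.app_apply, S.inner_J, inner_sub_left, S.inner_J, inner_sub_right,
    inner_add_right, map_smul, inner_smul_right]
  ring

/-- If `e^{λ} e^{-C} x = W x` only for `x = 0`, then `λ` is not an eigenvalue of `L_W`. -/
theorem eq_zero_of_mem_graph_extensionOp (S : IsSystem α Ar Ai C D J V Y) (hV : V 1 = U 1 0)
    {lam : ℂ} (hinj : ∀ x, propagator J lam 1 x = W x → x = 0) {u : WeightedL2 H α}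
    (hu : (u, lam • u) ∈ (extensionOp α Ar Ai D U W).graph) : u = 0 := by
  obtain ⟨-, ⟨w, hw, huw, hb⟩, hu⟩ := mem_graph_extensionOp_iff.1 hu
  have huw := S.weight.ae_iff.1 huw
  have hz := S.isMildSolution_of_mem_graph hu hw huw
  have h01 : (0 : ℝ) ∈ Icc (0 : ℝ) 1 := left_mem_Icc.2 zero_le_one
  have h11 : (1 : ℝ) ∈ Icc (0 : ℝ) 1 := right_mem_Icc.2 zero_le_one
  have hY0 : ∀ x, Y 0 x = x := fun x => by
    have h1 := S.evolution.Y_V 0 h01 x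
    rwa [S.evolution.V_zero] at h1
  have hz1 : Y 1 (w 1) = W (w 0) := by
    rw [hb, ← hV]
    exact S.evolution.Y_V 1 h11 _
  have hp := fun t ht => S.eq_propagator hz (t := t) ht
  simp only [hY0] at hp
  have hw0 : w 0 = 0 := hinj _ (by rw [← hz1, hp 1 h11])
  refine Lp.ext (S.weight.ae_iff.2 ?_)
  filter_upwards [huw, S.weight.ae_iff.1 (Lp.coeFn_zero H 2 (weightMeasure α)), ae_unit_mem]
    with t h1 h2 ht
  have htc := Ioo_subset_Icc_self ht
  have h3 : w t = 0 := by
    rw [← S.evolution.V_Y t htc (w t), hp t htc, hw0, map_zero, map_zero]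
  rw [h2]
  exact (smul_eq_zero.1 (h1.trans h3)).resolve_left (S.weight.sqrt_ne_zero ht)

end IsSystem
end NormalExt

/-! ### Regular points of `L_W` and invertibility of `W - e^λ e^{-C}`. -/

namespace NormalExt
open Filter Topology

section

variable {H : Type*} [NormedAddCommGroup H] [InnerProductSpace ℂ H] [CompleteSpace H]

/-- For a normal operator the orthogonal complement of the range is the kernel, so a lower bound
gives dense as well as closed range. -/
theorem isUnit_of_isStarNormal {T : H →L[ℂ] H} (hT : IsStarNormal T) {c : ℝ}
    (h : ∀ x, ‖x‖ ≤ c * ‖T x‖) : IsUnit T := by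
  have hc : ∀ x, ‖x‖ ≤ (c.toNNReal : ℝ) * ‖T x‖ := fun x =>
    (h x).trans (mul_le_mul_of_nonneg_right (Real.le_coe_toNNReal c) (norm_nonneg _))
  rw [ContinuousLinearMap.isUnit_iff_bijective,
    ContinuousLinearMap.bijective_iff_dense_range_and_antilipschitz]
  refine ⟨?_, _, T.antilipschitz_of_bound hc⟩
  rw [Submodule.topologicalClosure_eq_top_iff,
    ContinuousLinearMap.IsStarNormal.orthogonal_range hT]
  refine (Submodule.eq_bot_iff _).2 fun x hx => ?_
  have h1 := hc x
  have h2 : T x = 0 := hx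
  rw [h2, norm_zero, mul_zero] at h1
  exact norm_le_zero_iff.1 h1

theorem norm_semigroup_apply_le_propagator {J : H →L[ℂ] H} (lam : ℂ) {t : ℝ} (ht : t ∈ Icc (0 : ℝ) 1) (x : H) :
    ‖semigroup J t x‖ ≤ Real.exp ‖lam‖ * ‖propagator J lam t x‖ := by
  have h1 : semigroup J t x = Complex.exp (-lam * t) • propagator J lam t x := by
    rw [propagator_apply, smul_smul, ← Complex.exp_add]
    simp
  rw [h1, norm_smul]
  have h2 := norm_cexp_mul_le (-lam) ht
  rw [norm_neg] at h2
  gcongr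

end

variable {H : Type*} [NormedAddCommGroup H] [InnerProductSpace ℂ H] [CompleteSpace H]
  [TopologicalSpace.SeparableSpace H]
  {α : ℝ → ℝ} {Ar Ai : ℝ → H →ₗ.[ℂ] H} {C : H →ₗ.[ℂ] H} {D : Submodule ℂ H}
  {J : H →L[ℂ] H} {V Y : ℝ → H →L[ℂ] H} {U : ℝ → ℝ → H →L[ℂ] H} {W : H →L[ℂ] H}
  {Φ : Lp H 2 unitMeasure ≃ₗᵢ[ℂ] WeightedL2 H α} {lam : ℂ}

namespace IsSystem

theorem exists_isResolventAt_extensionOp (S : IsSystem α Ar Ai C D J V Y)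
    (hΦ : IsWeightedEquiv V Φ) (hV : V 1 = U 1 0) (hWi : ∀ x y, ⟪W x, W y⟫_ℂ = ⟪x, y⟫_ℂ)
    (hWJ : Commute J W) (hT : IsUnit (W - propagator J lam 1)) :
    ∃ R, IsResolventAt (extensionOp α Ar Ai D U W) lam R := by
  obtain ⟨T, hT⟩ := hT
  set Q : H →L[ℂ] H := ((T⁻¹ : (H →L[ℂ] H)ˣ) : H →L[ℂ] H) with hQ
  have h1 : ∀ d, propagator J lam 1 (Q d) + d = W (Q d) := fun d => by
    have h2 : ((T : H →L[ℂ] H) * Q) d = d := by rw [hQ, Units.mul_inv]; rfl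
    rw [hT] at h2
    have h3 : W (Q d) - propagator J lam 1 (Q d) = d := h2
    exact (sub_eq_iff_eq_add'.1 h3).symm
  have hinj : ∀ x, propagator J lam 1 x = W x → x = 0 := fun x hx => by
    have h2 : (Q * (T : H →L[ℂ] H)) x = x := by rw [hQ, Units.inv_mul]; rfl
    have h3 : (T : H →L[ℂ] H) x = 0 := by
      rw [hT]
      exact sub_eq_zero.2 hx.symm
    rw [← h2]
    change Q ((T : H →L[ℂ] H) x) = 0
    rw [h3, map_zero]
  have hg := S.mem_graph_solutionOp hΦ hV hWi hWJ h1
  generalize S.isPosResolvent.solutionOp Q lam = K at hg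
  let R : WeightedL2 H α →L[ℂ] WeightedL2 H α :=
    (Φ.toContinuousLinearEquiv : _ →L[ℂ] _) ∘L K ∘L (Φ.symm.toContinuousLinearEquiv : _ →L[ℂ] _)
  have hR : ∀ v, (R v, lam • R v + v) ∈ (extensionOp α Ar Ai D U W).graph := fun v => by
    have h2 := hg (Φ.symm v)
    rw [map_add, map_smul, Φ.apply_symm_apply] at h2
    exact h2
  refine ⟨R, fun v => mem_domain_of_graph (hR v), fun v => ?_, fun u hu => ?_⟩
  · rw [app_of_graph (hR v)]
    abel
  · set v := app (extensionOp α Ar Ai D U W) u - lam • u with hv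
    have h2 := Submodule.sub_mem _ (hR v) (mem_graph_app hu)
    have h3 : (R v, lam • R v + v) - (u, app (extensionOp α Ar Ai D U W) u) =
        (R v - u, lam • (R v - u)) := by
      rw [Prod.mk_sub_mk, hv, smul_sub]
      congr 1
      abel
    rw [h3] at h2
    exact sub_eq_zero.1 (S.eq_zero_of_mem_graph_extensionOp hV hinj h2)

/-- Every mild solution with the right boundary values lies in the domain of `L_W`, so the resolvent
yields an a priori estimate. -/
theorem norm_le_of_isResolventAt (S : IsSystem α Ar Ai C D J V Y)
    (hΦ : IsWeightedEquiv V Φ) (hV : V 1 = U 1 0) (hWi : ∀ x y, ⟪W x, W y⟫_ℂ = ⟪x, y⟫_ℂ)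
    (hWJ : Commute J W) {R : WeightedL2 H α →L[ℂ] WeightedL2 H α}
    (hR : IsResolventAt (extensionOp α Ar Ai D U W) lam R) {z η : ℝ → H}
    (h : IsMildSolution J z η) (hb : z 1 = W (z 0)) {M : ℝ} (hM : 0 ≤ M)
    (hη : ∀ t ∈ Icc (0 : ℝ) 1, ‖η t - lam • z t‖ ≤ M) :
    ‖toL2 h.continuousOn‖ ≤ ‖R‖ * M := by
  obtain ⟨v, hv, -⟩ := S.exists_mem_graph_maximalOpPlus_of_mild hΦ hWi hWJ h hb
  have hg : (Φ (toL2 h.continuousOn), Φ (toL2 h.continuousOn_rhs)) ∈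
      (extensionOp α Ar Ai D U W).graph := by
    refine mem_graph_extensionOp_iff.2 ⟨mem_domain_of_graph hv, ?_, S.mem_graph_maximalOp hΦ h⟩
    rw [← hV]
    exact S.mem_boundaryCondition hΦ _ hb
  have h1 := hR.left_inv _ (mem_domain_of_graph hg)
  rw [app_of_graph hg, ← map_smul, ← map_sub] at h1
  have hc : ContinuousOn (fun t => η t - lam • z t) (Icc 0 1) :=
    h.continuousOn_rhs.sub (h.continuousOn.const_smul lam)
  have h2 : toL2 hc = toL2 h.continuousOn_rhs - lam • toL2 h.continuousOn := by
    refine toL2_eq _ ?_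
    filter_upwards [Lp.coeFn_sub (toL2 h.continuousOn_rhs) (lam • toL2 h.continuousOn),
      Lp.coeFn_smul lam (toL2 h.continuousOn), coeFn_toL2 h.continuousOn,
      coeFn_toL2 h.continuousOn_rhs] with t h1 h2 h3 h4
    rw [h1, Pi.sub_apply, h2, Pi.smul_apply, h3, h4]
  rw [← h2] at h1
  rw [← Φ.norm_map (toL2 h.continuousOn), ← h1]
  refine R.le_opNorm_of_le ?_
  rw [Φ.norm_map]
  exact norm_toL2_le hc hM fun t ht => hη t (Ioo_subset_Icc_self ht)

/-- Write `h = (W - e^λ E) x` with `E = e^{-C}`. The function `z(t) = e^{-t(C-λ)} E x + t E h`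
satisfies `z(1) = E W x = W z(0)`, and `z' + C z - λ z = E h + t C E h - λ t E h` is bounded by a
multiple of `‖h‖`. The extra factor `E` is what makes `C E h` meaningful and bounded. -/
theorem exists_norm_semigroup_le (S : IsSystem α Ar Ai C D J V Y)
    (hΦ : IsWeightedEquiv V Φ) (hV : V 1 = U 1 0) (hWi : ∀ x y, ⟪W x, W y⟫_ℂ = ⟪x, y⟫_ℂ)
    (hWJ : Commute J W) {R : WeightedL2 H α →L[ℂ] WeightedL2 H α}
    (hR : IsResolventAt (extensionOp α Ar Ai D U W) lam R) :
    ∃ c : ℝ, ∀ x, ‖semigroup J 1 (semigroup J 1 x)‖ ≤ c * ‖(W - propagator J lam 1) x‖ := by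
  have hJ := S.isPosResolvent
  set N := smoothing J 1 with hN
  set c₁ : ℝ := 1 + (‖N‖ + 1) + ‖lam‖ with hc₁
  refine ⟨Real.exp ‖lam‖ * (‖R‖ * c₁ + 1), fun x => ?_⟩
  set h₀ := (W - propagator J lam 1) x with hh₀
  set x' := semigroup J 1 x with hx'
  set h' := semigroup J 1 h₀ with hh'
  -- This is `C E h`, since `N = (1 + C) E`.
  set k := N h₀ - h' with hk
  have hh'n : ‖h'‖ ≤ ‖h₀‖ := hJ.norm_semigroup_apply_le zero_le_one h₀
  have hkn : ‖k‖ ≤ (‖N‖ + 1) * ‖h₀‖ := by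
    refine (norm_sub_le _ _).trans ?_
    linarith [N.le_opNorm h₀]
  have hJk : J k = h' - J h' := by
    rw [hk, map_sub, ← hJ.semigroup_eq one_pos]
  have hp := hJ.isMildSolution_propagator lam x'
  have hz : IsMildSolution J (fun t => propagator J lam t x' + (t : ℂ) • h')
      (fun t => lam • propagator J lam t x' + (h' + (t : ℂ) • k)) := by
    have hc : ∀ y : H, ContinuousOn (fun t : ℝ => (t : ℂ) • y) (Icc 0 1) := fun y =>
      (Complex.continuous_ofReal.smul continuous_const).continuousOn
    refine ⟨hp.continuousOn.add (hc h'), hp.continuousOn_rhs.add (continuousOn_const.add (hc k)),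
      fun t ht => ?_⟩
    have h1 : HasDerivAt (fun r : ℝ => (r : ℂ) • J h') (J h') t := by
      have h2 := (hasDerivAt_id t).ofReal_comp.smul_const (J h')
      simpa using h2
    refine (((hp.hasDerivAt t ht).add h1).congr_of_eventuallyEq
      (Eventually.of_forall fun r => ?_)).congr_deriv ?_
    · simp only [map_add, map_smul, Pi.add_apply]
    · simp only [map_add, map_smul, hJk]
      module
  have hbd : (fun t : ℝ => propagator J lam t x' + (t : ℂ) • h') 1 =
      W ((fun t : ℝ => propagator J lam t x' + (t : ℂ) • h') 0) := by
    have h1 : propagator J lam 1 x' = semigroup J 1 (propagator J lam 1 x) := by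
      rw [propagator_apply, propagator_apply, map_smul]
    have h2 : semigroup J 1 (W x) = W x' :=
      DFunLike.congr_fun (commute_semigroup hWJ 1).eq x
    simp only [propagator_zero, Complex.ofReal_one, one_smul, Complex.ofReal_zero, zero_smul,
      add_zero]
    rw [h1, hh', ← map_add]
    change semigroup J 1 (propagator J lam 1 x + (W x - propagator J lam 1 x)) = W x'
    rw [add_sub_cancel, h2]
  have hbound := S.norm_le_of_isResolventAt hΦ hV hWi hWJ hR hz hbd
    (M := c₁ * ‖h₀‖) (by positivity) fun t ht => by
      have e : lam • propagator J lam t x' + (h' + (t : ℂ) • k) -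
          lam • (propagator J lam t x' + (t : ℂ) • h') = h' + (t : ℂ) • k - lam • (t : ℂ) • h' := by
        module
      have ht1 : ∀ y : H, ‖(t : ℂ) • y‖ ≤ ‖y‖ := fun y => by
        rw [norm_smul, Complex.norm_real, Real.norm_of_nonneg ht.1]
        exact mul_le_of_le_one_left (norm_nonneg _) ht.2
      rw [e]
      have h1 : ‖lam • (t : ℂ) • h'‖ ≤ ‖lam‖ * ‖h₀‖ := by
        rw [norm_smul]
        exact mul_le_mul_of_nonneg_left ((ht1 _).trans hh'n) (norm_nonneg _)
      have h2 := norm_sub_le (h' + (t : ℂ) • k) (lam • (t : ℂ) • h')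
      have h3 := norm_add_le h' ((t : ℂ) • k)
      have h4 := ht1 k
      rw [hc₁]
      linarith
  set m := toL2 hz.continuousOn with hm
  -- Writing `E² x` as the contraction `e^{-(1-t)C}` applied to `e^{-tC} E x` bounds it by the
  -- solution at every time `t`; integrating over `(0,1)` brings in its `L²` norm.
  have hpt : ∀ᵐ t ∂unitMeasure, ‖semigroup J 1 x'‖ ≤ Real.exp ‖lam‖ * (‖m t‖ + ‖h₀‖) := by
    filter_upwards [coeFn_toL2 hz.continuousOn, ae_unit_mem] with t h1 ht
    have htc := Ioo_subset_Icc_self ht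
    have h2 : semigroup J 1 x' = semigroup J (1 - t) (semigroup J t x') := by
      rw [← hJ.semigroup_add_apply (sub_nonneg.2 htc.2) htc.1, sub_add_cancel]
    have h3 := hJ.norm_semigroup_apply_le (sub_nonneg.2 htc.2) (semigroup J t x')
    rw [← h2] at h3
    refine h3.trans ((norm_semigroup_apply_le_propagator lam htc x').trans ?_)
    gcongr
    rw [h1]
    have h4 : propagator J lam t x' = propagator J lam t x' + (t : ℂ) • h' - (t : ℂ) • h' := by
      abel
    have h5 : ‖(t : ℂ) • h'‖ ≤ ‖h₀‖ := by
      rw [norm_smul, Complex.norm_real, Real.norm_of_nonneg htc.1]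
      exact (mul_le_of_le_one_left (norm_nonneg _) htc.2).trans hh'n
    calc ‖propagator J lam t x'‖ = _ := congrArg norm h4
      _ ≤ ‖propagator J lam t x' + (t : ℂ) • h'‖ + ‖(t : ℂ) • h'‖ := norm_sub_le _ _
      _ ≤ _ := by gcongr
  have hi := integral_mono_ae (integrable_const _)
    (((integrable_coeFn m).norm.add (integrable_const ‖h₀‖)).const_mul (Real.exp ‖lam‖)) hpt
  simp only [Pi.add_apply] at hi
  rw [integral_const_mul, integral_add (integrable_coeFn m).norm (integrable_const _),
    integral_const, integral_const, probReal_univ, one_smul, one_smul] at hi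
  refine hi.trans ?_
  rw [mul_assoc]
  gcongr
  have h1 := (integral_norm_le_norm m).trans hbound
  linarith

/-- Here `T` is normal because `W` is unitary and commutes with the self-adjoint `e^{-C}`. The
estimate on `e^{-2C} x` becomes a lower bound for `T`, since `W x = T x + e^λ e^{-C} x` and `W` is
isometric. -/
theorem isUnit_of_isResolventAt (S : IsSystem α Ar Ai C D J V Y)
    (hΦ : IsWeightedEquiv V Φ) (hV : V 1 = U 1 0) (hW : W ∈ unitary (H →L[ℂ] H))
    (hWJ : Commute J W) {R : WeightedL2 H α →L[ℂ] WeightedL2 H α}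
    (hR : IsResolventAt (extensionOp α Ar Ai D U W) lam R) :
    IsUnit (W - propagator J lam 1) := by
  have hJ := S.isPosResolvent
  have hWn : ∀ x, ‖W x‖ = ‖x‖ := fun x => ContinuousLinearMap.norm_map_of_mem_unitary hW x
  have hWi : ∀ x y, ⟪W x, W y⟫_ℂ = ⟪x, y⟫_ℂ :=
    (LinearMap.norm_map_iff_inner_map_map W).1 hWn
  obtain ⟨c, hc⟩ := S.exists_norm_semigroup_le hΦ hV hWi hWJ hR
  set T := W - propagator J lam 1 with hT
  have hWE : Commute (semigroup J 1) W := commute_semigroup hWJ 1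
  have hTE : ∀ x, T (semigroup J 1 x) = semigroup J 1 (T x) := fun x => by
    have h1 : Commute T (semigroup J 1) :=
      hWE.symm.sub_left ((Commute.refl _).smul_left _)
    exact DFunLike.congr_fun h1.eq x
  have hsplit : ∀ x, ‖x‖ ≤ ‖T x‖ + Real.exp ‖lam‖ * ‖semigroup J 1 x‖ := fun x => by
    have h1 : W x = T x + Complex.exp (lam * (1 : ℝ)) • semigroup J 1 x := by
      rw [← propagator_apply]
      simp [hT]
    rw [← hWn x, h1]
    refine (norm_add_le _ _).trans ?_
    rw [norm_smul]
    gcongr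
    exact norm_cexp_mul_le lam ⟨zero_le_one, le_rfl⟩
  -- The constant comes from applying `hsplit` at `x` and at `e^{-C} x`, then the bound for `e^{-2C}
  -- x`.
  refine isUnit_of_isStarNormal (c := 1 + Real.exp ‖lam‖ * (1 + Real.exp ‖lam‖ * c)) ?_ fun x => ?_
  · have hE : IsStarNormal (propagator J lam 1) := by
      have := (isSelfAdjoint_semigroup J 1).isStarNormal
      unfold propagator
      infer_instance
    have hEs : star (propagator J lam 1) =
        (starRingEnd ℂ) (Complex.exp (lam * (1 : ℝ))) • semigroup J 1 := by
      rw [propagator, star_smul, (isSelfAdjoint_semigroup J 1).star_eq]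
      rfl
    have h1 : Commute (star (propagator J lam 1)) W := by
      rw [hEs]
      exact hWE.smul_left _
    have h2 : Commute (star W) (propagator J lam 1) := by
      have := h1.star_star
      rw [star_star] at this
      exact this.symm
    have hWs : Commute (star W) W := by
      rw [Commute, SemiconjBy, Unitary.star_mul_self_of_mem hW, Unitary.mul_star_self_of_mem hW]
    refine ⟨?_⟩
    rw [hT, star_sub]
    exact (hWs.sub_right h2).sub_left (h1.sub_right hE.star_comm_self)
  · have h1 := hsplit x
    have h2 := hsplit (semigroup J 1 x)
    have h3 := hc x
    have h4 : ‖T (semigroup J 1 x)‖ ≤ ‖T x‖ := by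
      rw [hTE]
      exact hJ.norm_semigroup_apply_le zero_le_one _
    have he := Real.exp_pos ‖lam‖
    calc ‖x‖ ≤ ‖T x‖ + Real.exp ‖lam‖ * ‖semigroup J 1 x‖ := h1
      _ ≤ ‖T x‖ + Real.exp ‖lam‖ * (‖T x‖ + Real.exp ‖lam‖ * (c * ‖T x‖)) := by
          gcongr
          exact h2.trans (by gcongr)
      _ = _ := by ring

end IsSystem
end NormalExt

/-! ### From invertibility of `W - e^λ e^{-C}` to the spectrum formula. -/

namespace NormalExt
open Filter Topology

/-- The formula lists `2πi n - Log μ`, that is, all values of `-log μ`. -/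
theorem exists_eq_iff_exp_neg_mem {s : Set ℂ} {z : ℂ} :
    (∃ n : ℤ, ∃ μ ∈ s, μ ≠ 0 ∧ z = ((Real.log ‖μ‖⁻¹ : ℝ) : ℂ)
      + Complex.I * (((2 * (n : ℝ) * Real.pi - Complex.arg μ : ℝ)) : ℂ)) ↔
      Complex.exp (-z) ∈ s := by
  have hlog : ∀ (n : ℤ) (μ : ℂ), ((Real.log ‖μ‖⁻¹ : ℝ) : ℂ)
      + Complex.I * (((2 * (n : ℝ) * Real.pi - Complex.arg μ : ℝ)) : ℂ) =
      n * (2 * Real.pi * Complex.I) - Complex.log μ := fun n μ => by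
    rw [Complex.log, Real.log_inv]
    push_cast
    ring
  simp only [hlog]
  constructor
  · rintro ⟨n, μ, hμ, h0, rfl⟩
    rwa [neg_sub, Complex.exp_sub, Complex.exp_int_mul_two_pi_mul_I, div_one, Complex.exp_log h0]
  · intro h
    obtain ⟨n, hn⟩ := Complex.exp_eq_exp_iff_exists_int.1 (Complex.exp_log (Complex.exp_ne_zero (-z)))
    refine ⟨n, _, h, Complex.exp_ne_zero _, ?_⟩
    rw [hn]
    ring

/-- The factorization `W - e^z E = e^z W (e^{-z} - W^* E)` has an invertible first factor. -/
theorem exp_neg_mem_spectrum_iff {H : Type*} [NormedAddCommGroup H] [InnerProductSpace ℂ H]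
    [CompleteSpace H] {J W : H →L[ℂ] H} (hW : W ∈ unitary (H →L[ℂ] H)) {z : ℂ} :
    Complex.exp (-z) ∈ spectrum ℂ (star W * semigroup J 1) ↔
      ¬ IsUnit (W - propagator J z 1) := by
  have hu : IsUnit (Complex.exp z • W) := by
    have h1 : IsUnit W := ⟨⟨W, star W, Unitary.mul_star_self_of_mem hW,
      Unitary.star_mul_self_of_mem hW⟩, rfl⟩
    have h2 := (isUnit_iff_ne_zero.2 (Complex.exp_ne_zero z)).map (algebraMap ℂ (H →L[ℂ] H))
    have h3 := h2.mul h1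
    rwa [← Algebra.smul_def] at h3
  obtain ⟨u, hu⟩ := hu
  have h : W - propagator J z 1 =
      u * (algebraMap ℂ (H →L[ℂ] H) (Complex.exp (-z)) - star W * semigroup J 1) := by
    rw [hu, mul_sub, smul_mul_assoc, smul_mul_assoc, ← mul_assoc,
      Unitary.mul_star_self_of_mem hW, one_mul, Algebra.algebraMap_eq_smul_one, mul_smul_comm,
      mul_one, smul_smul, ← Complex.exp_add, add_neg_cancel, Complex.exp_zero, one_smul, propagator,
      Complex.ofReal_one, mul_one]
  rw [spectrum.mem_iff, h, Units.isUnit_units_mul]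

theorem unboundedSpectrum_of_subsingleton {E : Type*} [NormedAddCommGroup E]
    [InnerProductSpace ℂ E] [Subsingleton E] (T : E →ₗ.[ℂ] E) : unboundedSpectrum T = ∅ := by
  refine eq_empty_of_forall_notMem fun z hz => hz ⟨0, fun x => ?_, fun x => Subsingleton.elim _ _,
    fun x _ => Subsingleton.elim _ _⟩
  rw [Subsingleton.elim ((0 : E →L[ℂ] E) x) 0]
  exact T.domain.zero_mem

instance {H : Type*} [NormedAddCommGroup H] [Subsingleton H] (μ : Measure ℝ) :
    Subsingleton (Lp H 2 μ) :=
  ⟨fun _ _ => Lp.ext (Eventually.of_forall fun _ => Subsingleton.elim _ _)⟩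

end NormalExt

end

theorem theorem6 {H : Type*} [NormedAddCommGroup H] [InnerProductSpace ℂ H] [CompleteSpace H]
    [TopologicalSpace.SeparableSpace H]
    (α : ℝ → ℝ) (hα : NormalExt.IsWeight α)
    (Ar Ai : ℝ → H →ₗ.[ℂ] H) (C : H →ₗ.[ℂ] H) (D : Submodule ℂ H)
    (hA : NormalExt.IsNormalCoeff α Ar Ai C D)
    (U : ℝ → ℝ → H →L[ℂ] H) (hU : NormalExt.IsEvolutionFamily D Ai U)
    (W : H →L[ℂ] H) (hW : W ∈ unitary (H →L[ℂ] H)) (hWC : NormalExt.BoundedCommutes W C) :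
    NormalExt.unboundedSpectrum (NormalExt.extensionOp α Ar Ai D U W) =
      {z : ℂ | ∃ n : ℤ, ∃ μ ∈ spectrum ℂ (star W * NormalExt.expNeg C), μ ≠ 0 ∧
        z = ((Real.log ‖μ‖⁻¹ : ℝ) : ℂ)
          + Complex.I * (((2 * (n : ℝ) * Real.pi - Complex.arg μ : ℝ)) : ℂ)} := by
  ext z
  rw [mem_ofPred_eq, NormalExt.exists_eq_iff_exp_neg_mem]
  -- In the zero space nothing prevents zeros of `α`, but both spectra are empty; otherwise a
  -- nonzero vector of `D` is available to prove `α > 0` on `(0,1)`.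
  rcases subsingleton_or_nontrivial H with hH | hH
  · rw [NormalExt.unboundedSpectrum_of_subsingleton, spectrum.of_subsingleton]
    rfl
  · have hJ := NormalExt.isResolventAt_resolventOp (NormalExt.exists_isResolventAt_neg_one
      hA.selfAdjoint_const hA.nonneg_const)
    rw [NormalExt.expNeg_eq_semigroup, NormalExt.exp_neg_mem_spectrum_iff hW]
    set J := NormalExt.resolventOp C (-1)
    have hE := hU.isEvolutionPair hA.dense hA.selfAdjoint_im hA.le_domain_im
    have S : NormalExt.IsSystem α Ar Ai C D J (fun t => U t 0) (fun t => U 0 t) :=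
      ⟨⟨hα, fun t ht => hα.pos hA ht⟩, hA, hJ, hE⟩
    obtain ⟨Φ, hΦ⟩ := NormalExt.exists_weightedEquiv S.weight hE
    have hWJ := hJ.commute_of_boundedCommutes hWC
    have hWi : ∀ x y, ⟪W x, W y⟫_ℂ = ⟪x, y⟫_ℂ := (LinearMap.norm_map_iff_inner_map_map W).1
      fun x => ContinuousLinearMap.norm_map_of_mem_unitary hW x
    refine not_congr ⟨?_, fun h => S.exists_isResolventAt_extensionOp hΦ rfl hWi hWJ h⟩
    rintro ⟨R, hR⟩
    exact S.isUnit_of_isResolventAt hΦ rfl hW hWJ hR
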